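/- Let $N\ge 2$, let $p_1,\dots,p_N\in\mathbb Z$ with $\sum_r p_r=0$, and put $\widetilde p_r=p_r+\frac1N\bigl(r-\frac{N+1}2\bigr)$. Let $q,Q\in\mathbb C$ with $0<|q|<1$ and $|Qq|<1$; fractional powers are principal values. **Partitions.** For a partition $\mu$ let $x_i(\mu)=\mu_i-i+\frac12$ $(i\ge1)$, $\kappa(\mu)=2\sum_{(i,j)\in\mu}(j-i)$, and let $\widetilde\mu$ be the conjugate partition. For partitions $\lambda=(\lambda^{(1)},\dots,\lambda^{(N)})$ let $\mu(\lambda;p)$ be the unique partition with $$\{x_i(\mu(\lambda;p)) : i\ge1\}=\bigcup_{r=1}^N\{N(x_i(\lambda^{(r)})+\widetilde p_r) : i\ge1\}.$$ **Schur functions.** Write $s_\mu(q^{-\rho})=s_\mu(q^{1/2},q^{3/2},q^{5/2},\dots)$. Write $s_{\nu/\chi}(q^{\lambda+\rho})$ for the skew Schur function of the variables $q^{\lambda_i-i+1/2}$ $(i\ge1)$; this is understood as the rational function of $q^{1/2}$ given by the convergent specialization for $|q|>1$, that is, the power sums are $p_k(q^{\lambda+\rho})=\frac1{q^{k/2}-q^{-k/2}}+\sum_{i\le\ell(\lambda)}\bigl(q^{k(\lambda_i-i+1/2)}-q^{k(-i+1/2)}\bigr)$.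 Finally $s_\nu=s_{\nu/\emptyset}$, and $q^\rho$ is the case $\lambda=\emptyset$. **Instanton weight.** $$\mathcal Z_q^{SU(N)\,inst}(\lambda,p,Q)=Q^{\frac12(|\mu(\lambda;p)|-|\mu(\emptyset;p)|)}\,\frac{s_{\mu(\lambda;p)}(q^{-\rho})}{s_{\mu(\emptyset;p)}(q^{-\rho})},$$ where $\mu(\emptyset;p)$ denotes $\mu(\lambda;p)$ with all $\lambda^{(r)}$ empty. **String amplitude** ($A_{N-1}$ fibration over $\mathbb P^1$, framing $N$). $$Z_{string}^{SU(N)}(q,\{Q_{F_r}\},Q_B)=\sum_{\lambda}\Bigl[Q_B^{\frac12\sum_r|\lambda^{(r)}|}\,q^{-\frac12\sum_r r\kappa(\lambda^{(r)})}\prod_{r=1}^{N-1}Q_{F_r}^{\,r\sum_{s>r}|\lambda^{(s)}|}\prod_{r=1}^N s_{\lambda^{(r)}}(q^\rho)\;A_\lambda(q,\{Q_{F_r}\})\Bigr]^2,$$ $$A_\lambda=\sum_{\nu^{(1)},\dots,\nu^{(N-1)}}\prod_{t=1}^{N-1}Q_{F_t}^{|\nu^{(t)}|}\;s_{\nu^{(1)}}(q^{\lambda^{(1)}+\rho})\,s_{\nu^{(N-1)}}(q^{\widetilde{\lambda^{(N)}}+\rho})\sum_{\chi^{(1)},\dots,\chi^{(N-2)}}\prod_{t=1}^{N-2}s_{\nu^{(t)}/\chi^{(t)}}(q^{\widetilde{\lambda^{(t+1)}}+\rho})\,s_{\nu^{(t+1)}/\chi^{(t)}}(q^{\lambda^{(t+1)}+\rho}).$$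 The series $A_\lambda$ converges for small $Q_F$, and at other $Q_F$ it denotes the value of its meromorphic continuation, taken along the line $z\mapsto(zQ_{F_1},\dots,zQ_{F_{N-1}})$ from $z$ near $0$ to $z=1$. **Claim.** Put $Q_{F_r}=q^{N(\widetilde p_r-\widetilde p_{r+1})}$ for $1\le r\le N-1$. Then for every $\lambda$ the continuation of $A_\lambda(q^N,\cdot)$ along this line exists on all of $\mathbb C$ and is analytic at $z=1$; the infinite products below converge, the sum over $\lambda$ below and the sum over $\lambda$ defining $Z_{string}^{SU(N)}(q^N,\{Q_{F_r}\},Q^N)$ converge absolutely, and $$\sum_{\lambda^{(1)},\dots,\lambda^{(N)}}\mathcal Z_q^{SU(N)\,inst}(\lambda,p,Q)^2=\prod_{1\le r<s\le N}\prod_{k=1}^\infty\Bigl(1-\Bigl(\prod_{t=r}^{s-1}Q_{F_t}\Bigr)q^{Nk}\Bigr)^{2k}\;Z_{string}^{SU(N)}\bigl(q^N,\{Q_{F_r}\},Q^N\bigr).$$ -/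

import Mathlib

open scoped BigOperators Topology

noncomputable section

namespace PlanePartition

/-! ### Partitions and Maya diagrams

Partitions are Young diagrams; `μ.rowLen i` is the part `μ_{i+1}`, `μ.card` is `|μ|`,
`μ.colLen 0` is the number of nonzero parts and `μ.transpose` is the conjugate partition.
-/

/-- `κ(μ) = 2 ∑_{(i,j) ∈ μ} (j - i)`. -/
def kappa (μ : YoungDiagram) : ℤ :=
  2 * ∑ c ∈ μ.cells, ((c.2 : ℤ) - (c.1 : ℤ))

/-- `x_{i+1}(μ) = μ_{i+1} - (i+1) + 1/2`, for `i = 0, 1, 2, …`. -/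
def mayaCoord (μ : YoungDiagram) (i : ℕ) : ℚ :=
  (μ.rowLen i : ℚ) - ((i : ℚ) + 1) + 1 / 2

/-- The Maya diagram `S_μ = {x_i(μ) ; i ≥ 1}`. -/
def mayaSet (μ : YoungDiagram) : Set ℚ := Set.range (mayaCoord μ)

/-- `p̃_r = p_r + (1/N) (r - (N+1)/2)`, where the colour `r = 1, …, N` is `r.val + 1`. -/
def pTilde {N : ℕ} (p : Fin N → ℤ) (r : Fin N) : ℚ :=
  (p r : ℚ) + 1 / (N : ℚ) * (((r.val : ℚ) + 1) - ((N : ℚ) + 1) / 2)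

/-- The set `⋃_r {N (x_i(λ^{(r)}) + p̃_r) ; i ≥ 1}`. -/
def foldedMayaSet {N : ℕ} (p : Fin N → ℤ) (lam : Fin N → YoungDiagram) : Set ℚ :=
  ⋃ r : Fin N, Set.range fun i : ℕ => (N : ℚ) * (mayaCoord (lam r) i + pTilde p r)

theorem mayaCoord_strictAnti (μ : YoungDiagram) : StrictAnti (mayaCoord μ) := by
  refine strictAnti_nat_of_succ_lt fun n => ?_
  have h : (μ.rowLen (n + 1) : ℚ) ≤ μ.rowLen n := by
    exact_mod_cast μ.rowLen_anti n (n + 1) (Nat.le_succ n)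
  simp only [mayaCoord]
  push_cast
  linarith

theorem mayaSet_injective : Function.Injective mayaSet := by
  intro μ ν h
  have key : mayaCoord μ = mayaCoord ν := by
    have h1 : StrictMono fun i => -mayaCoord μ i := fun a b hab =>
      neg_lt_neg (mayaCoord_strictAnti μ hab)
    have h2 : StrictMono fun i => -mayaCoord ν i := fun a b hab =>
      neg_lt_neg (mayaCoord_strictAnti ν hab)
    have h3 : (Set.range fun i => -mayaCoord μ i) = Set.range fun i => -mayaCoord ν i := by
      have e : ∀ ρ : YoungDiagram,
          (Set.range fun i => -mayaCoord ρ i) = (fun x : ℚ => -x) '' mayaSet ρ := by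
        intro ρ
        rw [mayaSet, ← Set.range_comp]
        rfl
      rw [e, e, h]
    have h4 := (h1.range_inj h2).1 h3
    funext i
    have := congrFun h4 i
    simpa using this
  ext ⟨i, j⟩
  have := congrFun key i
  simp only [mayaCoord] at this
  have h5 : μ.rowLen i = ν.rowLen i := by
    have : (μ.rowLen i : ℚ) = ν.rowLen i := by linarith
    exact_mod_cast this
  rw [YoungDiagram.mem_cells, YoungDiagram.mem_cells, YoungDiagram.mem_iff_lt_rowLen,
    YoungDiagram.mem_iff_lt_rowLen, h5]

theorem exists_rowLen_eq (f : ℕ → ℕ) (hf : Antitone f) (n : ℕ) (hn : ∀ i, n ≤ i → f i = 0) :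
    ∃ μ : YoungDiagram, ∀ i, μ.rowLen i = f i := by
  let μ : YoungDiagram :=
    { cells := ((Finset.range n) ×ˢ (Finset.range (f 0))).filter fun c => c.2 < f c.1
      isLowerSet := by
        rintro ⟨a, b⟩ ⟨c, d⟩ ⟨h1, h2⟩ h
        simp only [Finset.coe_filter, Finset.mem_product, Finset.mem_range,
          Set.mem_ofPred_eq] at h ⊢
        simp only at h1 h2
        have := hf h1
        refine ⟨⟨?_, ?_⟩, ?_⟩ <;> omega }
  refine ⟨μ, fun i => ?_⟩
  have hmem : ∀ j, (i, j) ∈ μ ↔ j < f i := by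
    intro j
    have h0 : f i ≤ f 0 := hf (Nat.zero_le i)
    change (i, j) ∈ ((Finset.range n) ×ˢ (Finset.range (f 0))).filter (fun c => c.2 < f c.1) ↔ _
    simp only [Finset.mem_filter, Finset.mem_product, Finset.mem_range]
    constructor
    · exact fun h => h.2
    · intro h
      refine ⟨⟨?_, by omega⟩, h⟩
      by_contra hi
      have := hn i (by omega)
      omega
  apply le_antisymm
  · by_contra hlt
    have h1 := (hmem (f i)).1 (YoungDiagram.mem_iff_lt_rowLen.2 (by omega))
    omega
  · by_contra hlt
    have h1 := YoungDiagram.mem_iff_lt_rowLen.1 ((hmem (μ.rowLen i)).2 (by omega))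
    omega

theorem exists_partition_of_charge_zero (M : ℕ) (F : Finset ℤ) (hcard : F.card = M)
    (hge : ∀ y ∈ F, -(M : ℤ) ≤ y) :
    ∃ μ : YoungDiagram, ∀ y : ℤ,
      (∃ i : ℕ, y = (μ.rowLen i : ℤ) - i - 1) ↔ (y ∈ F ∨ y < -(M : ℤ)) := by
  let e := F.orderEmbOfFin hcard
  have he : ∀ k : ℕ, ∀ hk : k < M, -(M : ℤ) + k ≤ e ⟨k, hk⟩ := by
    intro k
    induction k with
    | zero =>
      intro hk
      have := hge _ (F.orderEmbOfFin_mem hcard ⟨0, hk⟩)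
      simpa using this
    | succ k ih =>
      intro hk
      have h1 := ih (by omega)
      have h2 : e ⟨k, by omega⟩ < e ⟨k + 1, hk⟩ := e.strictMono (by simp)
      push_cast
      omega
  let s : ℕ → ℤ := fun i => if h : i < M then e ⟨M - 1 - i, by omega⟩ else -(i : ℤ) - 1
  have hs1 : ∀ i (h : i < M), s i = e ⟨M - 1 - i, by omega⟩ := fun i h => dif_pos h
  have hs2 : ∀ i, ¬ i < M → s i = -(i : ℤ) - 1 := fun i h => dif_neg h
  have hlow : ∀ i : ℕ, -(i : ℤ) - 1 ≤ s i := by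
    intro i
    by_cases h : i < M
    · rw [hs1 i h]
      have := he (M - 1 - i) (by omega)
      omega
    · rw [hs2 i h]
  have hstep : ∀ i, s (i + 1) < s i := by
    intro i
    by_cases h : i + 1 < M
    · rw [hs1 _ h, hs1 i (by omega)]
      apply e.strictMono
      rw [Fin.mk_lt_mk]
      omega
    · rw [hs2 _ h]
      have := hlow i
      push_cast
      omega
  obtain ⟨μ, hμ⟩ := exists_rowLen_eq (fun i => (s i + i + 1).toNat)
    (antitone_nat_of_succ_le fun i => by
      have := hstep i
      apply Int.toNat_le_toNat
      push_cast
      omega) M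
    (fun i hi => by
      have := hs2 i (by omega)
      change (s i + i + 1).toNat = 0
      omega)
  refine ⟨μ, fun y => ?_⟩
  have hval : ∀ i, (μ.rowLen i : ℤ) - i - 1 = s i := by
    intro i
    have := hlow i
    rw [hμ i, Int.toNat_of_nonneg (by omega)]
    ring
  simp only [hval]
  constructor
  · rintro ⟨i, rfl⟩
    by_cases h : i < M
    · left
      rw [hs1 i h]
      exact F.orderEmbOfFin_mem hcard _
    · right
      rw [hs2 i h]
      omega
  · rintro (h | h)
    · have hr : y ∈ Set.range e := by
        rw [Finset.range_orderEmbOfFin]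
        exact h
      obtain ⟨k, rfl⟩ := hr
      refine ⟨M - 1 - k.val, ?_⟩
      have hk := k.isLt
      rw [hs1 _ (by omega)]
      congr 1
      apply Fin.ext
      simp only
      omega
    · refine ⟨(-y - 1).toNat, ?_⟩
      rw [hs2 _ (by omega)]
      omega

/-- In the neutral sector the set `⋃_r {N (x_i(λ^{(r)}) + p̃_r)}` is the Maya diagram of
exactly one partition. -/
theorem existsUnique_foldedPartition {N : ℕ} (hN : 0 < N) (p : Fin N → ℤ)
    (hp : ∑ r, p r = 0) (lam : Fin N → YoungDiagram) :
    ∃! μ : YoungDiagram, mayaSet μ = foldedMayaSet p lam := by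
  refine existsUnique_of_exists_of_unique ?_ fun μ ν h1 h2 => mayaSet_injective (h1.trans h2.symm)
  -- a cut-off below which every site is occupied
  obtain ⟨K, hK⟩ : ∃ K : ℕ, ∀ r, ((lam r).colLen 0 : ℤ) ≤ K + p r := by
    refine ⟨∑ r, ((lam r).colLen 0 + (p r).natAbs), fun r => ?_⟩
    have := Finset.single_le_sum (f := fun r => (lam r).colLen 0 + (p r).natAbs)
      (fun _ _ => Nat.zero_le _) (Finset.mem_univ r)
    omega
  have hzero : ∀ r i, (lam r).colLen 0 ≤ i → (lam r).rowLen i = 0 := by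
    intro r i hi
    by_contra h
    have h1 : (i, 0) ∈ lam r := YoungDiagram.mem_iff_lt_rowLen.2 (by omega)
    have := YoungDiagram.mem_iff_lt_colLen.1 h1
    omega
  let g : (r : Fin N) → ℕ → ℤ := fun r i =>
    (N : ℤ) * (((lam r).rowLen i : ℤ) - i - 1 + p r) + r.val
  have hN' : (0 : ℤ) < N := by exact_mod_cast hN
  have hginj : ∀ r i r' i', g r i = g r' i' → r = r' ∧ i = i' := by
    intro r i r' i' h
    have hr : r = r' := by
      have h1 : g r i % N = g r' i' % N := by rw [h]
      simp only [g] at h1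
      rw [Int.mul_add_emod_self_left, Int.mul_add_emod_self_left,
        Int.emod_eq_of_lt (by omega) (by exact_mod_cast r.isLt),
        Int.emod_eq_of_lt (by omega) (by exact_mod_cast r'.isLt)] at h1
      exact Fin.ext (by exact_mod_cast h1)
    subst hr
    refine ⟨rfl, ?_⟩
    simp only [g] at h
    have h2 : ((lam r).rowLen i : ℤ) - i - 1 + p r = ((lam r).rowLen i' : ℤ) - i' - 1 + p r := by
      apply mul_left_cancel₀ (ne_of_gt hN')
      linarith
    rcases lt_trichotomy i i' with h3 | h3 | h3
    · have := (lam r).rowLen_anti i i' h3.le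
      omega
    · exact h3
    · have := (lam r).rowLen_anti i' i h3.le
      omega
  let D : Finset (Σ _ : Fin N, ℕ) :=
    Finset.univ.sigma fun r => Finset.range ((K : ℤ) + p r).toNat
  let F : Finset ℤ := D.image fun x => g x.1 x.2
  have hpos : ∀ r, 0 ≤ (K : ℤ) + p r := fun r => by
    have := hK r
    omega
  have hcard : F.card = N * K := by
    have h1 : F.card = D.card := by
      apply Finset.card_image_of_injective
      rintro ⟨r, i⟩ ⟨r', i'⟩ h
      obtain ⟨h1, h2⟩ := hginj _ _ _ _ h
      simp only at h1 h2
      subst h1 h2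
      rfl
    rw [h1, Finset.card_sigma]
    simp only [Finset.card_range]
    have h2 : ((∑ r : Fin N, ((K : ℤ) + p r).toNat : ℕ) : ℤ) = ((N * K : ℕ) : ℤ) := by
      rw [Nat.cast_sum, Finset.sum_congr rfl fun r _ => Int.toNat_of_nonneg (hpos r),
        Finset.sum_add_distrib, hp]
      simp
    exact_mod_cast h2
  have hin : ∀ r i, i < ((K : ℤ) + p r).toNat → -(K : ℤ) ≤ ((lam r).rowLen i : ℤ) - i - 1 + p r := by
    intro r i hi
    omega
  obtain ⟨μ, hμ⟩ := exists_partition_of_charge_zero (N * K) F hcard (by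
    intro y hy
    obtain ⟨⟨r, i⟩, h1, rfl⟩ := Finset.mem_image.1 hy
    have h2 : i < ((K : ℤ) + p r).toNat := by simpa [D] using h1
    have h3 := mul_le_mul_of_nonneg_left (hin r i h2) hN'.le
    simp only [g]
    push_cast
    have : (0 : ℤ) ≤ (r.val : ℤ) := by positivity
    linarith)
  have hS : ∀ y : ℤ, (y ∈ F ∨ y < -((N * K : ℕ) : ℤ)) ↔ ∃ r i, y = g r i := by
    intro y
    constructor
    · rintro (h | h)
      · obtain ⟨⟨r, i⟩, -, rfl⟩ := Finset.mem_image.1 h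
        exact ⟨r, i, rfl⟩
      · have hm0 := Int.emod_nonneg y (ne_of_gt hN')
        have hm1 := Int.emod_lt_of_pos y hN'
        have hdm := Int.mul_ediv_add_emod y N
        set r : Fin N := ⟨(y % N).toNat, by omega⟩ with hr
        have hdiv : y / N < -(K : ℤ) := by
          apply Int.ediv_lt_of_lt_mul hN'
          push_cast at h
          linarith
        have hKr := hK r
        refine ⟨r, (p r - 1 - y / N).toNat, ?_⟩
        have hi : ((p r - 1 - y / N).toNat : ℤ) = p r - 1 - y / N :=
          Int.toNat_of_nonneg (by omega)
        have hrow : (lam r).rowLen (p r - 1 - y / N).toNat = 0 := hzero _ _ (by omega)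
        simp only [g]
        rw [hrow, hi]
        have hrv : ((r.val : ℕ) : ℤ) = y % N := by
          simp only [hr]
          omega
        rw [hrv]
        push_cast
        linarith
    · rintro ⟨r, i, rfl⟩
      by_cases h : i < ((K : ℤ) + p r).toNat
      · left
        exact Finset.mem_image.2 ⟨⟨r, i⟩, by simpa [D] using h, rfl⟩
      · right
        have hKr := hK r
        have h0 := hpos r
        have hrow : (lam r).rowLen i = 0 := hzero _ _ (by omega)
        have h1 : ((lam r).rowLen i : ℤ) - i - 1 + p r ≤ -(K : ℤ) - 1 := by
          rw [hrow]
          push_cast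
          omega
        have h2 := mul_le_mul_of_nonneg_left h1 hN'.le
        have h3 : (r.val : ℤ) < N := by exact_mod_cast r.isLt
        simp only [g]
        push_cast
        linarith
  refine ⟨μ, ?_⟩
  have hNQ : (N : ℚ) ≠ 0 := by exact_mod_cast hN.ne'
  have e1 : ∀ i, mayaCoord μ i = (((μ.rowLen i : ℤ) - i - 1 : ℤ) : ℚ) + 1 / 2 := by
    intro i
    simp only [mayaCoord]
    push_cast
    ring
  have e2 : ∀ r i, (N : ℚ) * (mayaCoord (lam r) i + pTilde p r) = ((g r i : ℤ) : ℚ) + 1 / 2 := by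
    intro r i
    simp only [mayaCoord, pTilde, g]
    push_cast
    field_simp
    ring
  ext x
  simp only [mayaSet, foldedMayaSet, Set.mem_iUnion, Set.mem_range, e1, e2]
  constructor
  · rintro ⟨i, rfl⟩
    obtain ⟨r, i', h⟩ := (hS _).1 ((hμ _).1 ⟨i, rfl⟩)
    exact ⟨r, i', by rw [h]⟩
  · rintro ⟨r, i', rfl⟩
    obtain ⟨i, h⟩ := (hμ _).2 ((hS _).2 ⟨r, i', rfl⟩)
    exact ⟨i, by rw [h]⟩

/-- The partition `μ({λ^{(r)}}; {p_r})` whose Maya diagram is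
`⋃_r {N (x_i(λ^{(r)}) + p̃_r) ; i ≥ 1}`. It exists and is unique whenever `∑_r p_r = 0`,
see `existsUnique_foldedPartition`. -/
def foldedPartition {N : ℕ} (p : Fin N → ℤ) (lam : Fin N → YoungDiagram) : YoungDiagram :=
  Classical.epsilon fun μ => mayaSet μ = foldedMayaSet p lam

theorem mayaSet_foldedPartition {N : ℕ} (hN : 0 < N) (p : Fin N → ℤ)
    (hp : ∑ r, p r = 0) (lam : Fin N → YoungDiagram) :
    mayaSet (foldedPartition p lam) = foldedMayaSet p lam :=
  Classical.epsilon_spec (p := fun μ => mayaSet μ = foldedMayaSet p lam)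
    (existsUnique_foldedPartition hN p hp lam).exists

/-! ### (Skew) Schur functions

A specialization of the ring of symmetric functions is given by the values `P k` (`k ≥ 1`)
of the power sums; for an alphabet `(x_1, x_2, …)` these are `P k = ∑_i x_i ^ k`.
-/

/-- The complete symmetric functions in terms of the power sums, through Newton's identity
`n h_n = ∑_{k=1}^n p_k h_{n-k}`. -/
def completeSymm (P : ℕ → ℂ) : ℕ → ℂ
  | 0 => 1
  | n + 1 => (∑ k : Fin (n + 1), P (k.val + 1) * completeSymm P (n - k.val)) / ((n : ℂ) + 1)
  decreasing_by omega

/-- `h_m` for `m ∈ ℤ`, with `h_m = 0` for `m < 0`. -/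
def completeSymmInt (P : ℕ → ℂ) (m : ℤ) : ℂ :=
  if m < 0 then 0 else completeSymm P m.toNat

/-- The skew Schur function `s_{ν/χ} = det (h_{ν_i - χ_j - i + j})_{1 ≤ i, j ≤ n}`, where `n`
is the larger of the numbers of parts of `ν` and `χ`; it vanishes unless `χ ⊆ ν`. -/
def skewSchur (P : ℕ → ℂ) (ν χ : YoungDiagram) : ℂ :=
  Matrix.det (Matrix.of fun i j : Fin (max (ν.colLen 0) (χ.colLen 0)) =>
    completeSymmInt P ((ν.rowLen i : ℤ) - (χ.rowLen j : ℤ) - (i.val : ℤ) + (j.val : ℤ)))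

/-- The Schur function `s_ν = s_{ν/∅}`. -/
def schur (P : ℕ → ℂ) (ν : YoungDiagram) : ℂ := skewSchur P ν ⊥

/-- The power sums of the alphabet `q^{-ρ} = (q^{1/2}, q^{3/2}, …)`, convergent for `|q| < 1`. -/
def powerSumNegRho (q : ℂ) (k : ℕ) : ℂ :=
  ∑' i : ℕ, (q ^ ((i : ℂ) + 1 / 2)) ^ k

/-- The power sums, for `k ≥ 1`, of the alphabet `q^{λ+ρ} = (q^{λ_i - i + 1/2})_{i ≥ 1}`, as
rational functions of `q^{1/2}`. The defining series converges for `|q| > 1`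
(see `hasSum_powerSumShiftedRho`); for `|q| < 1` it diverges, and the symmetric functions of
this alphabet are by definition the values of these rational functions. -/
def powerSumShiftedRho (q : ℂ) (lam : YoungDiagram) (k : ℕ) : ℂ :=
  1 / (q ^ ((k : ℂ) / 2) - q ^ (-((k : ℂ) / 2))) +
    ∑ i ∈ Finset.range (lam.colLen 0),
      ((q ^ ((mayaCoord lam i : ℚ) : ℂ)) ^ k - (q ^ ((mayaCoord ⊥ i : ℚ) : ℂ)) ^ k)

theorem hasSum_powerSumShiftedRho {q : ℂ} (hq : 1 < ‖q‖) (lam : YoungDiagram) {k : ℕ}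
    (hk : 1 ≤ k) :
    HasSum (fun i : ℕ => (q ^ ((mayaCoord lam i : ℚ) : ℂ)) ^ k) (powerSumShiftedRho q lam k) := by
  have hq0 : q ≠ 0 := by
    rintro rfl
    simp at hq
    linarith
  have hrow0 : ∀ (μ : YoungDiagram) i, μ.colLen 0 ≤ i → μ.rowLen i = 0 := by
    intro μ i hi
    by_contra h
    have h1 : (i, 0) ∈ μ := YoungDiagram.mem_iff_lt_rowLen.2 (by omega)
    have := YoungDiagram.mem_iff_lt_colLen.1 h1
    omega
  have hbot : ∀ i, (⊥ : YoungDiagram).rowLen i = 0 := by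
    intro i
    by_contra h
    exact YoungDiagram.notMem_bot (i, 0)
      (YoungDiagram.mem_iff_lt_rowLen.2 (Nat.pos_of_ne_zero h))
  have hb : ∀ i : ℕ, (q ^ ((mayaCoord ⊥ i : ℚ) : ℂ)) ^ k
      = q ^ (-((k : ℂ) / 2)) * ((q ^ k)⁻¹) ^ i := by
    intro i
    have e : (((mayaCoord ⊥ i : ℚ) : ℂ)) * (k : ℂ) = -((k : ℂ) / 2) + -(((k * i : ℕ) : ℂ)) := by
      simp only [mayaCoord, hbot]
      push_cast
      ring
    rw [← Complex.cpow_mul_nat, e, Complex.cpow_add _ _ hq0, Complex.cpow_neg _ ((k * i : ℕ) : ℂ),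
      Complex.cpow_natCast, pow_mul, inv_pow]
  have hnorm : ‖(q ^ k)⁻¹‖ < 1 := by
    rw [norm_inv, norm_pow]
    exact inv_lt_one_of_one_lt₀ (one_lt_pow₀ hq (by omega))
  have h0 : HasSum (fun i : ℕ => (q ^ ((mayaCoord ⊥ i : ℚ) : ℂ)) ^ k)
      (1 / (q ^ ((k : ℂ) / 2) - q ^ (-((k : ℂ) / 2)))) := by
    simp only [hb]
    have h1 := (hasSum_geometric_of_norm_lt_one hnorm).mul_left (q ^ (-((k : ℂ) / 2)))
    suffices hval : q ^ (-((k : ℂ) / 2)) * (1 - (q ^ k)⁻¹)⁻¹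
        = 1 / (q ^ ((k : ℂ) / 2) - q ^ (-((k : ℂ) / 2))) by
      rw [← hval]
      exact h1
    have ha : q ^ ((k : ℂ) / 2) ≠ 0 := by
      rw [Complex.cpow_def_of_ne_zero hq0]
      exact Complex.exp_ne_zero _
    have hsq : q ^ k = q ^ ((k : ℂ) / 2) * q ^ ((k : ℂ) / 2) := by
      rw [← Complex.cpow_add _ _ hq0, ← Complex.cpow_natCast]
      congr 1
      ring
    rw [Complex.cpow_neg, hsq]
    set a := q ^ ((k : ℂ) / 2)
    rw [one_div, ← mul_inv]
    congr 1
    field_simp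
  have h1 := hasSum_sum_of_ne_finset_zero (L := SummationFilter.unconditional ℕ)
    (f := fun i : ℕ => (q ^ ((mayaCoord lam i : ℚ) : ℂ)) ^ k - (q ^ ((mayaCoord ⊥ i : ℚ) : ℂ)) ^ k)
    (s := Finset.range (lam.colLen 0)) (by
      intro i hi
      have : mayaCoord lam i = mayaCoord ⊥ i := by
        simp only [mayaCoord, hbot]
        rw [hrow0 lam i (by simpa using hi)]
      rw [this, sub_self])
  have h2 := h0.add h1
  unfold powerSumShiftedRho
  simpa only [add_sub_cancel] using h2

/-- `s_μ(q^{-ρ})`. -/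
def schurNegRho (q : ℂ) (μ : YoungDiagram) : ℂ := schur (powerSumNegRho q) μ

/-- `s_{ν/χ}(q^{λ+ρ})`. -/
def skewSchurShiftedRho (q : ℂ) (lam ν χ : YoungDiagram) : ℂ :=
  skewSchur (powerSumShiftedRho q lam) ν χ

/-- `s_ν(q^{λ+ρ})`; for `λ = ∅` this is `s_ν(q^ρ)`. -/
def schurShiftedRho (q : ℂ) (lam ν : YoungDiagram) : ℂ :=
  schur (powerSumShiftedRho q lam) ν

/-! ### The instanton weights -/

/-- `𝒵_q^{SU(N) inst}({λ^{(r)}}, {p_r}, Q)`. -/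
def instantonWeight {N : ℕ} (q Q : ℂ) (p : Fin N → ℤ) (lam : Fin N → YoungDiagram) : ℂ :=
  Q ^ ((1 / 2 : ℂ) *
      (((foldedPartition p lam).card : ℂ) - ((foldedPartition p fun _ => ⊥).card : ℂ))) *
    (schurNegRho q (foldedPartition p lam) / schurNegRho q (foldedPartition p fun _ => ⊥))

/-- `Q_{F_r} = q^{N (p̃_r - p̃_{r+1})}`, `1 ≤ r ≤ N - 1`. -/
def fibreParam {N : ℕ} (q : ℂ) (p : Fin N → ℤ) (r : Fin (N - 1)) : ℂ :=
  q ^ (((N : ℚ) * (pTilde p ⟨r.val, by omega⟩ - pTilde p ⟨r.val + 1, by omega⟩) : ℚ) : ℂ)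

/-- `∏_{t=r}^{s-1} Q_{F_t}`. -/
def fibreProd {N : ℕ} (QF : Fin (N - 1) → ℂ) (r s : Fin N) : ℂ :=
  ∏ t ∈ Finset.univ.filter (fun t : Fin (N - 1) => r.val ≤ t.val ∧ t.val < s.val), QF t

/-! ### The topological string amplitude -/

/-- The `(ν^{(1)}, …, ν^{(N-1)})`-term of the fibre part of the amplitude,
`∏_t Q_{F_t}^{|ν^{(t)}|} s_{ν^{(1)}}(q^{λ^{(1)}+ρ}) s_{ν^{(N-1)}}(q^{λ̃^{(N)}+ρ})
  ∑_χ ∏_{t=1}^{N-2} s_{ν^{(t)}/χ^{(t)}}(q^{λ̃^{(t+1)}+ρ}) s_{ν^{(t+1)}/χ^{(t)}}(q^{λ^{(t+1)}+ρ})`.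
Indices start from `0` in the code. The sum over `χ` has only finitely many nonzero terms. -/
def fibreTerm {N : ℕ} (hN : 2 ≤ N) (q : ℂ) (QF : Fin (N - 1) → ℂ)
    (lam : Fin N → YoungDiagram) (ν : Fin (N - 1) → YoungDiagram) : ℂ :=
  (∏ t, QF t ^ (ν t).card) *
    schurShiftedRho q (lam ⟨0, by omega⟩) (ν ⟨0, by omega⟩) *
    schurShiftedRho q (lam ⟨N - 1, by omega⟩).transpose (ν ⟨N - 2, by omega⟩) *
    ∑' χ : Fin (N - 2) → YoungDiagram, ∏ t : Fin (N - 2),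
      (skewSchurShiftedRho q (lam ⟨t.val + 1, by omega⟩).transpose
          (ν ⟨t.val, by omega⟩) (χ t) *
        skewSchurShiftedRho q (lam ⟨t.val + 1, by omega⟩)
          (ν ⟨t.val + 1, by omega⟩) (χ t))

/-- The sum over `ν` of `fibreTerm` converges for small `Q_F` only (depending on `λ`), and is
continued analytically in `Q_F`. `F` is its continuation along the complex line
`z ↦ (z Q_{F_1}, …, z Q_{F_{N-1}})`: a meromorphic function on `ℂ` (in normal form, that is,
without spurious values) which is the sum of the series for `z` near `0`. There is at most
one such `F`, see `IsFibreContinuation.unique`. -/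
def IsFibreContinuation {N : ℕ} (hN : 2 ≤ N) (q : ℂ) (QF : Fin (N - 1) → ℂ)
    (lam : Fin N → YoungDiagram) (F : ℂ → ℂ) : Prop :=
  MeromorphicNFOn F Set.univ ∧
    ∀ᶠ z in 𝓝 (0 : ℂ), HasSum (fibreTerm hN q (fun t => z * QF t) lam) (F z)

theorem IsFibreContinuation.unique {N : ℕ} {hN : 2 ≤ N} {q : ℂ} {QF : Fin (N - 1) → ℂ}
    {lam : Fin N → YoungDiagram} {F G : ℂ → ℂ} (hF : IsFibreContinuation hN q QF lam F)
    (hG : IsFibreContinuation hN q QF lam G) : F = G := by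
  have h0 : ∀ᶠ z in 𝓝 (0 : ℂ), (F - G) z = 0 := by
    filter_upwards [hF.2, hG.2] with z h1 h2
    simp [h1.unique h2]
  have hm : MeromorphicOn (F - G) Set.univ := hF.1.meromorphicOn.sub hG.1.meromorphicOn
  funext w
  have htop : meromorphicOrderAt (F - G) w = ⊤ := by
    by_contra hne
    have hall := (MeromorphicOn.exists_meromorphicOrderAt_ne_top_iff_forall hm
      isConnected_univ).1 ⟨⟨w, Set.mem_univ w⟩, hne⟩
    exact hall ⟨0, Set.mem_univ 0⟩
      (meromorphicOrderAt_eq_top_iff.2 (h0.filter_mono nhdsWithin_le_nhds))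
  have h1 : F =ᶠ[𝓝[≠] w] G := by
    filter_upwards [meromorphicOrderAt_eq_top_iff.1 htop] with z hz
    exact sub_eq_zero.1 hz
  exact (((hF.1 (Set.mem_univ w)).eventuallyEq_nhdsNE_iff_eventuallyEq_nhds
    (hG.1 (Set.mem_univ w))).1 h1).eq_of_nhds

/-- The fibre part `∑_ν ∏_t Q_{F_t}^{|ν^{(t)}|} …` of the amplitude at `Q_F`. -/
def fibreAmplitude {N : ℕ} (hN : 2 ≤ N) (q : ℂ) (QF : Fin (N - 1) → ℂ)
    (lam : Fin N → YoungDiagram) : ℂ :=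
  Classical.epsilon (fun F : ℂ → ℂ => IsFibreContinuation hN q QF lam F) 1

/-- The `{λ^{(r)}}`-term (before squaring) of the string amplitude. -/
def stringWeight {N : ℕ} (hN : 2 ≤ N) (q : ℂ) (QF : Fin (N - 1) → ℂ) (QB : ℂ)
    (lam : Fin N → YoungDiagram) : ℂ :=
  QB ^ ((1 / 2 : ℂ) * ∑ r, ((lam r).card : ℂ)) *
    q ^ (-(1 / 2 : ℂ) * ∑ r : Fin N, ((r.val : ℂ) + 1) * (kappa (lam r) : ℂ)) *
    (∏ r : Fin (N - 1), QF r ^ ((r.val + 1) *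
      ∑ s ∈ Finset.univ.filter (fun s : Fin N => r.val < s.val), (lam s).card)) *
    (∏ r, schurShiftedRho q ⊥ (lam r)) *
    fibreAmplitude hN q QF lam

/-- `Z_string^{SU(N)}(q, {Q_{F_r}}, Q_B)`. -/
def stringAmplitude {N : ℕ} (hN : 2 ≤ N) (q : ℂ) (QF : Fin (N - 1) → ℂ) (QB : ℂ) : ℂ :=
  ∑' lam : Fin N → YoungDiagram, stringWeight hN q QF QB lam ^ 2

end PlanePartition

end

open scoped BigOperators Topology

noncomputable section

namespace PlanePartition

/-! ### Complete symmetric functions -/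

theorem completeSymm_zero (P : ℕ → ℂ) : completeSymm P 0 = 1 := by
  rw [completeSymm]

theorem completeSymm_succ (P : ℕ → ℂ) (n : ℕ) :
    completeSymm P (n + 1) =
      (∑ k ∈ Finset.range (n + 1), P (k + 1) * completeSymm P (n - k)) / ((n : ℂ) + 1) := by
  rw [completeSymm, Finset.sum_range]

theorem succ_mul_completeSymm (P : ℕ → ℂ) (n : ℕ) :
    ((n : ℂ) + 1) * completeSymm P (n + 1) =
      ∑ k ∈ Finset.range (n + 1), P (k + 1) * completeSymm P (n - k) := by
  rw [completeSymm_succ, mul_div_cancel₀ _ (Nat.cast_add_one_ne_zero n)]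

theorem completeSymm_congr {P P' : ℕ → ℂ} {n : ℕ} (h : ∀ k, 1 ≤ k → k ≤ n → P k = P' k) :
    completeSymm P n = completeSymm P' n := by
  induction n using Nat.strong_induction_on with
  | _ n ih =>
    cases n with
    | zero => rw [completeSymm_zero, completeSymm_zero]
    | succ n =>
      rw [completeSymm_succ, completeSymm_succ]
      congr 1
      refine Finset.sum_congr rfl fun k hk => ?_
      rw [Finset.mem_range] at hk
      rw [h (k + 1) (by omega) (by omega),
        ih (n - k) (by omega) fun j hj hj' => h j hj (by omega)]

theorem eq_of_completeSymm_eq {P P' : ℕ → ℂ} {D : ℕ}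
    (h : ∀ n, n ≤ D → completeSymm P n = completeSymm P' n) :
    ∀ k, 1 ≤ k → k ≤ D → P k = P' k := by
  intro k
  induction k using Nat.strong_induction_on with
  | _ k ih =>
    intro hk hkD
    obtain ⟨n, rfl⟩ : ∃ n, k = n + 1 := ⟨k - 1, by omega⟩
    have h1 := succ_mul_completeSymm P n
    have h2 := succ_mul_completeSymm P' n
    rw [h (n + 1) hkD, h2, Finset.sum_range_succ, Finset.sum_range_succ, Nat.sub_self,
      completeSymm_zero, completeSymm_zero] at h1
    have h3 : ∑ k ∈ Finset.range n, P' (k + 1) * completeSymm P' (n - k) =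
        ∑ k ∈ Finset.range n, P (k + 1) * completeSymm P (n - k) := by
      refine Finset.sum_congr rfl fun j hj => ?_
      rw [Finset.mem_range] at hj
      rw [ih (j + 1) (by omega) (by omega) (by omega), h (n - j) (by omega)]
    rw [h3] at h1
    have h4 := add_left_cancel h1
    simpa using h4.symm

/-- The generating series of the complete symmetric functions. -/
def completeSeries (P : ℕ → ℂ) : PowerSeries ℂ := PowerSeries.mk (completeSymm P)

theorem coeff_completeSeries (P : ℕ → ℂ) (n : ℕ) :
    PowerSeries.coeff n (completeSeries P) = completeSymm P n := PowerSeries.coeff_mk _ _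

theorem eq_completeSeries {P : ℕ → ℂ} {F : PowerSeries ℂ} (h0 : PowerSeries.coeff 0 F = 1)
    (hF : PowerSeries.derivative ℂ F = PowerSeries.mk (fun k => P (k + 1)) * F) :
    F = completeSeries P := by
  ext n
  rw [coeff_completeSeries]
  induction n using Nat.strong_induction_on with
  | _ n ih =>
    cases n with
    | zero => rw [h0, completeSymm_zero]
    | succ n =>
      have h1 := congrArg (PowerSeries.coeff n) hF
      rw [PowerSeries.coeff_derivative, PowerSeries.coeff_mul,
        Finset.Nat.sum_antidiagonal_eq_sum_range_succ_mk] at h1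
      rw [completeSymm_succ, eq_div_iff (Nat.cast_add_one_ne_zero n), h1]
      refine Finset.sum_congr rfl fun k hk => ?_
      rw [PowerSeries.coeff_mk, ih (n - k) (by omega)]

theorem derivative_completeSeries (P : ℕ → ℂ) :
    PowerSeries.derivative ℂ (completeSeries P) =
      PowerSeries.mk (fun k => P (k + 1)) * completeSeries P := by
  ext n
  rw [PowerSeries.coeff_derivative, PowerSeries.coeff_mul,
    Finset.Nat.sum_antidiagonal_eq_sum_range_succ_mk, coeff_completeSeries, mul_comm,
    succ_mul_completeSymm]
  refine Finset.sum_congr rfl fun k hk => ?_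
  rw [PowerSeries.coeff_mk, coeff_completeSeries]

theorem completeSeries_add (P P' : ℕ → ℂ) :
    completeSeries (fun k => P k + P' k) = completeSeries P * completeSeries P' := by
  symm
  apply eq_completeSeries
  · rw [PowerSeries.coeff_mul]
    simp [coeff_completeSeries, completeSymm_zero]
  · rw [Derivation.leibniz, derivative_completeSeries, derivative_completeSeries]
    have : PowerSeries.mk (fun k => P (k + 1) + P' (k + 1)) =
        PowerSeries.mk (fun k => P (k + 1)) + PowerSeries.mk (fun k => P' (k + 1)) := by
      ext; simp
    rw [this, smul_eq_mul, smul_eq_mul]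
    ring

theorem completeSymm_add (P P' : ℕ → ℂ) (n : ℕ) :
    completeSymm (fun k => P k + P' k) n =
      ∑ x ∈ Finset.HasAntidiagonal.antidiagonal n, completeSymm P x.1 * completeSymm P' x.2 := by
  rw [← coeff_completeSeries, completeSeries_add, PowerSeries.coeff_mul]
  simp only [coeff_completeSeries]

theorem completeSymm_zero_fun (n : ℕ) :
    completeSymm (fun _ => 0) n = if n = 0 then 1 else 0 := by
  cases n with
  | zero => rw [completeSymm_zero, if_pos rfl]
  | succ n => rw [completeSymm_succ]; simp

theorem completeSeries_zero_fun : completeSeries (fun _ => 0) = 1 := by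
  ext n
  rw [coeff_completeSeries, completeSymm_zero_fun, PowerSeries.coeff_one]

theorem completeSeries_sum {ι : Type*} (s : Finset ι) (P : ι → ℕ → ℂ) :
    completeSeries (fun k => ∑ i ∈ s, P i k) = ∏ i ∈ s, completeSeries (P i) := by
  classical
  induction s using Finset.induction_on with
  | empty => simpa using completeSeries_zero_fun
  | insert i s hi ih =>
    simp only [Finset.sum_insert hi, Finset.prod_insert hi]
    rw [completeSeries_add, ih]

theorem completeSymm_scale (c : ℂ) (P : ℕ → ℂ) (n : ℕ) :
    completeSymm (fun k => c ^ k * P k) n = c ^ n * completeSymm P n := by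
  induction n using Nat.strong_induction_on with
  | _ n ih =>
    cases n with
    | zero => simp [completeSymm_zero]
    | succ n =>
      rw [completeSymm_succ, completeSymm_succ, mul_div_assoc', Finset.mul_sum]
      congr 1
      refine Finset.sum_congr rfl fun k hk => ?_
      rw [Finset.mem_range] at hk
      rw [ih (n - k) (by omega)]
      have : n + 1 = (k + 1) + (n - k) := by omega
      rw [this, pow_add]
      ring

theorem completeSymm_one (n : ℕ) : completeSymm (fun _ => 1) n = 1 := by
  induction n using Nat.strong_induction_on with
  | _ n ih =>
    cases n with
    | zero => rw [completeSymm_zero]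
    | succ n =>
      rw [completeSymm_succ, Finset.sum_congr rfl fun k _ => by rw [ih (n - k) (by omega), one_mul]]
      simp [div_self (Nat.cast_add_one_ne_zero (R := ℂ) n)]

theorem completeSymm_pow (c : ℂ) (n : ℕ) : completeSymm (fun k => c ^ k) n = c ^ n := by
  have := completeSymm_scale c (fun _ => 1) n
  simpa [completeSymm_one] using this

theorem norm_completeSymm_le_mul {P : ℕ → ℂ} {ε r : ℝ} (hε0 : 0 ≤ ε) (hε : ε ≤ 1) (hr : 0 ≤ r)
    (h : ∀ k, 1 ≤ k → ‖P k‖ ≤ ε * r ^ k) {n : ℕ} (hn : 1 ≤ n) :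
    ‖completeSymm P n‖ ≤ ε * r ^ n := by
  induction n using Nat.strong_induction_on with
  | _ n ih =>
    obtain ⟨n, rfl⟩ : ∃ m, n = m + 1 := ⟨n - 1, by omega⟩
    have hpos : (0 : ℝ) < (n : ℝ) + 1 := by positivity
    have hle : ∀ m, m ≤ n → ‖completeSymm P m‖ ≤ r ^ m := by
      intro m hm
      rcases Nat.eq_zero_or_pos m with rfl | hm0
      · simp [completeSymm_zero]
      · exact (ih m (by omega) hm0).trans (mul_le_of_le_one_left (by positivity) hε)
    rw [completeSymm_succ, norm_div]
    have hnn : ‖((n : ℂ) + 1)‖ = (n : ℝ) + 1 := by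
      rw [show ((n : ℂ) + 1) = ((n + 1 : ℕ) : ℂ) by push_cast; rfl, Complex.norm_natCast]
      push_cast; rfl
    rw [hnn, div_le_iff₀ hpos]
    calc ‖∑ k ∈ Finset.range (n + 1), P (k + 1) * completeSymm P (n - k)‖
        ≤ ∑ k ∈ Finset.range (n + 1), ε * r ^ (n + 1) := by
          refine norm_sum_le_of_le _ fun k hk => ?_
          rw [Finset.mem_range] at hk
          rw [norm_mul]
          calc ‖P (k + 1)‖ * ‖completeSymm P (n - k)‖
              ≤ (ε * r ^ (k + 1)) * r ^ (n - k) :=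
                mul_le_mul (h _ (by omega)) (hle _ (by omega)) (norm_nonneg _) (by positivity)
            _ = ε * r ^ (n + 1) := by
                rw [mul_assoc, ← pow_add]
                congr 2
                omega
      _ = ε * r ^ (n + 1) * ((n : ℝ) + 1) := by
          rw [Finset.sum_const, Finset.card_range, nsmul_eq_mul]
          push_cast
          ring

theorem norm_completeSymm_le {P : ℕ → ℂ} {r : ℝ} (hr : 0 ≤ r)
    (h : ∀ k, 1 ≤ k → ‖P k‖ ≤ r ^ k) (n : ℕ) : ‖completeSymm P n‖ ≤ r ^ n := by
  rcases Nat.eq_zero_or_pos n with rfl | hn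
  · simp [completeSymm_zero]
  · simpa using norm_completeSymm_le_mul zero_le_one le_rfl hr (by simpa using h) hn

theorem exists_completeSymm_ofReal {R : ℕ → ℝ} (hR : ∀ k, 1 ≤ k → 0 ≤ R k) (n : ℕ) :
    ∃ x : ℝ, 0 ≤ x ∧ completeSymm (fun k => (R k : ℂ)) n = x := by
  induction n using Nat.strong_induction_on with
  | _ n ih =>
    cases n with
    | zero => exact ⟨1, zero_le_one, by rw [completeSymm_zero, Complex.ofReal_one]⟩
    | succ n =>
      choose! x hx0 hx using fun m (hm : m < n + 1) => ih m hm
      refine ⟨(∑ k ∈ Finset.range (n + 1), R (k + 1) * x (n - k)) / ((n : ℝ) + 1), ?_, ?_⟩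
      · exact div_nonneg (Finset.sum_nonneg fun k _ =>
          mul_nonneg (hR _ (by omega)) (hx0 _ (by omega))) (by positivity)
      · rw [completeSymm_succ]
        push_cast
        congr 1
        refine Finset.sum_congr rfl fun k _ => ?_
        rw [hx (n - k) (by omega)]

theorem norm_completeSymm_le_norm {P : ℕ → ℂ} {R : ℕ → ℝ} (h : ∀ k, 1 ≤ k → ‖P k‖ ≤ R k) (n : ℕ) :
    ‖completeSymm P n‖ ≤ ‖completeSymm (fun k => (R k : ℂ)) n‖ := by
  have hR : ∀ k, 1 ≤ k → 0 ≤ R k := fun k hk => (norm_nonneg _).trans (h k hk)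
  induction n using Nat.strong_induction_on with
  | _ n ih =>
    cases n with
    | zero => rw [completeSymm_zero, completeSymm_zero]
    | succ n =>
      choose x hx0 hx using fun m => exists_completeSymm_ofReal hR m
      have hn : ∀ m, ‖completeSymm (fun k => (R k : ℂ)) m‖ = x m := fun m => by
        rw [hx, Complex.norm_real, Real.norm_of_nonneg (hx0 m)]
      rw [completeSymm_succ, completeSymm_succ, norm_div, norm_div]
      refine div_le_div_of_nonneg_right ?_ (norm_nonneg _)
      have e : ∑ k ∈ Finset.range (n + 1), (R (k + 1) : ℂ) *
          completeSymm (fun k => (R k : ℂ)) (n - k) =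
          ((∑ k ∈ Finset.range (n + 1), R (k + 1) * x (n - k) : ℝ) : ℂ) := by
        push_cast
        exact Finset.sum_congr rfl fun k _ => by rw [hx]
      rw [e, Complex.norm_real, Real.norm_of_nonneg (Finset.sum_nonneg fun k _ =>
          mul_nonneg (hR _ (by omega)) (hx0 _))]
      refine norm_sum_le_of_le _ fun k _ => ?_
      rw [norm_mul]
      refine mul_le_mul (h _ (by omega)) ?_ (norm_nonneg _) (hR _ (by omega))
      rw [← hn]
      exact ih _ (by omega)

/-! ### Young diagrams -/

theorem rowLen_eq_zero {μ : YoungDiagram} {i : ℕ} (h : μ.colLen 0 ≤ i) : μ.rowLen i = 0 := by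
  by_contra h0
  have h1 : (i, 0) ∈ μ := YoungDiagram.mem_iff_lt_rowLen.2 (Nat.pos_of_ne_zero h0)
  have := YoungDiagram.mem_iff_lt_colLen.1 h1
  omega

theorem colLen_le_iff {μ : YoungDiagram} {n : ℕ} : μ.colLen 0 ≤ n ↔ μ.rowLen n = 0 := by
  refine ⟨rowLen_eq_zero, fun h => ?_⟩
  by_contra h1
  have h2 : (n, 0) ∈ μ := YoungDiagram.mem_iff_lt_colLen.2 (by omega)
  have := YoungDiagram.mem_iff_lt_rowLen.1 h2
  omega

theorem rowLen_bot (i : ℕ) : (⊥ : YoungDiagram).rowLen i = 0 := by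
  by_contra h
  exact YoungDiagram.notMem_bot (i, 0) (YoungDiagram.mem_iff_lt_rowLen.2 (Nat.pos_of_ne_zero h))

theorem colLen_bot : (⊥ : YoungDiagram).colLen 0 = 0 :=
  Nat.le_zero.1 (colLen_le_iff.2 (rowLen_bot 0))

theorem card_bot : (⊥ : YoungDiagram).card = 0 := by
  simp [YoungDiagram.card]

theorem ext_rowLen {μ ν : YoungDiagram} (h : ∀ i, μ.rowLen i = ν.rowLen i) : μ = ν := by
  ext ⟨i, j⟩
  rw [YoungDiagram.mem_cells, YoungDiagram.mem_cells, YoungDiagram.mem_iff_lt_rowLen,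
    YoungDiagram.mem_iff_lt_rowLen, h]

theorem le_iff_rowLen {μ ν : YoungDiagram} : μ ≤ ν ↔ ∀ i, μ.rowLen i ≤ ν.rowLen i := by
  constructor
  · intro h i
    by_contra h1
    have h2 : (i, ν.rowLen i) ∈ μ := YoungDiagram.mem_iff_lt_rowLen.2 (by omega)
    have := YoungDiagram.mem_iff_lt_rowLen.1 (h h2)
    omega
  · rintro h ⟨i, j⟩ hc
    exact YoungDiagram.mem_iff_lt_rowLen.2
      ((YoungDiagram.mem_iff_lt_rowLen.1 hc).trans_le (h i))

theorem colLen_mono {μ ν : YoungDiagram} (h : μ ≤ ν) : μ.colLen 0 ≤ ν.colLen 0 := by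
  rw [colLen_le_iff]
  have := le_iff_rowLen.1 h (ν.colLen 0)
  rw [rowLen_eq_zero le_rfl] at this
  omega

theorem card_mono {μ ν : YoungDiagram} (h : μ ≤ ν) : μ.card ≤ ν.card :=
  Finset.card_le_card (YoungDiagram.cells_subset_iff.2 h)

theorem sum_cells {M : Type*} [AddCommMonoid M] {μ : YoungDiagram} {n : ℕ} (hn : μ.colLen 0 ≤ n)
    (f : ℕ × ℕ → M) :
    ∑ c ∈ μ.cells, f c = ∑ i ∈ Finset.range n, ∑ j ∈ Finset.range (μ.rowLen i), f (i, j) := by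
  refine Finset.sum_finset_product _ _ _ ?_
  rintro ⟨i, j⟩
  rw [YoungDiagram.mem_cells, YoungDiagram.mem_iff_lt_rowLen, Finset.mem_range, Finset.mem_range]
  refine ⟨fun h => ⟨?_, h⟩, fun h => h.2⟩
  by_contra h1
  simp only at h h1
  rw [rowLen_eq_zero (by omega)] at h
  omega

theorem card_eq_sum_rowLen {μ : YoungDiagram} {n : ℕ} (hn : μ.colLen 0 ≤ n) :
    μ.card = ∑ i ∈ Finset.range n, μ.rowLen i := by
  have := sum_cells hn (fun _ => 1)
  simpa [YoungDiagram.card] using this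

theorem colLen_le_card (μ : YoungDiagram) : μ.colLen 0 ≤ μ.card := by
  rw [YoungDiagram.colLen_eq_card]
  exact Finset.card_le_card (Finset.filter_subset _ _)

theorem rowLen_le_card (μ : YoungDiagram) (i : ℕ) : μ.rowLen i ≤ μ.card := by
  rw [YoungDiagram.rowLen_eq_card]
  exact Finset.card_le_card (Finset.filter_subset _ _)

theorem finite_cells_subset (S : Finset (ℕ × ℕ)) : {μ : YoungDiagram | μ.cells ⊆ S}.Finite := by
  refine Set.Finite.of_injOn (f := YoungDiagram.cells) (t := (S.powerset : Set (Finset (ℕ × ℕ))))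
    ?_ ?_ S.powerset.finite_toSet
  · intro μ hμ
    simpa using hμ
  · intro μ _ ν _ h
    exact YoungDiagram.ext h

/-- The diagrams all of whose cells belong to `S`. -/
def diagramsIn (S : Finset (ℕ × ℕ)) : Finset YoungDiagram := (finite_cells_subset S).toFinset

theorem mem_diagramsIn {S : Finset (ℕ × ℕ)} {μ : YoungDiagram} :
    μ ∈ diagramsIn S ↔ μ.cells ⊆ S := by
  simp [diagramsIn]

theorem card_diagramsIn_le (S : Finset (ℕ × ℕ)) : (diagramsIn S).card ≤ 2 ^ S.card := by
  rw [← Finset.card_powerset]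
  refine Finset.card_le_card_of_injOn YoungDiagram.cells ?_ ?_
  · intro μ hμ
    simpa [mem_diagramsIn] using hμ
  · intro μ _ ν _ h
    exact YoungDiagram.ext h

/-- The diagrams contained in `ν`. -/
def subdiagrams (ν : YoungDiagram) : Finset YoungDiagram := diagramsIn ν.cells

theorem mem_subdiagrams {ν χ : YoungDiagram} : χ ∈ subdiagrams ν ↔ χ ≤ ν := by
  rw [subdiagrams, mem_diagramsIn, YoungDiagram.cells_subset_iff]

/-- The diagrams contained in the rectangle with `n` rows and `m` columns. -/
def boxDiagrams (n m : ℕ) : Finset YoungDiagram :=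
  diagramsIn (Finset.range n ×ˢ Finset.range m)

theorem mem_boxDiagrams {n m : ℕ} {μ : YoungDiagram} :
    μ ∈ boxDiagrams n m ↔ μ.colLen 0 ≤ n ∧ ∀ i, μ.rowLen i ≤ m := by
  rw [boxDiagrams, mem_diagramsIn]
  constructor
  · intro h
    constructor
    · rw [colLen_le_iff]
      by_contra h0
      have h1 : (n, 0) ∈ μ.cells :=
        (YoungDiagram.mem_cells _).2 (YoungDiagram.mem_iff_lt_rowLen.2 (Nat.pos_of_ne_zero h0))
      have := h h1
      simp at this
    · intro i
      by_contra h0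
      have h1 : (i, m) ∈ μ.cells :=
        (YoungDiagram.mem_cells _).2 (YoungDiagram.mem_iff_lt_rowLen.2 (by omega))
      have := h h1
      simp at this
  · rintro ⟨h1, h2⟩ ⟨i, j⟩ hc
    rw [YoungDiagram.mem_cells, YoungDiagram.mem_iff_lt_rowLen] at hc
    have := h2 i
    rw [Finset.mem_product, Finset.mem_range, Finset.mem_range]
    refine ⟨?_, by simp only; omega⟩
    by_contra h3
    simp only at h3
    rw [rowLen_eq_zero (by omega)] at hc
    omega

theorem finite_card_eq (d : ℕ) : {μ : YoungDiagram | μ.card = d}.Finite := by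
  refine (boxDiagrams d d).finite_toSet.subset fun μ hμ => ?_
  have h : μ.card = d := hμ
  rw [Finset.mem_coe, mem_boxDiagrams, ← h]
  exact ⟨colLen_le_card μ, rowLen_le_card μ⟩

/-- The diagrams with `d` cells. -/
def diagramsOfCard (d : ℕ) : Finset YoungDiagram := (finite_card_eq d).toFinset

theorem mem_diagramsOfCard {d : ℕ} {μ : YoungDiagram} : μ ∈ diagramsOfCard d ↔ μ.card = d := by
  simp [diagramsOfCard]

/-- The strictly decreasing sequence `ν_i + n - i` (`1 ≤ i ≤ n`) of a partition with at most
`n` parts. -/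
def betaNum (n : ℕ) (ν : YoungDiagram) (i : Fin n) : ℕ := ν.rowLen i + (n - 1 - i)

theorem betaNum_strictAnti (n : ℕ) (ν : YoungDiagram) : StrictAnti (betaNum n ν) := by
  intro i j hij
  have h1 := ν.rowLen_anti i j hij.le
  have h2 : (i : ℕ) < j := hij
  have := j.isLt
  simp only [betaNum]
  omega

theorem betaNum_injective {n : ℕ} {μ ν : YoungDiagram} (hμ : μ.colLen 0 ≤ n) (hν : ν.colLen 0 ≤ n)
    (h : betaNum n μ = betaNum n ν) : μ = ν := by
  apply ext_rowLen
  intro i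
  by_cases hi : i < n
  · have := congrFun h ⟨i, hi⟩
    simp only [betaNum] at this
    omega
  · rw [rowLen_eq_zero (by omega), rowLen_eq_zero (by omega)]

theorem exists_betaNum_eq {n : ℕ} {g : Fin n → ℕ} (hg : StrictAnti g) :
    ∃ ν : YoungDiagram, ν.colLen 0 ≤ n ∧ betaNum n ν = g := by
  have key : ∀ k : ℕ, ∀ hk : k < n, k ≤ g ⟨n - 1 - k, by omega⟩ := by
    intro k
    induction k with
    | zero => exact fun _ => Nat.zero_le _
    | succ k ih =>
      intro hk
      have h1 := ih (by omega)
      have h2 : g ⟨n - 1 - k, by omega⟩ < g ⟨n - 1 - (k + 1), by omega⟩ := by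
        apply hg
        rw [Fin.mk_lt_mk]
        omega
      omega
  have key' : ∀ i : ℕ, ∀ hi : i < n, n - 1 - i ≤ g ⟨i, hi⟩ := by
    intro i hi
    have := key (n - 1 - i) (by omega)
    have e : n - 1 - (n - 1 - i) = i := by omega
    simpa only [e] using this
  obtain ⟨ν, hν⟩ := exists_rowLen_eq
    (fun i => if h : i < n then g ⟨i, h⟩ - (n - 1 - i) else 0)
    (antitone_nat_of_succ_le fun i => by
      by_cases h : i + 1 < n
      · have h1 : g ⟨i + 1, h⟩ < g ⟨i, by omega⟩ := hg (by rw [Fin.mk_lt_mk]; omega)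
        have h2 := key' (i + 1) h
        simp only [dif_pos h, dif_pos (show i < n by omega)]
        omega
      · simp only [dif_neg h]
        exact Nat.zero_le _) n (fun i hi => dif_neg (by omega))
  refine ⟨ν, ?_, ?_⟩
  · rw [colLen_le_iff, hν, dif_neg (by omega)]
  · funext i
    have := key' i i.isLt
    simp only [betaNum, hν, dif_pos i.isLt, Fin.eta] at this ⊢
    omega

theorem sum_betaNum {n : ℕ} {ν : YoungDiagram} (hν : ν.colLen 0 ≤ n) :
    ∑ i, betaNum n ν i = ν.card + ∑ i : Fin n, (n - 1 - (i : ℕ)) := by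
  simp only [betaNum]
  rw [Finset.sum_add_distrib, card_eq_sum_rowLen hν, Finset.sum_range]

theorem exists_betaNum_perm {n : ℕ} {f : Fin n → ℕ} (hf : Function.Injective f) :
    ∃ ν : YoungDiagram, ν.colLen 0 ≤ n ∧ ∃ σ : Equiv.Perm (Fin n), ∀ i, betaNum n ν (σ i) = f i := by
  classical
  have hcard : (Finset.univ.image f).card = n := by
    rw [Finset.card_image_of_injective _ hf, Finset.card_univ, Fintype.card_fin]
  let e := (Finset.univ.image f).orderEmbOfFin hcard
  obtain ⟨ν, hν, hβ⟩ := exists_betaNum_eq (g := fun i => e (Fin.rev i)) (by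
    intro i j hij
    exact e.strictMono (Fin.rev_lt_rev.2 hij))
  have hmem : ∀ i, ∃ j, betaNum n ν j = f i := by
    intro i
    have h1 : f i ∈ Set.range e := by
      rw [Finset.range_orderEmbOfFin]
      simp
    obtain ⟨j, hj⟩ := h1
    exact ⟨Fin.rev j, by rw [hβ]; simpa using hj⟩
  choose τ hτ using hmem
  have hinj : Function.Injective τ := by
    intro i j h
    apply hf
    rw [← hτ, ← hτ, h]
  exact ⟨ν, hν, Equiv.ofBijective τ (Finite.injective_iff_bijective.1 hinj), hτ⟩

/-- The Cauchy–Binet formula, with the maximal minors indexed by Young diagrams. -/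
theorem det_sum_mul_eq_sum_boxDiagrams {R : Type*} [CommRing R] {n m : ℕ}
    (A : Fin n → ℕ → R) (B : ℕ → Fin n → R) :
    Matrix.det (Matrix.of fun i k : Fin n => ∑ l ∈ Finset.range (m + n), A i l * B l k) =
      ∑ ν ∈ boxDiagrams n m,
        Matrix.det (Matrix.of fun i j : Fin n => A i (betaNum n ν j)) *
          Matrix.det (Matrix.of fun j k : Fin n => B (betaNum n ν j) k) := by
  classical
  have h1 : Matrix.det (Matrix.of fun i k : Fin n => ∑ l ∈ Finset.range (m + n), A i l * B l k) =
      ∑ f ∈ Fintype.piFinset fun _ : Fin n => Finset.range (m + n),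
        (∏ i, A i (f i)) * Matrix.det (Matrix.of fun i k : Fin n => B (f i) k) := by
    have := (Matrix.detRowAlternating (n := Fin n) (R := R)).toMultilinearMap.map_sum_finset
      (fun i l => A i l • B l) (fun _ => Finset.range (m + n))
    simp only [AlternatingMap.coe_multilinearMap] at this
    have e : (Matrix.of fun i k : Fin n => ∑ l ∈ Finset.range (m + n), A i l * B l k) =
        fun i : Fin n => ∑ l ∈ Finset.range (m + n), A i l • B l := by
      funext i k
      simp [Finset.sum_apply]
    rw [e]
    refine this.trans (Finset.sum_congr rfl fun f _ => ?_)
    have h2 := (Matrix.detRowAlternating (n := Fin n) (R := R)).toMultilinearMap.map_smul_univ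
      (fun i => A i (f i)) (fun i => B (f i))
    exact h2
  have h2 : ∑ f ∈ Fintype.piFinset fun _ : Fin n => Finset.range (m + n),
        (∏ i, A i (f i)) * Matrix.det (Matrix.of fun i k : Fin n => B (f i) k) =
      ∑ f ∈ (Fintype.piFinset fun _ : Fin n => Finset.range (m + n)).filter Function.Injective,
        (∏ i, A i (f i)) * Matrix.det (Matrix.of fun i k : Fin n => B (f i) k) := by
    symm
    apply Finset.sum_subset (Finset.filter_subset _ _)
    intro f hf hf'
    have hni : ¬ Function.Injective f := fun h => hf' (Finset.mem_filter.2 ⟨hf, h⟩)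
    simp only [Function.Injective, not_forall] at hni
    obtain ⟨i, j, hij, hne⟩ := hni
    rw [Matrix.det_zero_of_row_eq hne (by funext k; simp [hij]), mul_zero]
  have h3 : ∑ x ∈ boxDiagrams n m ×ˢ (Finset.univ : Finset (Equiv.Perm (Fin n))),
        (∏ i, A i (betaNum n x.1 (x.2 i))) *
          Matrix.det (Matrix.of fun i k : Fin n => B (betaNum n x.1 (x.2 i)) k) =
      ∑ f ∈ (Fintype.piFinset fun _ : Fin n => Finset.range (m + n)).filter Function.Injective,
        (∏ i, A i (f i)) * Matrix.det (Matrix.of fun i k : Fin n => B (f i) k) := by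
    refine Finset.sum_bij (fun x _ => fun i => betaNum n x.1 (x.2 i)) ?_ ?_ ?_ ?_
    · rintro ⟨ν, σ⟩ h
      obtain ⟨h1, -⟩ := Finset.mem_product.1 h
      have h2 := mem_boxDiagrams.1 h1
      rw [Finset.mem_filter, Fintype.mem_piFinset]
      refine ⟨fun i => ?_, (betaNum_strictAnti n ν).injective.comp σ.injective⟩
      have h3 := h2.2 (σ i)
      have := (σ i).isLt
      simp only [betaNum, Finset.mem_range] at h3 ⊢
      omega
    · rintro ⟨μ, σ⟩ h ⟨ν, τ⟩ h' heq
      have hμ := (mem_boxDiagrams.1 (Finset.mem_product.1 h).1).1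
      have hν := (mem_boxDiagrams.1 (Finset.mem_product.1 h').1).1
      simp only at heq hμ hν
      have hr : Set.range (fun i => -(betaNum n μ i : ℤ)) =
          Set.range (fun i => -(betaNum n ν i : ℤ)) := by
        have e1 : (fun i => -(betaNum n μ i : ℤ)) ∘ σ = (fun i => -(betaNum n ν i : ℤ)) ∘ τ := by
          funext i
          have := congrFun heq i
          simp [this]
        rw [← σ.surjective.range_comp, e1, τ.surjective.range_comp]
      have sm : ∀ ρ : YoungDiagram, StrictMono fun i => -(betaNum n ρ i : ℤ) := fun ρ i j hij => by
        have := betaNum_strictAnti n ρ hij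
        simp only
        omega
      have e2 := (StrictMono.range_inj (sm μ) (sm ν)).1 hr
      have e3 : μ = ν := betaNum_injective hμ hν (by
        funext i
        have : -(betaNum n μ i : ℤ) = -(betaNum n ν i : ℤ) := congrFun e2 i
        omega)
      subst e3
      congr 1
      ext i
      have := (betaNum_strictAnti n μ).injective (congrFun heq i)
      rw [this]
    · intro f hf
      obtain ⟨hf1, hf2⟩ := Finset.mem_filter.1 hf
      obtain ⟨ν, hν, σ, hσ⟩ := exists_betaNum_perm hf2
      refine ⟨(ν, σ), Finset.mem_product.2 ⟨mem_boxDiagrams.2 ⟨hν, fun i => ?_⟩,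
        Finset.mem_univ _⟩, funext hσ⟩
      refine (ν.rowLen_anti 0 i (Nat.zero_le _)).trans ?_
      rcases Nat.eq_zero_or_pos n with h0 | h0
      · rw [rowLen_eq_zero (by omega)]
        exact Nat.zero_le _
      · have h4 := hσ (σ.symm ⟨0, h0⟩)
        rw [Equiv.apply_symm_apply] at h4
        have h5 := Fintype.mem_piFinset.1 hf1 (σ.symm ⟨0, h0⟩)
        rw [← h4, Finset.mem_range] at h5
        simp only [betaNum] at h5
        omega
    · intros
      rfl
  rw [h1, h2, ← h3, Finset.sum_product]
  refine Finset.sum_congr rfl fun ν _ => ?_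
  have h4 : ∀ σ : Equiv.Perm (Fin n),
      Matrix.det (Matrix.of fun i k : Fin n => B (betaNum n ν (σ i)) k) =
        ((Equiv.Perm.sign σ : ℤ) : R) *
          Matrix.det (Matrix.of fun i k : Fin n => B (betaNum n ν i) k) := fun σ =>
    Matrix.det_permute σ (Matrix.of fun i k : Fin n => B (betaNum n ν i) k)
  simp only [h4]
  generalize Matrix.det (Matrix.of fun i k : Fin n => B (betaNum n ν i) k) = dB
  rw [← Matrix.det_transpose (Matrix.of fun i j : Fin n => A i (betaNum n ν j)), Matrix.det_apply',
    Finset.sum_mul]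
  refine Finset.sum_congr rfl fun σ _ => ?_
  simp only [Matrix.transpose_apply, Matrix.of_apply]
  ring

/-! ### Skew Schur functions -/

theorem completeSymmInt_of_neg (P : ℕ → ℂ) {m : ℤ} (h : m < 0) : completeSymmInt P m = 0 :=
  if_pos h

theorem completeSymmInt_natCast (P : ℕ → ℂ) (m : ℕ) : completeSymmInt P (m : ℤ) = completeSymm P m := by
  rw [completeSymmInt, if_neg (by omega), Int.toNat_natCast]

theorem completeSymmInt_sub_of_le (P : ℕ → ℂ) {a b : ℕ} (h : b ≤ a) :
    completeSymmInt P ((a : ℤ) - b) = completeSymm P (a - b) := by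
  rw [← completeSymmInt_natCast, Nat.cast_sub h]

theorem completeSymmInt_sub_of_lt (P : ℕ → ℂ) {a b : ℕ} (h : a < b) :
    completeSymmInt P ((a : ℤ) - b) = 0 :=
  completeSymmInt_of_neg P (by omega)

theorem completeSymmInt_add (P P' : ℕ → ℂ) {a b L : ℕ} (hL : a < L) :
    completeSymmInt (fun k => P k + P' k) ((a : ℤ) - b) =
      ∑ l ∈ Finset.range L, completeSymmInt P' ((a : ℤ) - l) * completeSymmInt P ((l : ℤ) - b) := by
  rcases lt_or_ge a b with h | h
  · rw [completeSymmInt_sub_of_lt _ h, Finset.sum_eq_zero]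
    intro l _
    rcases lt_or_ge a l with h1 | h1
    · rw [completeSymmInt_sub_of_lt _ h1, zero_mul]
    · rw [completeSymmInt_sub_of_lt _ (h1.trans_lt h), mul_zero]
  · have h1 : ∑ l ∈ Finset.Ico b (a + 1),
        completeSymmInt P' ((a : ℤ) - l) * completeSymmInt P ((l : ℤ) - b) =
        ∑ l ∈ Finset.range L, completeSymmInt P' ((a : ℤ) - l) * completeSymmInt P ((l : ℤ) - b) := by
      apply Finset.sum_subset
      · intro l hl
        rw [Finset.mem_Ico] at hl
        rw [Finset.mem_range]
        omega
      · intro l _ hl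
        rw [Finset.mem_Ico] at hl
        rcases lt_or_ge a l with h1 | h1
        · rw [completeSymmInt_sub_of_lt _ h1, zero_mul]
        · rw [completeSymmInt_sub_of_lt P (by omega : l < b), mul_zero]
    rw [← h1, Finset.sum_Ico_eq_sum_range, completeSymmInt_sub_of_le _ h, completeSymm_add,
      Finset.Nat.sum_antidiagonal_eq_sum_range_succ_mk, show a + 1 - b = (a - b).succ by omega]
    refine Finset.sum_congr rfl fun k hk => ?_
    rw [Finset.mem_range] at hk
    rw [completeSymmInt_sub_of_le _ (by omega), completeSymmInt_sub_of_le _ (by omega), mul_comm]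
    congr 2 <;> omega

/-- The Jacobi–Trudi matrix with `n` rows. -/
def jacobiTrudi (n : ℕ) (P : ℕ → ℂ) (ν χ : YoungDiagram) : Matrix (Fin n) (Fin n) ℂ :=
  Matrix.of fun i j => completeSymmInt P ((betaNum n ν i : ℤ) - betaNum n χ j)

theorem jacobiTrudi_apply (n : ℕ) (P : ℕ → ℂ) (ν χ : YoungDiagram) (i j : Fin n) :
    jacobiTrudi n P ν χ i j =
      completeSymmInt P ((ν.rowLen i : ℤ) - (χ.rowLen j : ℤ) - (i.val : ℤ) + (j.val : ℤ)) := by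
  have hi := i.isLt
  have hj := j.isLt
  rw [jacobiTrudi, Matrix.of_apply]
  congr 1
  simp only [betaNum]
  omega

theorem det_jacobiTrudi_succ {n : ℕ} (P : ℕ → ℂ) {ν χ : YoungDiagram} (hν : ν.colLen 0 ≤ n)
    (hχ : χ.colLen 0 ≤ n) : (jacobiTrudi (n + 1) P ν χ).det = (jacobiTrudi n P ν χ).det := by
  rw [Matrix.det_succ_row _ (Fin.last n), Finset.sum_eq_single (Fin.last n)]
  · rw [jacobiTrudi_apply, rowLen_eq_zero (i := (Fin.last n).val) (by simpa using hν),
      rowLen_eq_zero (i := (Fin.last n).val) (by simpa using hχ)]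
    have h0 : completeSymmInt P ((0 : ℕ) - (0 : ℕ) - ((Fin.last n).val : ℤ) + ((Fin.last n).val : ℤ))
        = 1 := by
      rw [show ((0 : ℕ) - (0 : ℕ) - ((Fin.last n).val : ℤ) + ((Fin.last n).val : ℤ)) = (0 : ℕ) by
        push_cast; ring, completeSymmInt_natCast, completeSymm_zero]
    rw [h0, mul_one, ← two_mul, pow_mul, neg_one_sq, one_pow, one_mul]
    congr 1
    ext i j
    simp [jacobiTrudi_apply]
  · intro j _ hj
    have hj' : j.val < n := by
      have := j.isLt
      have h2 : j.val ≠ n := fun h => hj (Fin.ext h)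
      omega
    rw [jacobiTrudi_apply, rowLen_eq_zero (i := (Fin.last n).val) (by simpa using hν),
      completeSymmInt_of_neg, mul_zero, zero_mul]
    simp only [Fin.val_last]
    omega
  · simp

theorem skewSchur_eq_det {n : ℕ} (P : ℕ → ℂ) {ν χ : YoungDiagram} (hν : ν.colLen 0 ≤ n)
    (hχ : χ.colLen 0 ≤ n) : skewSchur P ν χ = (jacobiTrudi n P ν χ).det := by
  have h0 : skewSchur P ν χ = (jacobiTrudi (max (ν.colLen 0) (χ.colLen 0)) P ν χ).det := by
    rw [skewSchur]
    congr 1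
    ext i j
    rw [jacobiTrudi_apply, Matrix.of_apply]
  rw [h0]
  obtain ⟨k, rfl⟩ := Nat.exists_eq_add_of_le (max_le hν hχ)
  clear h0 hν hχ
  induction k with
  | zero => rfl
  | succ k ih =>
    rw [ih, ← add_assoc, det_jacobiTrudi_succ]
    · exact (le_max_left _ _).trans (Nat.le_add_right _ _)
    · exact (le_max_right _ _).trans (Nat.le_add_right _ _)

theorem skewSchur_eq_zero (P : ℕ → ℂ) {ν χ : YoungDiagram} (h : ¬ χ ≤ ν) : skewSchur P ν χ = 0 := by
  rw [le_iff_rowLen, not_forall] at h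
  obtain ⟨r, hr⟩ := h
  set n := max (ν.colLen 0) (χ.colLen 0) with hn
  have hrn : r < n := by
    by_contra h1
    rw [rowLen_eq_zero (μ := χ) ((le_max_right _ _).trans (not_lt.1 h1))] at hr
    omega
  rw [skewSchur_eq_det P (le_max_left _ _) (le_max_right _ _), ← hn, Matrix.det_apply]
  refine Finset.sum_eq_zero fun σ _ => ?_
  obtain ⟨j, hj, hσ⟩ : ∃ j : Fin n, j.val ≤ r ∧ r ≤ (σ j).val := by
    by_contra hcon
    push Not at hcon
    have h1 : ((Finset.univ.filter fun j : Fin n => j.val ≤ r).image σ).card ≤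
        (Finset.univ.filter fun j : Fin n => j.val < r).card := by
      apply Finset.card_le_card
      intro k hk
      obtain ⟨j, hj, rfl⟩ := Finset.mem_image.1 hk
      rw [Finset.mem_filter] at hj ⊢
      exact ⟨Finset.mem_univ _, hcon j hj.2⟩
    rw [Finset.card_image_of_injective _ σ.injective] at h1
    have h2 : (Finset.univ.filter fun j : Fin n => j.val < r) ⊂
        (Finset.univ.filter fun j : Fin n => j.val ≤ r) := by
      rw [Finset.ssubset_iff_of_subset]
      · exact ⟨⟨r, hrn⟩, by simp, by simp⟩
      · intro j hj
        rw [Finset.mem_filter] at hj ⊢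
        exact ⟨hj.1, hj.2.le⟩
    have := Finset.card_lt_card h2
    omega
  rw [Finset.prod_eq_zero (Finset.mem_univ j), smul_zero]
  rw [jacobiTrudi_apply]
  apply completeSymmInt_of_neg
  have h1 := ν.rowLen_anti r (σ j) hσ
  have h2 := χ.rowLen_anti j r hj
  omega

theorem skewSchur_congr {P P' : ℕ → ℂ} {ν : YoungDiagram} (χ : YoungDiagram)
    (h : ∀ k, 1 ≤ k → k ≤ 2 * ν.card → P k = P' k) : skewSchur P ν χ = skewSchur P' ν χ := by
  by_cases hχ : χ ≤ ν
  · rw [skewSchur_eq_det P le_rfl (colLen_mono hχ), skewSchur_eq_det P' le_rfl (colLen_mono hχ)]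
    congr 1
    ext i j
    simp only [jacobiTrudi, Matrix.of_apply]
    rcases lt_or_ge (betaNum _ ν i) (betaNum _ χ j) with h1 | h1
    · rw [completeSymmInt_sub_of_lt _ h1, completeSymmInt_sub_of_lt _ h1]
    · rw [completeSymmInt_sub_of_le _ h1, completeSymmInt_sub_of_le _ h1]
      refine completeSymm_congr fun k hk hk' => h k hk (hk'.trans ?_)
      have h2 := rowLen_le_card ν i
      have h3 := colLen_le_card ν
      have h4 : betaNum (ν.colLen 0) ν i ≤ 2 * ν.card := by
        simp only [betaNum]
        omega
      omega
  · rw [skewSchur_eq_zero _ hχ, skewSchur_eq_zero _ hχ]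

theorem sum_betaNum_sub {n : ℕ} {ν χ : YoungDiagram} (hν : ν.colLen 0 ≤ n) (hχ : χ.colLen 0 ≤ n)
    (σ : Equiv.Perm (Fin n)) :
    ∑ i, ((betaNum n ν (σ i) : ℤ) - betaNum n χ i) = (ν.card : ℤ) - χ.card := by
  rw [Finset.sum_sub_distrib, Equiv.sum_comp σ fun i => (betaNum n ν i : ℤ), ← Nat.cast_sum,
    ← Nat.cast_sum, sum_betaNum hν, sum_betaNum hχ]
  push_cast
  ring

theorem prod_completeSymmInt_scale {n : ℕ} (c : ℂ) (P : ℕ → ℂ) {ν χ : YoungDiagram}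
    (hν : ν.colLen 0 ≤ n) (hχ : χ.colLen 0 ≤ n) (σ : Equiv.Perm (Fin n)) :
    ∏ i, jacobiTrudi n (fun k => c ^ k * P k) ν χ (σ i) i =
      c ^ (ν.card - χ.card) * ∏ i, jacobiTrudi n P ν χ (σ i) i := by
  simp only [jacobiTrudi, Matrix.of_apply]
  by_cases h : ∀ i, betaNum n χ i ≤ betaNum n ν (σ i)
  · have h1 : ν.card - χ.card = ∑ i, (betaNum n ν (σ i) - betaNum n χ i) := by
      have h2 := sum_betaNum_sub hν hχ σ
      have h3 : ((∑ i, (betaNum n ν (σ i) - betaNum n χ i) : ℕ) : ℤ) = (ν.card : ℤ) - χ.card := by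
        rw [← h2]
        push_cast
        exact Finset.sum_congr rfl fun i _ => Nat.cast_sub (h i)
      omega
    rw [h1, ← Finset.prod_pow_eq_pow_sum, ← Finset.prod_mul_distrib]
    refine Finset.prod_congr rfl fun i _ => ?_
    rw [completeSymmInt_sub_of_le _ (h i), completeSymmInt_sub_of_le _ (h i), completeSymm_scale]
  · push Not at h
    obtain ⟨i, hi⟩ := h
    rw [Finset.prod_eq_zero (Finset.mem_univ i) (completeSymmInt_sub_of_lt _ hi),
      Finset.prod_eq_zero (Finset.mem_univ i) (completeSymmInt_sub_of_lt _ hi), mul_zero]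

theorem skewSchur_scale (c : ℂ) (P : ℕ → ℂ) (ν χ : YoungDiagram) :
    skewSchur (fun k => c ^ k * P k) ν χ = c ^ (ν.card - χ.card) * skewSchur P ν χ := by
  have h1 := le_max_left (ν.colLen 0) (χ.colLen 0)
  have h2 := le_max_right (ν.colLen 0) (χ.colLen 0)
  rw [skewSchur_eq_det _ h1 h2, skewSchur_eq_det _ h1 h2, Matrix.det_apply, Matrix.det_apply,
    Finset.mul_sum]
  refine Finset.sum_congr rfl fun σ _ => ?_
  rw [prod_completeSymmInt_scale c P h1 h2, mul_smul_comm]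

theorem schur_scale (c : ℂ) (P : ℕ → ℂ) (ν : YoungDiagram) :
    schur (fun k => c ^ k * P k) ν = c ^ ν.card * schur P ν := by
  rw [schur, schur, skewSchur_scale, card_bot, Nat.sub_zero]

theorem schur_bot (P : ℕ → ℂ) : schur P ⊥ = 1 := by
  rw [schur, skewSchur_eq_det (n := 0) P (by rw [colLen_bot]) (by rw [colLen_bot])]
  exact Matrix.det_isEmpty

theorem schur_zero_fun {ν : YoungDiagram} (h : ν ≠ ⊥) : schur (fun _ => 0) ν = 0 := by
  have h1 : schur (fun k => 0 ^ k * (0 : ℂ)) ν = 0 ^ ν.card * schur (fun _ => 0) ν :=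
    schur_scale 0 (fun _ => 0) ν
  have h2 : ν.card ≠ 0 := fun h0 => h (ext_rowLen fun i => by
    have := rowLen_le_card ν i
    rw [rowLen_bot]
    omega)
  simpa [zero_pow h2] using h1

theorem sum_schur_mul_skewSchur (P P' : ℕ → ℂ) (ν : YoungDiagram) :
    ∑ χ ∈ subdiagrams ν, schur P χ * skewSchur P' ν χ = schur (fun k => P k + P' k) ν := by
  set n := ν.colLen 0 with hn
  have hb : (⊥ : YoungDiagram).colLen 0 ≤ n := by rw [colLen_bot]; exact Nat.zero_le _
  have h1 : schur (fun k => P k + P' k) ν =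
      Matrix.det (Matrix.of fun i k : Fin n => ∑ l ∈ Finset.range (ν.rowLen 0 + n),
        completeSymmInt P' ((betaNum n ν i : ℤ) - l) *
          completeSymmInt P ((l : ℤ) - betaNum n ⊥ k)) := by
    rw [schur, skewSchur_eq_det _ hn.symm.le hb]
    congr 1
    ext i k
    rw [jacobiTrudi, Matrix.of_apply, Matrix.of_apply]
    refine completeSymmInt_add P P' ?_
    have h2 := ν.rowLen_anti 0 i (Nat.zero_le _)
    have := i.isLt
    simp only [betaNum]
    omega
  rw [h1, det_sum_mul_eq_sum_boxDiagrams]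
  have h2 : ∀ χ ∈ boxDiagrams n (ν.rowLen 0), schur P χ * skewSchur P' ν χ =
      Matrix.det (Matrix.of fun i j : Fin n =>
        completeSymmInt P' ((betaNum n ν i : ℤ) - betaNum n χ j)) *
      Matrix.det (Matrix.of fun j k : Fin n =>
        completeSymmInt P ((betaNum n χ j : ℤ) - betaNum n ⊥ k)) := by
    intro χ hχ
    have hχn := (mem_boxDiagrams.1 hχ).1
    rw [schur, skewSchur_eq_det _ hχn hb, skewSchur_eq_det _ hn.symm.le hχn, mul_comm]
    rfl
  rw [← Finset.sum_congr rfl h2]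
  apply Finset.sum_subset
  · intro χ hχ
    rw [mem_subdiagrams] at hχ
    rw [mem_boxDiagrams]
    exact ⟨colLen_mono hχ, fun i =>
      (le_iff_rowLen.1 hχ i).trans (ν.rowLen_anti 0 i (Nat.zero_le _))⟩
  · intro χ _ hχ
    rw [mem_subdiagrams] at hχ
    rw [skewSchur_eq_zero _ hχ, mul_zero]

theorem norm_det_le_prod_sum {n : ℕ} (A : Matrix (Fin n) (Fin n) ℂ) :
    ‖A.det‖ ≤ ∏ j, ∑ i, ‖A i j‖ := by
  classical
  rw [Matrix.det_apply]
  calc ‖∑ σ : Equiv.Perm (Fin n), Equiv.Perm.sign σ • ∏ i, A (σ i) i‖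
      ≤ ∑ σ : Equiv.Perm (Fin n), ∏ i, ‖A (σ i) i‖ := by
        refine norm_sum_le_of_le _ fun σ _ => ?_
        rcases Int.units_eq_one_or (Equiv.Perm.sign σ) with h | h <;>
          simp [h]
    _ = ∑ f ∈ Finset.univ.image (fun σ : Equiv.Perm (Fin n) => (σ : Fin n → Fin n)),
          ∏ i, ‖A (f i) i‖ := by
        rw [Finset.sum_image]
        intro σ _ τ _ h
        exact DFunLike.coe_injective h
    _ ≤ ∑ f : Fin n → Fin n, ∏ i, ‖A (f i) i‖ :=
        Finset.sum_le_sum_of_subset_of_nonneg (Finset.subset_univ _) fun f _ _ =>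
          Finset.prod_nonneg fun i _ => norm_nonneg _
    _ = ∏ j, ∑ i, ‖A i j‖ := by
        rw [Finset.prod_univ_sum, Fintype.piFinset_univ]

theorem norm_skewSchur_le_of_half {P : ℕ → ℂ} (hP : ∀ k, 1 ≤ k → ‖P k‖ ≤ (1 / 2 : ℝ) ^ k)
    {ν χ : YoungDiagram} (h : χ ≤ ν) : ‖skewSchur P ν χ‖ ≤ 2 ^ ν.card := by
  rw [skewSchur_eq_det P le_rfl (colLen_mono h)]
  set n := ν.colLen 0 with hn
  have hcol : ∀ j : Fin n, ∑ i, ‖jacobiTrudi n P ν χ i j‖ ≤ 2 := by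
    intro j
    set b := betaNum n χ j
    have e : ∑ i, ‖jacobiTrudi n P ν χ i j‖ =
        ∑ l ∈ Finset.univ.image (betaNum n ν), ‖completeSymmInt P ((l : ℤ) - b)‖ := by
      rw [Finset.sum_image fun i _ j _ hij => (betaNum_strictAnti n ν).injective hij]
      rfl
    rw [e]
    calc ∑ l ∈ Finset.univ.image (betaNum n ν), ‖completeSymmInt P ((l : ℤ) - b)‖
        = ∑ l ∈ (Finset.univ.image (betaNum n ν)).filter (fun l => b ≤ l),
            ‖completeSymmInt P ((l : ℤ) - b)‖ := by
          symm
          apply Finset.sum_subset (Finset.filter_subset _ _)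
          intro l hl hl'
          have : l < b := by
            by_contra h1
            exact hl' (Finset.mem_filter.2 ⟨hl, not_lt.1 h1⟩)
          rw [completeSymmInt_sub_of_lt _ this, norm_zero]
      _ ≤ ∑ l ∈ (Finset.univ.image (betaNum n ν)).filter (fun l => b ≤ l),
            (1 / 2 : ℝ) ^ (l - b) := by
          refine Finset.sum_le_sum fun l hl => ?_
          rw [completeSymmInt_sub_of_le _ (Finset.mem_filter.1 hl).2]
          exact norm_completeSymm_le (by norm_num) hP _
      _ = ∑ m ∈ ((Finset.univ.image (betaNum n ν)).filter (fun l => b ≤ l)).image (· - b),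
            (1 / 2 : ℝ) ^ m := by
          rw [Finset.sum_image]
          intro l hl l' hl' hll
          have h1 := (Finset.mem_filter.1 hl).2
          have h2 := (Finset.mem_filter.1 hl').2
          simp only at hll
          omega
      _ ≤ ∑' m : ℕ, (1 / 2 : ℝ) ^ m :=
          summable_geometric_two.sum_le_tsum _ fun _ _ => by positivity
      _ = 2 := tsum_geometric_two
  calc ‖(jacobiTrudi n P ν χ).det‖ ≤ ∏ j, ∑ i, ‖jacobiTrudi n P ν χ i j‖ := norm_det_le_prod_sum _
    _ ≤ ∏ _j : Fin n, (2 : ℝ) :=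
        Finset.prod_le_prod (fun j _ => Finset.sum_nonneg fun i _ => norm_nonneg _)
          fun j _ => hcol j
    _ = 2 ^ n := by simp
    _ ≤ 2 ^ ν.card := pow_le_pow_right₀ (by norm_num) (colLen_le_card ν)

theorem norm_skewSchur_le {P : ℕ → ℂ} {R : ℝ} (hR : 1 ≤ R) (hP : ∀ k, 1 ≤ k → ‖P k‖ ≤ R ^ k)
    (ν χ : YoungDiagram) : ‖skewSchur P ν χ‖ ≤ (4 * R) ^ ν.card := by
  by_cases h : χ ≤ ν
  · have hR0 : (0 : ℝ) < 2 * R := by linarith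
    have hR1 : ((2 * R : ℝ) : ℂ) ≠ 0 := by exact_mod_cast hR0.ne'
    have e : P = fun k => ((2 * R : ℝ) : ℂ) ^ k * (P k / ((2 * R : ℝ) : ℂ) ^ k) := by
      funext k
      rw [mul_div_cancel₀ _ (pow_ne_zero k hR1)]
    rw [e, skewSchur_scale, norm_mul, norm_pow, Complex.norm_real, Real.norm_of_nonneg hR0.le]
    have h1 : ‖skewSchur (fun k => P k / ((2 * R : ℝ) : ℂ) ^ k) ν χ‖ ≤ 2 ^ ν.card := by
      apply norm_skewSchur_le_of_half _ h
      intro k hk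
      rw [norm_div, norm_pow, Complex.norm_real, Real.norm_of_nonneg hR0.le, mul_pow,
        div_le_iff₀ (by positivity), ← mul_assoc, ← mul_pow]
      simpa using hP k hk
    calc (2 * R) ^ (ν.card - χ.card) * ‖skewSchur (fun k => P k / ((2 * R : ℝ) : ℂ) ^ k) ν χ‖
        ≤ (2 * R) ^ ν.card * 2 ^ ν.card :=
          mul_le_mul (pow_le_pow_right₀ (by linarith) (Nat.sub_le _ _)) h1 (norm_nonneg _)
            (by positivity)
      _ = (4 * R) ^ ν.card := by
          rw [← mul_pow]
          congr 1
          ring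
  · rw [skewSchur_eq_zero P h, norm_zero]
    positivity

/-! ### Finite alphabets and the Cauchy identity -/

/-- The power sums of a finite alphabet. -/
def powerSum {n : ℕ} (x : Fin n → ℂ) (k : ℕ) : ℂ := ∑ i, x i ^ k

/-- The polynomial `∏_{k ≠ l} (1 - x_k t)`. -/
def omitPoly {n : ℕ} (x : Fin n → ℂ) (l : Fin n) : Polynomial ℂ :=
  ∏ k ∈ Finset.univ.erase l, (1 - Polynomial.C (x k) * Polynomial.X)

theorem completeSeries_pow_mul (c : ℂ) :
    completeSeries (fun k => c ^ k) * ((1 - Polynomial.C c * Polynomial.X : Polynomial ℂ) :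
      PowerSeries ℂ) = 1 := by
  ext m
  rw [Polynomial.coe_sub, Polynomial.coe_one, Polynomial.coe_mul, Polynomial.coe_C,
    Polynomial.coe_X, mul_sub, mul_one, map_sub, mul_left_comm, PowerSeries.coeff_C_mul]
  cases m with
  | zero => simp [coeff_completeSeries, completeSymm_pow]
  | succ m =>
    rw [PowerSeries.coeff_succ_mul_X, coeff_completeSeries, coeff_completeSeries,
      completeSymm_pow, completeSymm_pow, PowerSeries.coeff_one, if_neg (Nat.succ_ne_zero m)]
    ring

theorem completeSeries_powerSum {n : ℕ} (x : Fin n → ℂ) :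
    completeSeries (powerSum x) = ∏ i, completeSeries (fun k => x i ^ k) :=
  completeSeries_sum Finset.univ fun i k => x i ^ k

theorem completeSeries_powerSum_mul {n : ℕ} (x : Fin n → ℂ) (l : Fin n) :
    completeSeries (powerSum x) * (omitPoly x l : PowerSeries ℂ) =
      completeSeries (fun k => x l ^ k) := by
  have h : (omitPoly x l : PowerSeries ℂ) = ∏ k ∈ Finset.univ.erase l,
      ((1 - Polynomial.C (x k) * Polynomial.X : Polynomial ℂ) : PowerSeries ℂ) := by
    rw [omitPoly, ← Polynomial.coeToPowerSeries.ringHom_apply, map_prod]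
    rfl
  rw [completeSeries_powerSum, h, ← Finset.mul_prod_erase _ _ (Finset.mem_univ l), mul_assoc,
    ← Finset.prod_mul_distrib, Finset.prod_eq_one fun k _ => completeSeries_pow_mul (x k), mul_one]

theorem natDegree_omitPoly_lt {n : ℕ} (x : Fin n → ℂ) (l : Fin n) :
    (omitPoly x l).natDegree < n := by
  have h1 : (omitPoly x l).natDegree ≤ ∑ k ∈ Finset.univ.erase l, 1 := by
    refine (Polynomial.natDegree_prod_le _ _).trans (Finset.sum_le_sum fun k _ => ?_)
    refine (Polynomial.natDegree_sub_le _ _).trans ?_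
    rw [Polynomial.natDegree_one, Nat.zero_max]
    exact (Polynomial.natDegree_C_mul_le _ _).trans Polynomial.natDegree_X_le
  have h2 := l.isLt
  rw [Finset.sum_const, Finset.card_erase_of_mem (Finset.mem_univ l), Finset.card_univ,
    Fintype.card_fin, smul_eq_mul] at h1
  omega

theorem pow_eq_sum_completeSymm {n : ℕ} (x : Fin n → ℂ) (l : Fin n) (m : ℕ) :
    x l ^ m = ∑ j : Fin n, completeSymmInt (powerSum x) ((m : ℤ) - betaNum n ⊥ j) *
      (omitPoly x l).coeff (betaNum n ⊥ j) := by
  have h1 : x l ^ m = ∑ c ∈ Finset.range (m + 1),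
      (omitPoly x l).coeff c * completeSymm (powerSum x) (m - c) := by
    rw [← completeSymm_pow, ← coeff_completeSeries, ← completeSeries_powerSum_mul, mul_comm,
      PowerSeries.coeff_mul, Finset.Nat.sum_antidiagonal_eq_sum_range_succ_mk]
    refine Finset.sum_congr rfl fun c _ => ?_
    rw [coeff_completeSeries, Polynomial.coeff_coe]
  have h2 : ∑ j : Fin n, completeSymmInt (powerSum x) ((m : ℤ) - betaNum n ⊥ j) *
      (omitPoly x l).coeff (betaNum n ⊥ j) = ∑ c ∈ Finset.range n,
        completeSymmInt (powerSum x) ((m : ℤ) - c) * (omitPoly x l).coeff c := by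
    rw [Finset.sum_range, ← Equiv.sum_comp Fin.revPerm]
    refine Finset.sum_congr rfl fun j _ => ?_
    have : betaNum n ⊥ (Fin.revPerm j) = j := by
      have := j.isLt
      simp only [betaNum, rowLen_bot, Fin.revPerm_apply, Fin.val_rev]
      omega
    rw [this]
  have h3 : ∀ K, m + 1 ≤ K → ∑ c ∈ Finset.range (m + 1),
      (omitPoly x l).coeff c * completeSymm (powerSum x) (m - c) =
      ∑ c ∈ Finset.range K, completeSymmInt (powerSum x) ((m : ℤ) - c) * (omitPoly x l).coeff c := by
    intro K hK
    rw [← Finset.sum_subset (Finset.range_subset_range.2 hK)]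
    · refine Finset.sum_congr rfl fun c hc => ?_
      rw [Finset.mem_range] at hc
      rw [completeSymmInt_sub_of_le _ (by omega), mul_comm]
    · intro c _ hc
      rw [Finset.mem_range] at hc
      rw [completeSymmInt_sub_of_lt _ (by omega), zero_mul]
  rw [h1, h2, h3 (max (m + 1) n) (le_max_left _ _)]
  symm
  apply Finset.sum_subset (Finset.range_subset_range.2 (le_max_right _ _))
  intro c _ hc
  rw [Finset.mem_range] at hc
  have := natDegree_omitPoly_lt x l
  rw [Polynomial.coeff_eq_zero_of_natDegree_lt (by omega), mul_zero]

/-- The alternant `det (x_l ^ (ν_i + n - i))`. -/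
def alternant {n : ℕ} (x : Fin n → ℂ) (ν : YoungDiagram) : ℂ :=
  Matrix.det (Matrix.of fun l i : Fin n => x l ^ betaNum n ν i)

theorem alternant_eq_schur_mul {n : ℕ} (x : Fin n → ℂ) {ν : YoungDiagram} (hν : ν.colLen 0 ≤ n) :
    alternant x ν = schur (powerSum x) ν * alternant x ⊥ := by
  have hb : (⊥ : YoungDiagram).colLen 0 ≤ n := by rw [colLen_bot]; exact Nat.zero_le _
  have key : ∀ ρ : YoungDiagram, ρ.colLen 0 ≤ n → alternant x ρ = schur (powerSum x) ρ *
      Matrix.det (Matrix.of fun j l : Fin n => (omitPoly x l).coeff (betaNum n ⊥ j)) := by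
    intro ρ hρ
    rw [schur, skewSchur_eq_det _ hρ hb, ← Matrix.det_mul, alternant, ← Matrix.det_transpose]
    congr 1
    ext i l
    rw [Matrix.transpose_apply, Matrix.of_apply, pow_eq_sum_completeSymm, Matrix.mul_apply]
    rfl
  rw [key ν hν, key ⊥ hb, schur_bot, one_mul]

theorem alternant_bot_ne_zero {n : ℕ} {x : Fin n → ℂ} (hx : Function.Injective x) :
    alternant x ⊥ ≠ 0 := by
  have h : (Matrix.of fun l i : Fin n => x l ^ betaNum n ⊥ i) =
      (Matrix.vandermonde x).submatrix id Fin.revPerm := by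
    ext l i
    have := i.isLt
    rw [Matrix.submatrix_apply, Matrix.vandermonde_apply, Matrix.of_apply]
    congr 1
    simp only [betaNum, rowLen_bot, Fin.revPerm_apply, Fin.val_rev]
    omega
  rw [alternant, h, Matrix.det_permute']
  refine mul_ne_zero ?_ (Matrix.det_vandermonde_ne_zero_iff.2 hx)
  rcases Int.units_eq_one_or (Equiv.Perm.sign (Fin.revPerm (n := n))) with h | h <;> simp [h]

theorem exists_nodup_roots_add_C {g : Polynomial ℂ} {n : ℕ} (hn : 1 ≤ n) (hg : g.natDegree < n) :
    ∃ c : ℂ, (Polynomial.X ^ n + (g + Polynomial.C c)).roots.Nodup := by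
  set f₀ : Polynomial ℂ := Polynomial.X ^ n + g with hf₀
  have hdeg : g.degree < n := (Polynomial.degree_le_natDegree).trans_lt (by exact_mod_cast hg)
  have hmonic : ∀ c, (Polynomial.X ^ n + (g + Polynomial.C c)).Monic := fun c => by
    apply Polynomial.monic_X_pow_add
    refine (Polynomial.degree_add_le _ _).trans_lt (max_lt hdeg ?_)
    exact Polynomial.degree_C_le.trans_lt (by exact_mod_cast hn)
  have hm0 : f₀.Monic := Polynomial.monic_X_pow_add hdeg
  have hnd : f₀.natDegree = n := by
    rw [hf₀, Polynomial.natDegree_add_eq_left_of_natDegree_lt] <;>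
      simp only [Polynomial.natDegree_X_pow, hg]
  have hd0 : Polynomial.derivative f₀ ≠ 0 := by
    intro h
    have := Polynomial.derivative_eq_zero.1 h
    omega
  obtain ⟨c, hc⟩ := Infinite.exists_notMem_finset
    ((Polynomial.derivative f₀).roots.toFinset.image fun z => -f₀.eval z)
  refine ⟨c, ?_⟩
  have e : Polynomial.X ^ n + (g + Polynomial.C c) = f₀ + Polynomial.C c := by rw [hf₀, add_assoc]
  rw [Multiset.nodup_iff_count_le_one]
  intro z
  rw [Polynomial.count_roots]
  by_contra h
  rw [not_le, Polynomial.one_lt_rootMultiplicity_iff_isRoot (hmonic c).ne_zero, e] at h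
  apply hc
  rw [Finset.mem_image]
  refine ⟨z, ?_, ?_⟩
  · rw [Multiset.mem_toFinset, Polynomial.mem_roots hd0]
    simpa using h.2
  · have := h.1
    rw [Polynomial.IsRoot.def, Polynomial.eval_add, Polynomial.eval_C] at this
    exact neg_eq_of_add_eq_zero_right this

theorem exists_injective_prod_eq {g : Polynomial ℂ} {n : ℕ} (hn : 1 ≤ n) (hg : g.natDegree < n) :
    ∃ (c : ℂ) (x : Fin n → ℂ), Function.Injective x ∧
      ∏ i, (Polynomial.X - Polynomial.C (x i)) = Polynomial.X ^ n + (g + Polynomial.C c) := by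
  obtain ⟨c, hc⟩ := exists_nodup_roots_add_C hn hg
  set f : Polynomial ℂ := Polynomial.X ^ n + (g + Polynomial.C c) with hf
  have hlt : (g + Polynomial.C c).natDegree < n := by
    rw [Polynomial.natDegree_add_C]
    exact hg
  have hm : f.Monic := Polynomial.monic_X_pow_add
    ((Polynomial.degree_le_natDegree).trans_lt (by exact_mod_cast hlt))
  have hnd : f.natDegree = n := by
    rw [hf, Polynomial.natDegree_add_eq_left_of_natDegree_lt] <;>
      simp only [Polynomial.natDegree_X_pow, hlt]
  have hs : f.Splits := IsAlgClosed.splits f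
  have hcard : f.roots.toFinset.card = n := by
    rw [Multiset.toFinset_card_of_nodup hc, ← hs.natDegree_eq_card_roots, hnd]
  let x := (Finset.equivFinOfCardEq hcard).symm
  refine ⟨c, fun i => (x i : ℂ), fun i j h => x.injective (Subtype.ext h), ?_⟩
  have h1 : ∏ i, (Polynomial.X - Polynomial.C (x i : ℂ)) =
      ∏ z : f.roots.toFinset, (Polynomial.X - Polynomial.C (z : ℂ)) :=
    Equiv.prod_comp x fun z => Polynomial.X - Polynomial.C (z : ℂ)
  rw [h1, Finset.prod_coe_sort f.roots.toFinset fun z => Polynomial.X - Polynomial.C z,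
    Finset.prod, Multiset.toFinset_val, hc.dedup, ← hs.eq_prod_roots_of_monic hm]

theorem exists_alphabet (P : ℕ → ℂ) (D : ℕ) :
    ∃ x : Fin (D + 1) → ℂ, Function.Injective x ∧ ∀ k, 1 ≤ k → k ≤ D → powerSum x k = P k := by
  set e : ℕ → ℂ := completeSymm (fun k => -P k) with he
  have he0 : e 0 = 1 := completeSymm_zero _
  set g : Polynomial ℂ := ∑ m ∈ Finset.range D,
    Polynomial.C (e (m + 1)) * Polynomial.X ^ (D - m) with hg
  have hgdeg : g.natDegree < D + 1 := Nat.lt_succ_of_le <|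
    Polynomial.natDegree_sum_le_of_forall_le _ _ fun m _ =>
      (Polynomial.natDegree_C_mul_X_pow_le _ _).trans (Nat.sub_le _ _)
  obtain ⟨c, x, hx, hprod⟩ := exists_injective_prod_eq (Nat.succ_pos D) hgdeg
  refine ⟨x, hx, eq_of_completeSymm_eq fun n hn => ?_⟩
  have hE : ∏ i, (1 - Polynomial.C (x i) * Polynomial.X) =
      ∑ m ∈ Finset.range (D + 1), Polynomial.C (e m) * Polynomial.X ^ m +
        Polynomial.C c * Polynomial.X ^ (D + 1) := by
    apply Polynomial.funext
    intro t
    rcases eq_or_ne t 0 with rfl | ht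
    · simp [Polynomial.eval_prod, Polynomial.eval_finsetSum, Finset.sum_range_succ', he0]
    · have h1 := congrArg (Polynomial.eval t⁻¹) hprod
      have h2 : ∏ i, (1 - x i * t) = t ^ (D + 1) * ∏ i, (t⁻¹ - x i) := by
        have h3 : t ^ (D + 1) = ∏ _i : Fin (D + 1), t := by simp
        rw [h3, ← Finset.prod_mul_distrib]
        refine Finset.prod_congr rfl fun i _ => ?_
        rw [mul_sub, mul_inv_cancel₀ ht, mul_comm]
      simp only [Polynomial.eval_prod, Polynomial.eval_sub, Polynomial.eval_X,
        Polynomial.eval_C, Polynomial.eval_add, Polynomial.eval_pow, hg,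
        Polynomial.eval_finsetSum, Polynomial.eval_mul] at h1
      simp only [Polynomial.eval_prod, Polynomial.eval_sub, Polynomial.eval_X,
        Polynomial.eval_C, Polynomial.eval_add, Polynomial.eval_pow, Polynomial.eval_one,
        Polynomial.eval_finsetSum, Polynomial.eval_mul]
      rw [h2, h1, Finset.sum_range_succ', he0, mul_add, mul_add, ← mul_pow, mul_inv_cancel₀ ht,
        Finset.mul_sum]
      have h3 : ∀ m ∈ Finset.range D, t ^ (D + 1) * (e (m + 1) * t⁻¹ ^ (D - m)) =
          e (m + 1) * t ^ (m + 1) := by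
        intro m hm
        rw [Finset.mem_range] at hm
        have : D + 1 = (m + 1) + (D - m) := by omega
        rw [this, pow_add, mul_left_comm, mul_assoc, ← mul_pow, mul_inv_cancel₀ ht, one_pow,
          mul_one]
      rw [Finset.sum_congr rfl h3]
      ring
  have hS : completeSeries P * completeSeries (fun k => -P k) = 1 := by
    rw [← completeSeries_add]
    simpa using completeSeries_zero_fun
  have hX : completeSeries (powerSum x) *
      ((∏ i, (1 - Polynomial.C (x i) * Polynomial.X) : Polynomial ℂ) : PowerSeries ℂ) = 1 := by
    have h1 : ((∏ i, (1 - Polynomial.C (x i) * Polynomial.X) : Polynomial ℂ) : PowerSeries ℂ) =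
        ∏ i, ((1 - Polynomial.C (x i) * Polynomial.X : Polynomial ℂ) : PowerSeries ℂ) := by
      rw [← Polynomial.coeToPowerSeries.ringHom_apply, map_prod]
      rfl
    rw [h1, completeSeries_powerSum, ← Finset.prod_mul_distrib,
      Finset.prod_eq_one fun k _ => completeSeries_pow_mul (x k)]
  set E : PowerSeries ℂ :=
    ((∏ i, (1 - Polynomial.C (x i) * Polynomial.X) : Polynomial ℂ) : PowerSeries ℂ) with hEdef
  have hdvd : (PowerSeries.X : PowerSeries ℂ) ^ (D + 1) ∣
      E - completeSeries (fun k => -P k) := by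
    rw [PowerSeries.X_pow_dvd_iff]
    intro m hm
    rw [map_sub, hEdef, hE, Polynomial.coeff_coe, coeff_completeSeries, Polynomial.coeff_add,
      Polynomial.finsetSum_coeff]
    simp only [Polynomial.coeff_C_mul_X_pow]
    rw [Finset.sum_ite_eq, if_pos (Finset.mem_range.2 hm), if_neg (by omega), add_zero, sub_self]
  have hdvd2 : (PowerSeries.X : PowerSeries ℂ) ^ (D + 1) ∣
      completeSeries P - completeSeries (powerSum x) := by
    have : completeSeries P - completeSeries (powerSum x) =
        (E - completeSeries (fun k => -P k)) * (completeSeries P * completeSeries (powerSum x)) := by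
      linear_combination (-completeSeries P) * hX + completeSeries (powerSum x) * hS
    rw [this]
    exact hdvd.mul_right _
  have := (PowerSeries.X_pow_dvd_iff.1 hdvd2) n (by omega)
  rw [map_sub, coeff_completeSeries, coeff_completeSeries, sub_eq_zero] at this
  exact this.symm

theorem dvd_det_sub_det {R : Type*} [CommRing R] {n : ℕ} (r : R) {A B : Matrix (Fin n) (Fin n) R}
    (h : ∀ i j, r ∣ A i j - B i j) : r ∣ A.det - B.det := by
  rw [← Ideal.mem_span_singleton, ← Ideal.Quotient.eq, RingHom.map_det, RingHom.map_det]
  congr 1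
  ext i j
  simpa [Ideal.Quotient.eq, Ideal.mem_span_singleton] using h i j

theorem sum_schur_mul_skewSchur_of_finite {n : ℕ} {x : Fin n → ℂ} (hx : Function.Injective x)
    (P : ℕ → ℂ) {χ : YoungDiagram} {d : ℕ} (hχ : χ.colLen 0 ≤ n) (hd : d ≤ n) (hχd : χ.card ≤ d) :
    ∑ ν ∈ diagramsOfCard d, schur (powerSum x) ν * skewSchur P ν χ =
      completeSymm (fun k => powerSum x k * P k) (d - χ.card) * schur (powerSum x) χ := by
  set δ : ℕ := ∑ i : Fin n, (n - 1 - (i : ℕ)) with hδ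
  set L : ℕ := (d + δ + 1) + n with hL
  have hCB := det_sum_mul_eq_sum_boxDiagrams (m := d + δ + 1)
    (fun (l : Fin n) (m : ℕ) => PowerSeries.C (x l ^ m) * (PowerSeries.X : PowerSeries ℂ) ^ m)
    (fun (m : ℕ) (k : Fin n) =>
      PowerSeries.C (completeSymmInt P ((m : ℤ) - betaNum n χ k)))
  rw [← hL] at hCB
  have hfull : Matrix.det (Matrix.of fun l k : Fin n => (PowerSeries.mk fun m : ℕ =>
      x l ^ m * completeSymmInt P ((m : ℤ) - betaNum n χ k) : PowerSeries ℂ)) =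
      completeSeries (fun k => powerSum x k * P k) *
        (PowerSeries.X ^ (χ.card + δ) * PowerSeries.C (alternant x χ)) := by
    have h1 : (Matrix.of fun l k : Fin n => (PowerSeries.mk fun m : ℕ =>
        x l ^ m * completeSymmInt P ((m : ℤ) - betaNum n χ k) : PowerSeries ℂ)) =
        Matrix.of fun l k : Fin n => completeSeries (fun j => x l ^ j * P j) *
          (Matrix.of fun l k : Fin n => PowerSeries.X ^ betaNum n χ k *
            (PowerSeries.C (R := ℂ)).mapMatrix (Matrix.of fun l i : Fin n => x l ^ betaNum n χ i) l k) l k := by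
      ext l k m
      simp only [Matrix.of_apply, PowerSeries.coeff_mk, RingHom.mapMatrix_apply, Matrix.map_apply]
      rw [← mul_assoc, PowerSeries.coeff_mul_C, PowerSeries.coeff_mul_X_pow']
      split_ifs with h
      · rw [coeff_completeSeries, completeSymm_scale, completeSymmInt_sub_of_le _ h,
          mul_right_comm, ← pow_add, Nat.sub_add_cancel h]
      · rw [completeSymmInt_sub_of_lt _ (by omega), mul_zero, zero_mul]
    rw [h1, Matrix.det_mul_column, Matrix.det_mul_row, ← RingHom.map_det, ← completeSeries_sum,
      Finset.prod_pow_eq_pow_sum, sum_betaNum hχ]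
    simp only [← Finset.sum_mul]
    rfl
  have hmod : (PowerSeries.X : PowerSeries ℂ) ^ L ∣
      Matrix.det (Matrix.of fun l k : Fin n => (PowerSeries.mk fun m : ℕ =>
        x l ^ m * completeSymmInt P ((m : ℤ) - betaNum n χ k) : PowerSeries ℂ)) -
      Matrix.det (Matrix.of fun l k : Fin n => ∑ m ∈ Finset.range L,
        PowerSeries.C (x l ^ m) * (PowerSeries.X : PowerSeries ℂ) ^ m *
        PowerSeries.C (completeSymmInt P ((m : ℤ) - betaNum n χ k))) := by
    apply dvd_det_sub_det
    intro l k
    rw [PowerSeries.X_pow_dvd_iff]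
    intro m hm
    simp only [Matrix.of_apply]
    rw [map_sub, PowerSeries.coeff_mk, map_sum, Finset.sum_eq_single m]
    · rw [PowerSeries.coeff_mul_C, PowerSeries.coeff_C_mul, PowerSeries.coeff_X_pow_self, mul_one,
        sub_self]
    · intro j _ hj
      rw [PowerSeries.coeff_mul_C, PowerSeries.coeff_C_mul, PowerSeries.coeff_X_pow,
        if_neg hj.symm, mul_zero, zero_mul]
    · intro h
      exact absurd (Finset.mem_range.2 hm) h
  have hcoef := PowerSeries.X_pow_dvd_iff.1 hmod (d + δ) (by omega)
  rw [map_sub, sub_eq_zero, hfull, hCB, ← mul_assoc, PowerSeries.coeff_mul_C,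
    PowerSeries.coeff_mul_X_pow', if_pos (by omega), coeff_completeSeries, map_sum,
    show d + δ - (χ.card + δ) = d - χ.card by omega] at hcoef
  have hterm : ∀ ν ∈ boxDiagrams n (d + δ + 1), PowerSeries.coeff (d + δ)
      (Matrix.det (Matrix.of fun l j : Fin n => PowerSeries.C (x l ^ betaNum n ν j) *
          (PowerSeries.X : PowerSeries ℂ) ^ betaNum n ν j) *
        Matrix.det (Matrix.of fun j k : Fin n =>
          PowerSeries.C (completeSymmInt P ((betaNum n ν j : ℤ) - betaNum n χ k)))) =
      if ν.card = d then schur (powerSum x) ν * skewSchur P ν χ * alternant x ⊥ else 0 := by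
    intro ν hν
    have hνn := (mem_boxDiagrams.1 hν).1
    have h1 : Matrix.det (Matrix.of fun l j : Fin n => PowerSeries.C (x l ^ betaNum n ν j) *
          (PowerSeries.X : PowerSeries ℂ) ^ betaNum n ν j) =
        PowerSeries.X ^ (ν.card + δ) * PowerSeries.C (alternant x ν) := by
      have e : (Matrix.of fun l j : Fin n => PowerSeries.C (x l ^ betaNum n ν j) *
          (PowerSeries.X : PowerSeries ℂ) ^ betaNum n ν j) =
          Matrix.of fun l j : Fin n => PowerSeries.X ^ betaNum n ν j *
            (PowerSeries.C (R := ℂ)).mapMatrix (Matrix.of fun l i : Fin n => x l ^ betaNum n ν i) l j := by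
        ext1 l j
        simp [mul_comm]
      rw [e, Matrix.det_mul_row, ← RingHom.map_det, Finset.prod_pow_eq_pow_sum, sum_betaNum hνn]
      rfl
    have h2 : Matrix.det (Matrix.of fun j k : Fin n =>
          PowerSeries.C (R := ℂ) (completeSymmInt P ((betaNum n ν j : ℤ) - betaNum n χ k))) =
        PowerSeries.C (skewSchur P ν χ) := by
      rw [skewSchur_eq_det P hνn hχ, RingHom.map_det]
      rfl
    rw [h1, h2, PowerSeries.coeff_mul_C, PowerSeries.coeff_mul_C, PowerSeries.coeff_X_pow,
      alternant_eq_schur_mul x hνn]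
    by_cases h : ν.card = d
    · rw [if_pos h, if_pos (by omega)]
      ring
    · rw [if_neg h, if_neg (by omega)]
      ring
  rw [Finset.sum_congr rfl hterm, ← Finset.sum_filter, ← Finset.sum_mul,
    alternant_eq_schur_mul x hχ, ← mul_assoc] at hcoef
  rw [mul_right_cancel₀ (alternant_bot_ne_zero hx) hcoef]
  refine Finset.sum_congr ?_ fun _ _ => rfl
  ext ν
  rw [mem_diagramsOfCard, Finset.mem_filter, mem_boxDiagrams]
  refine ⟨fun h => ⟨⟨(colLen_le_card ν).trans (by omega), fun i =>
    (rowLen_le_card ν i).trans (by omega)⟩, h⟩, fun h => h.2⟩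

/-- The degree `d` part of `∑_ν s_ν(x) s_{ν/χ}(y) = ∏ (1 - x_i y_j)⁻¹ s_χ(x)`. -/
theorem sum_schur_mul_skewSchur_of_card (P P' : ℕ → ℂ) (χ : YoungDiagram) (d : ℕ) :
    ∑ ν ∈ diagramsOfCard d, schur P ν * skewSchur P' ν χ =
      if χ.card ≤ d then completeSymm (fun k => P k * P' k) (d - χ.card) * schur P χ else 0 := by
  split_ifs with h
  · obtain ⟨x, hx, hxP⟩ := exists_alphabet P (2 * d)
    have := colLen_le_card χ
    have h1 := sum_schur_mul_skewSchur_of_finite hx P' (χ := χ) (d := d) (by omega) (by omega) h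
    have hs : ∀ ν : YoungDiagram, ν.card ≤ d → schur (powerSum x) ν = schur P ν := fun ν hν =>
      skewSchur_congr _ fun k hk hk' => hxP k hk (by omega)
    rw [hs χ h, completeSymm_congr (P' := fun k => P k * P' k)
      fun k hk hk' => by rw [hxP k hk (by omega)]] at h1
    rw [← h1]
    refine Finset.sum_congr rfl fun ν hν => ?_
    rw [hs ν (mem_diagramsOfCard.1 hν).le]
  · refine Finset.sum_eq_zero fun ν hν => ?_
    rw [skewSchur_eq_zero _ fun hle => h ((card_mono hle).trans (mem_diagramsOfCard.1 hν).le),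
      mul_zero]

/-! ### The principal specialization -/

/-- The power sums `a ^ k / (1 - a ^ (2 k))` of the alphabet `(a, a³, a⁵, …)`. -/
def geomPowerSum (a : ℂ) (k : ℕ) : ℂ := a ^ k / (1 - a ^ (2 * k))

/-- `∏_{m = 1}^l (1 - b ^ m)`. -/
def qFactorial (b : ℂ) (l : ℕ) : ℂ := ∏ m ∈ Finset.Icc 1 l, (1 - b ^ m)

theorem qFactorial_succ (b : ℂ) (l : ℕ) :
    qFactorial b (l + 1) = qFactorial b l * (1 - b ^ (l + 1)) := by
  rw [qFactorial, Finset.prod_Icc_succ_top (by omega)]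
  rfl

theorem qFactorial_ne_zero {b : ℂ} (hb : ∀ k, 1 ≤ k → b ^ k ≠ 1) (l : ℕ) :
    qFactorial b l ≠ 0 :=
  Finset.prod_ne_zero_iff.2 fun m hm => sub_ne_zero.2 (hb m (Finset.mem_Icc.1 hm).1).symm

theorem completeSymm_geomPowerSum {a : ℂ} (ha : ∀ k, 1 ≤ k → (a ^ 2) ^ k ≠ 1) (m : ℕ) :
    completeSymm (geomPowerSum a) m = a ^ m / qFactorial (a ^ 2) m := by
  have h1 : completeSeries (geomPowerSum a) =
      completeSeries (fun k => (a ^ 2) ^ k * geomPowerSum a k) * completeSeries (fun k => a ^ k) := by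
    rw [← completeSeries_add]
    ext n
    rw [coeff_completeSeries, coeff_completeSeries]
    refine completeSymm_congr fun k hk _ => ?_
    have h2 : 1 - (a ^ 2) ^ k ≠ 0 := sub_ne_zero.2 (ha k hk).symm
    rw [geomPowerSum, pow_mul]
    field_simp
    ring
  have h2 : ∀ m, (1 - (a ^ 2) ^ (m + 1)) * completeSymm (geomPowerSum a) (m + 1) =
      a * completeSymm (geomPowerSum a) m := by
    intro m
    have h3 : completeSeries (geomPowerSum a) *
        ((1 - Polynomial.C a * Polynomial.X : Polynomial ℂ) : PowerSeries ℂ) =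
        completeSeries (fun k => (a ^ 2) ^ k * geomPowerSum a k) := by
      rw [h1, mul_assoc, completeSeries_pow_mul, mul_one]
    have h4 := congrArg (PowerSeries.coeff (m + 1)) h3
    rw [Polynomial.coe_sub, Polynomial.coe_one, Polynomial.coe_mul, Polynomial.coe_C,
      Polynomial.coe_X, mul_sub, mul_one, map_sub, mul_left_comm, PowerSeries.coeff_C_mul,
      PowerSeries.coeff_succ_mul_X, coeff_completeSeries, coeff_completeSeries,
      coeff_completeSeries, completeSymm_scale] at h4
    linear_combination h4
  induction m with
  | zero => simp [completeSymm_zero, qFactorial]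
  | succ m ih =>
    have h3 : 1 - (a ^ 2) ^ (m + 1) ≠ 0 := sub_ne_zero.2 (ha _ (by omega)).symm
    have h4 := qFactorial_ne_zero ha m
    rw [qFactorial_succ, eq_div_iff (mul_ne_zero h4 h3)]
    have h5 := h2 m
    rw [ih] at h5
    rw [mul_left_comm, mul_comm (completeSymm _ _), h5]
    field_simp
    ring

theorem completeSymmInt_geomPowerSum {a : ℂ} (ha0 : a ≠ 0) (ha : ∀ k, 1 ≤ k → (a ^ 2) ^ k ≠ 1)
    (l c : ℕ) :
    completeSymmInt (geomPowerSum a) ((l : ℤ) - c) =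
      (a ^ l / qFactorial (a ^ 2) l) *
        (((a ^ c)⁻¹ * ∏ k ∈ Finset.range c, (-((a ^ 2) ^ k)⁻¹)) *
          ∏ k ∈ Finset.range c, ((a ^ 2) ^ l - (a ^ 2) ^ k)) := by
  have hb0 : a ^ 2 ≠ 0 := pow_ne_zero 2 ha0
  rcases lt_or_ge l c with h | h
  · rw [completeSymmInt_sub_of_lt _ h,
      Finset.prod_eq_zero (s := Finset.range c) (f := fun k => (a ^ 2) ^ l - (a ^ 2) ^ k)
        (Finset.mem_range.2 h) (sub_self _), mul_zero, mul_zero]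
  · rw [completeSymmInt_sub_of_le _ h, completeSymm_geomPowerSum ha, mul_assoc,
      ← Finset.prod_mul_distrib]
    have h1 : ∀ c ≤ l, qFactorial (a ^ 2) (l - c) *
        ∏ k ∈ Finset.range c, (-((a ^ 2) ^ k)⁻¹ * ((a ^ 2) ^ l - (a ^ 2) ^ k)) =
        qFactorial (a ^ 2) l := by
      intro c
      induction c with
      | zero => intro _; simp
      | succ c ih =>
        intro hc
        rw [← ih (by omega), Finset.prod_range_succ, show l - c = (l - (c + 1)) + 1 by omega,
          qFactorial_succ, show l - (c + 1) + 1 = l - c by omega]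
        have e : (a ^ 2) ^ l = (a ^ 2) ^ (l - c) * (a ^ 2) ^ c := by
          rw [← pow_add]
          congr 1
          omega
        have h0 : (a ^ 2) ^ c ≠ 0 := pow_ne_zero c hb0
        have e2 : -((a ^ 2) ^ c)⁻¹ * ((a ^ 2) ^ l - (a ^ 2) ^ c) = 1 - (a ^ 2) ^ (l - c) := by
          rw [e]
          generalize (a ^ 2) ^ c = u at h0
          field_simp
          ring
        rw [e2]
        ring
    have h2 := h1 c h
    have h3 := qFactorial_ne_zero ha (l - c)
    have h4 : ∏ k ∈ Finset.range c, (-((a ^ 2) ^ k)⁻¹ * ((a ^ 2) ^ l - (a ^ 2) ^ k)) =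
        qFactorial (a ^ 2) l / qFactorial (a ^ 2) (l - c) := by
      rw [eq_div_iff h3, mul_comm, h2]
    have h5 := qFactorial_ne_zero ha l
    rw [h4, pow_sub₀ _ ha0 h]
    field_simp

theorem image_betaNum_sub_subset {n : ℕ} (μ : YoungDiagram) (i : Fin n) :
    (Finset.Ioi i).image (fun j => betaNum n μ i - betaNum n μ j) ⊆
      Finset.Icc 1 (betaNum n μ i) := by
  intro m hm
  obtain ⟨j, hj, rfl⟩ := Finset.mem_image.1 hm
  have := betaNum_strictAnti n μ (Finset.mem_Ioi.1 hj)
  rw [Finset.mem_Icc]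
  omega

theorem prod_Ioi_betaNum {n : ℕ} (μ : YoungDiagram) (i : Fin n) (f : ℕ → ℂ) :
    ∏ j ∈ Finset.Ioi i, f (betaNum n μ i - betaNum n μ j) =
      ∏ m ∈ (Finset.Ioi i).image (fun j => betaNum n μ i - betaNum n μ j), f m := by
  rw [Finset.prod_image]
  intro j hj k hk h
  have h1 := betaNum_strictAnti n μ (Finset.mem_Ioi.1 hj)
  have h2 := betaNum_strictAnti n μ (Finset.mem_Ioi.1 hk)
  apply (betaNum_strictAnti n μ).injective
  simp only at h
  omega

theorem prod_Ioi_betaNum_bot {n : ℕ} (b : ℂ) (i : Fin n) :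
    ∏ j ∈ Finset.Ioi i, (1 - b ^ (betaNum n ⊥ i - betaNum n ⊥ j)) =
      qFactorial b (betaNum n ⊥ i) := by
  rw [prod_Ioi_betaNum ⊥ i fun m => 1 - b ^ m, qFactorial]
  congr 1
  apply Finset.eq_of_subset_of_card_le (image_betaNum_sub_subset ⊥ i)
  rw [Finset.card_image_of_injOn, Fin.card_Ioi, Nat.card_Icc]
  · simp only [betaNum, rowLen_bot]
    omega
  · intro j hj k hk h
    have h1 := betaNum_strictAnti n ⊥ (Finset.mem_Ioi.1 (Finset.mem_coe.1 hj))
    have h2 := betaNum_strictAnti n ⊥ (Finset.mem_Ioi.1 (Finset.mem_coe.1 hk))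
    apply (betaNum_strictAnti n ⊥).injective
    simp only at h
    omega

theorem exists_schur_geomPowerSum_eq {n : ℕ} {a : ℂ} (ha0 : a ≠ 0)
    (ha : ∀ k, 1 ≤ k → (a ^ 2) ^ k ≠ 1) :
    ∃ K : ℂ, ∀ μ : YoungDiagram, μ.colLen 0 ≤ n →
      schur (geomPowerSum a) μ =
        (∏ i : Fin n, a ^ betaNum n μ i / qFactorial (a ^ 2) (betaNum n μ i)) *
          (∏ i : Fin n, ∏ j ∈ Finset.Ioi i,
            ((a ^ 2) ^ betaNum n μ j - (a ^ 2) ^ betaNum n μ i)) * K := by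
  have hb : (⊥ : YoungDiagram).colLen 0 ≤ n := by rw [colLen_bot]; exact Nat.zero_le _
  set κ : ℕ → ℂ := fun c => (a ^ c)⁻¹ * ∏ k ∈ Finset.range c, (-((a ^ 2) ^ k)⁻¹) with hκ
  set p : ℕ → Polynomial ℂ := fun c =>
    ∏ k ∈ Finset.range c, (Polynomial.X - Polynomial.C ((a ^ 2) ^ k)) with hp
  refine ⟨(∏ j : Fin n, κ (betaNum n ⊥ j)) * ((Equiv.Perm.sign (Fin.revPerm (n := n)) : ℤ) : ℂ),
    fun μ hμ => ?_⟩
  have h1 : jacobiTrudi n (geomPowerSum a) μ ⊥ = Matrix.of fun i j : Fin n =>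
      (a ^ betaNum n μ i / qFactorial (a ^ 2) (betaNum n μ i)) *
        (Matrix.of fun i j : Fin n => κ (betaNum n ⊥ j) *
          ((Matrix.of fun i j : Fin n => (p j).eval ((a ^ 2) ^ betaNum n μ i)).submatrix id
            Fin.revPerm) i j) i j := by
    ext i j
    have hj : ((Fin.revPerm j : Fin n) : ℕ) = betaNum n ⊥ j := by
      have := j.isLt
      simp only [betaNum, rowLen_bot, Fin.revPerm_apply, Fin.val_rev]
      omega
    simp only [jacobiTrudi, Matrix.of_apply, Matrix.submatrix_apply, id, hj]
    rw [completeSymmInt_geomPowerSum ha0 ha]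
    simp [hκ, hp, Polynomial.eval_prod]
  have h2 : (Matrix.of fun i j : Fin n => (p j).eval ((a ^ 2) ^ betaNum n μ i)).det =
      ∏ i : Fin n, ∏ j ∈ Finset.Ioi i, ((a ^ 2) ^ betaNum n μ j - (a ^ 2) ^ betaNum n μ i) := by
    rw [← Matrix.det_vandermonde]
    exact (Matrix.det_eval_matrixOfPolynomials_eq_det_vandermonde _ (fun j : Fin n => p j)
      (fun i => by
        rw [hp, Polynomial.natDegree_prod_of_monic _ _ fun k _ => Polynomial.monic_X_sub_C _]
        simp only [Polynomial.natDegree_X_sub_C]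
        simp)
      (fun i => Polynomial.monic_prod_of_monic _ _ fun k _ => Polynomial.monic_X_sub_C _)).symm
  rw [schur, skewSchur_eq_det _ hμ hb, h1, Matrix.det_mul_column, Matrix.det_mul_row,
    Matrix.det_permute', h2]
  ring

theorem prod_alternant_eq {n : ℕ} (a : ℂ) (μ : YoungDiagram) :
    (∏ i : Fin n, a ^ betaNum n μ i / qFactorial (a ^ 2) (betaNum n μ i)) *
      (∏ i : Fin n, ∏ j ∈ Finset.Ioi i, ((a ^ 2) ^ betaNum n μ j - (a ^ 2) ^ betaNum n μ i)) =
    a ^ (∑ i : Fin n, (2 * (i : ℕ) + 1) * betaNum n μ i) *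
      ∏ i : Fin n, (∏ j ∈ Finset.Ioi i, (1 - (a ^ 2) ^ (betaNum n μ i - betaNum n μ j))) /
        qFactorial (a ^ 2) (betaNum n μ i) := by
  have h1 : ∏ i : Fin n, ∏ j ∈ Finset.Ioi i,
      ((a ^ 2) ^ betaNum n μ j - (a ^ 2) ^ betaNum n μ i) =
      (∏ i : Fin n, ∏ j ∈ Finset.Ioi i, (a ^ 2) ^ betaNum n μ j) *
        ∏ i : Fin n, ∏ j ∈ Finset.Ioi i, (1 - (a ^ 2) ^ (betaNum n μ i - betaNum n μ j)) := by
    rw [← Finset.prod_mul_distrib]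
    refine Finset.prod_congr rfl fun i _ => ?_
    rw [← Finset.prod_mul_distrib]
    refine Finset.prod_congr rfl fun j hj => ?_
    rw [mul_sub, mul_one, ← pow_add, Nat.add_sub_cancel'
      (betaNum_strictAnti n μ (Finset.mem_Ioi.1 hj)).le]
  have h2 : ∏ i : Fin n, ∏ j ∈ Finset.Ioi i, (a ^ 2) ^ betaNum n μ j =
      a ^ (∑ i : Fin n, 2 * (i : ℕ) * betaNum n μ i) := by
    rw [Finset.prod_comm' (t' := Finset.univ) (s' := fun j => Finset.Iio j) (by simp),
      ← Finset.prod_pow_eq_pow_sum]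
    refine Finset.prod_congr rfl fun j _ => ?_
    rw [Finset.prod_const, Fin.card_Iio, ← pow_mul, ← pow_mul]
    congr 1
    ring
  rw [h1, h2, Finset.prod_div_distrib, Finset.prod_div_distrib, Finset.prod_pow_eq_pow_sum]
  have h3 : ∑ i : Fin n, (2 * (i : ℕ) + 1) * betaNum n μ i =
      ∑ i : Fin n, 2 * (i : ℕ) * betaNum n μ i + ∑ i : Fin n, betaNum n μ i := by
    rw [← Finset.sum_add_distrib]
    exact Finset.sum_congr rfl fun i _ => by ring
  rw [h3, pow_add]
  ring

theorem schur_geomPowerSum {n : ℕ} {a : ℂ} (ha0 : a ≠ 0) (ha : ∀ k, 1 ≤ k → (a ^ 2) ^ k ≠ 1)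
    {μ : YoungDiagram} (hμ : μ.colLen 0 ≤ n) :
    schur (geomPowerSum a) μ =
      a ^ (∑ i : Fin n, (2 * (i : ℕ) + 1) * μ.rowLen i) *
      ∏ i : Fin n, (∏ j ∈ Finset.Ioi i, (1 - (a ^ 2) ^ (betaNum n μ i - betaNum n μ j))) /
        qFactorial (a ^ 2) (betaNum n μ i) := by
  obtain ⟨K, hK⟩ := exists_schur_geomPowerSum_eq (n := n) ha0 ha
  have h0 := hK ⊥ (by rw [colLen_bot]; exact Nat.zero_le _)
  have h1 := hK μ hμ
  rw [prod_alternant_eq a] at h0 h1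
  rw [schur_bot, Finset.prod_eq_one fun i _ => by
    rw [prod_Ioi_betaNum_bot, div_self (qFactorial_ne_zero ha _)], mul_one] at h0
  have h2 : ∑ i : Fin n, (2 * (i : ℕ) + 1) * betaNum n μ i =
      ∑ i : Fin n, (2 * (i : ℕ) + 1) * μ.rowLen i +
        ∑ i : Fin n, (2 * (i : ℕ) + 1) * betaNum n ⊥ i := by
    rw [← Finset.sum_add_distrib]
    refine Finset.sum_congr rfl fun i _ => ?_
    simp only [betaNum, rowLen_bot]
    ring
  rw [h1, h2, pow_add]
  linear_combination (-(a ^ (∑ i : Fin n, (2 * (i : ℕ) + 1) * μ.rowLen i) *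
      ∏ i : Fin n, (∏ j ∈ Finset.Ioi i, (1 - (a ^ 2) ^ (betaNum n μ i - betaNum n μ j))) /
        qFactorial (a ^ 2) (betaNum n μ i))) * h0

theorem prod_Ioi_div_qFactorial {n : ℕ} {b : ℂ} (hb : ∀ k, 1 ≤ k → b ^ k ≠ 1)
    (μ : YoungDiagram) (i : Fin n) :
    (∏ j ∈ Finset.Ioi i, (1 - b ^ (betaNum n μ i - betaNum n μ j))) /
        qFactorial b (betaNum n μ i) =
      ∏ m ∈ Finset.Icc 1 (betaNum n μ i) \
        (Finset.Ioi i).image (fun j => betaNum n μ i - betaNum n μ j), (1 - b ^ m)⁻¹ := by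
  rw [prod_Ioi_betaNum μ i fun m => 1 - b ^ m, qFactorial,
    ← Finset.prod_sdiff (image_betaNum_sub_subset μ i), Finset.prod_inv_distrib, mul_comm,
    div_mul_cancel_left₀]
  refine Finset.prod_ne_zero_iff.2 fun m hm => sub_ne_zero.2 (hb m ?_).symm
  exact (Finset.mem_Icc.1 (image_betaNum_sub_subset μ i hm)).1

theorem pow_ne_one_of_norm_lt_one {b : ℂ} (hb : ‖b‖ < 1) (k : ℕ) (hk : 1 ≤ k) : b ^ k ≠ 1 := by
  intro h
  have h1 : ‖b‖ ^ k = 1 := by rw [← norm_pow, h, norm_one]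
  have := pow_lt_one₀ (norm_nonneg b) hb (by omega : k ≠ 0)
  linarith

theorem exists_schur_geomPowerSum_ofReal {a : ℂ} (ha0 : a ≠ 0) (ha : ‖a‖ < 1) (μ : YoungDiagram) :
    ∃ x : ℝ, schur (geomPowerSum (‖a‖ : ℂ)) μ = x ∧ ‖schur (geomPowerSum a) μ‖ ≤ x := by
  have hb : ‖a ^ 2‖ < 1 := by
    rw [norm_pow]
    exact pow_lt_one₀ (norm_nonneg a) ha two_ne_zero
  have hb' : ‖(‖a‖ : ℂ) ^ 2‖ < 1 := by simpa using hb
  have hr0 : (‖a‖ : ℂ) ≠ 0 := by simpa using ha0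
  rw [schur_geomPowerSum hr0 (pow_ne_one_of_norm_lt_one hb') le_rfl,
    schur_geomPowerSum ha0 (pow_ne_one_of_norm_lt_one hb) le_rfl]
  simp only [prod_Ioi_div_qFactorial (pow_ne_one_of_norm_lt_one hb'),
    prod_Ioi_div_qFactorial (pow_ne_one_of_norm_lt_one hb)]
  refine ⟨‖a‖ ^ (∑ i : Fin (μ.colLen 0), (2 * (i : ℕ) + 1) * μ.rowLen i) *
    ∏ i : Fin (μ.colLen 0), ∏ m ∈ Finset.Icc 1 (betaNum _ μ i) \
        (Finset.Ioi i).image (fun j => betaNum _ μ i - betaNum _ μ j), (1 - (‖a‖ ^ 2) ^ m)⁻¹,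
    by push_cast; rfl, ?_⟩
  rw [norm_mul, norm_pow, norm_prod]
  refine mul_le_mul_of_nonneg_left ?_ (by positivity)
  refine Finset.prod_le_prod (fun _ _ => norm_nonneg _) fun i _ => ?_
  rw [norm_prod]
  refine Finset.prod_le_prod (fun _ _ => norm_nonneg _) fun m hm => ?_
  have hm1 : 1 ≤ m := (Finset.mem_Icc.1 (Finset.mem_sdiff.1 hm).1).1
  rw [norm_inv]
  have h1 : (‖a‖ ^ 2) ^ m < 1 := pow_lt_one₀ (by positivity) (by simpa using hb) (by omega)
  refine inv_anti₀ (by linarith) ?_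
  have := norm_sub_norm_le 1 ((a ^ 2) ^ m)
  simpa using this

open scoped LaurentPolynomial
open LaurentPolynomial (T)

/-! ### Integral Laurent polynomials -/

theorem laurent_induction {p : ℤ[T;T⁻¹] → Prop} (hT : ∀ n, p (T n))
    (hadd : ∀ f g, p f → p g → p (f + g)) (hneg : ∀ f, p f → p (-f)) (f : ℤ[T;T⁻¹]) : p f := by
  refine LaurentPolynomial.induction_on' f hadd fun n a => ?_
  induction a using Int.induction_on with
  | zero =>
    rw [map_zero, zero_mul, ← add_neg_cancel (T 0)]
    exact hadd _ _ (hT 0) (hneg _ (hT 0))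
  | succ a ih =>
    rw [map_add, map_one, add_mul, one_mul]
    exact hadd _ _ ih (hT n)
  | pred a ih =>
    rw [map_sub, map_one, sub_mul, one_mul, sub_eq_add_neg]
    exact hadd _ _ ih (hneg _ (hT n))

/-- `∑_m f_m g(m)` for `f = ∑_m f_m T ^ m`. -/
def lsum {A : Type*} [Ring A] (g : ℤ → A) (f : ℤ[T;T⁻¹]) : A :=
  f.coeff.sum fun m d => (d : A) * g m

section lsum

variable {A : Type*} [Ring A] (g : ℤ → A)

theorem lsum_T (n : ℤ) : lsum g (T n) = g n := by
  have : (T n : ℤ[T;T⁻¹]).coeff = Finsupp.single n 1 := rfl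
  rw [lsum, this, Finsupp.sum_single_index] <;> simp

theorem lsum_add (f f' : ℤ[T;T⁻¹]) : lsum g (f + f') = lsum g f + lsum g f' := by
  rw [lsum, AddMonoidAlgebra.coeff_add, Finsupp.sum_add_index'] <;> simp [lsum, add_mul]

theorem lsum_zero : lsum g 0 = 0 := by
  simp [lsum]

theorem lsum_neg (f : ℤ[T;T⁻¹]) : lsum g (-f) = -lsum g f := by
  rw [eq_neg_iff_add_eq_zero, ← lsum_add, neg_add_cancel, lsum_zero]

theorem lsum_sub (f f' : ℤ[T;T⁻¹]) : lsum g (f - f') = lsum g f - lsum g f' := by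
  rw [sub_eq_add_neg, lsum_add, lsum_neg, sub_eq_add_neg]

theorem lsum_sum {ι : Type*} (s : Finset ι) (f : ι → ℤ[T;T⁻¹]) :
    lsum g (∑ i ∈ s, f i) = ∑ i ∈ s, lsum g (f i) := by
  classical
  induction s using Finset.induction_on with
  | empty => simp [lsum_zero]
  | insert i s hi ih => rw [Finset.sum_insert hi, Finset.sum_insert hi, lsum_add, ih]

theorem lsum_add_fun (g' : ℤ → A) (f : ℤ[T;T⁻¹]) :
    lsum (fun m => g m + g' m) f = lsum g f + lsum g' f := by
  simp only [lsum, mul_add, Finsupp.sum_add]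

end lsum

theorem lsum_const_mul {A : Type*} [CommRing A] (c : A) (g : ℤ → A) (f : ℤ[T;T⁻¹]) :
    lsum (fun m => c * g m) f = c * lsum g f := by
  rw [lsum, lsum, Finsupp.mul_sum]
  exact Finsupp.sum_congr fun m _ => by ring

theorem lsum_zpow_mul {x : ℂ} (hx : x ≠ 0) (f f' : ℤ[T;T⁻¹]) :
    lsum (fun m => x ^ m) (f * f') = lsum (fun m => x ^ m) f * lsum (fun m => x ^ m) f' := by
  induction f using laurent_induction with
  | hT n =>
    induction f' using laurent_induction with
    | hT m => rw [← LaurentPolynomial.T_add, lsum_T, lsum_T, lsum_T, zpow_add₀ hx]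
    | hadd f g hf hg => rw [mul_add, lsum_add, lsum_add, hf, hg, mul_add]
    | hneg f hf => rw [mul_neg, lsum_neg, lsum_neg, hf, mul_neg]
  | hadd f g hf hg => rw [add_mul, lsum_add, lsum_add, hf, hg, add_mul]
  | hneg f hf => rw [neg_mul, lsum_neg, lsum_neg, hf, neg_mul]

/-- `f(1)` -/
def augm (f : ℤ[T;T⁻¹]) : ℤ := lsum (fun _ => 1) f

/-- `f'(1)` -/
def slope (f : ℤ[T;T⁻¹]) : ℤ := lsum (fun m => m) f

theorem augm_mul (f f' : ℤ[T;T⁻¹]) : augm (f * f') = augm f * augm f' := by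
  unfold augm
  induction f using laurent_induction with
  | hT n =>
    induction f' using laurent_induction with
    | hT m => rw [← LaurentPolynomial.T_add, lsum_T, lsum_T, lsum_T, one_mul]
    | hadd f g hf hg => rw [mul_add, lsum_add, lsum_add, hf, hg, mul_add]
    | hneg f hf => rw [mul_neg, lsum_neg, lsum_neg, hf, mul_neg]
  | hadd f g hf hg => rw [add_mul, lsum_add, lsum_add, hf, hg, add_mul]
  | hneg f hf => rw [neg_mul, lsum_neg, lsum_neg, hf, neg_mul]

theorem slope_mul (f f' : ℤ[T;T⁻¹]) :
    slope (f * f') = slope f * augm f' + augm f * slope f' := by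
  unfold augm slope
  induction f using laurent_induction with
  | hT n =>
    induction f' using laurent_induction with
    | hT m => rw [← LaurentPolynomial.T_add]; simp only [lsum_T]; ring
    | hadd f g hf hg => rw [mul_add]; simp only [lsum_add, hf, hg]; ring
    | hneg f hf => rw [mul_neg]; simp only [lsum_neg, hf]; ring
  | hadd f g hf hg => rw [add_mul]; simp only [lsum_add, hf, hg]; ring
  | hneg f hf => rw [neg_mul]; simp only [lsum_neg, hf]; ring

/-- `∏_m φ(m) ^ f_m` for `f = ∑_m f_m T ^ m`. -/
def lprod (φ : ℤ → ℂ) (f : ℤ[T;T⁻¹]) : ℂ := f.coeff.prod fun m d => φ m ^ d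

theorem lprod_T (φ : ℤ → ℂ) (n : ℤ) : lprod φ (T n) = φ n := by
  have : (T n : ℤ[T;T⁻¹]).coeff = Finsupp.single n 1 := rfl
  rw [lprod, this, Finsupp.prod_single_index] <;> simp

theorem lprod_zero (φ : ℤ → ℂ) : lprod φ 0 = 1 := by
  simp [lprod]

theorem lprod_add {φ : ℤ → ℂ} (hφ : ∀ m, φ m ≠ 0) (f f' : ℤ[T;T⁻¹]) :
    lprod φ (f + f') = lprod φ f * lprod φ f' := by
  rw [lprod, AddMonoidAlgebra.coeff_add, Finsupp.prod_add_index'] <;> simp [lprod, zpow_add₀ (hφ _)]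

theorem lprod_ne_zero {φ : ℤ → ℂ} (hφ : ∀ m, φ m ≠ 0) (f : ℤ[T;T⁻¹]) : lprod φ f ≠ 0 :=
  Finset.prod_ne_zero_iff.2 fun m _ => zpow_ne_zero _ (hφ m)

theorem lprod_neg {φ : ℤ → ℂ} (hφ : ∀ m, φ m ≠ 0) (f : ℤ[T;T⁻¹]) : lprod φ (-f) = (lprod φ f)⁻¹ := by
  refine eq_inv_of_mul_eq_one_left ?_
  rw [← lprod_add hφ, neg_add_cancel, lprod_zero]

theorem lprod_sub {φ : ℤ → ℂ} (hφ : ∀ m, φ m ≠ 0) (f f' : ℤ[T;T⁻¹]) :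
    lprod φ (f - f') = lprod φ f / lprod φ f' := by
  rw [sub_eq_add_neg, lprod_add hφ, lprod_neg hφ, div_eq_mul_inv]

theorem lprod_sum {φ : ℤ → ℂ} (hφ : ∀ m, φ m ≠ 0) {ι : Type*} (s : Finset ι) (f : ι → ℤ[T;T⁻¹]) :
    lprod φ (∑ i ∈ s, f i) = ∏ i ∈ s, lprod φ (f i) := by
  classical
  induction s using Finset.induction_on with
  | empty => simp [lprod_zero]
  | insert i s hi ih => rw [Finset.sum_insert hi, Finset.prod_insert hi, lprod_add hφ, ih]

theorem lprod_mul_fun (φ ψ : ℤ → ℂ) (f : ℤ[T;T⁻¹]) :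
    lprod (fun m => φ m * ψ m) f = lprod φ f * lprod ψ f := by
  simp only [lprod, mul_zpow, Finsupp.prod_mul]

theorem lprod_zpow {x : ℂ} (hx : x ≠ 0) (l : ℤ → ℤ) (f : ℤ[T;T⁻¹]) :
    lprod (fun m => x ^ l m) f = x ^ lsum l f := by
  have h : ∀ m, x ^ l m ≠ 0 := fun m => zpow_ne_zero _ hx
  induction f using laurent_induction with
  | hT n => rw [lprod_T, lsum_T]
  | hadd f g hf hg => rw [lprod_add h, lsum_add, hf, hg, zpow_add₀ hx]
  | hneg f hf => rw [lprod_neg h, lsum_neg, hf, zpow_neg]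

/-- The substitution `T ↦ T ^ N`. -/
def dilate (N : ℤ) : ℤ[T;T⁻¹] →+* ℤ[T;T⁻¹] :=
  AddMonoidAlgebra.mapDomainRingHom ℤ (AddMonoidHom.mulLeft N)

theorem dilate_T (N n : ℤ) : dilate N (T n) = T (N * n) := by
  rw [dilate, T, AddMonoidAlgebra.mapDomainRingHom_apply, AddMonoidAlgebra.mapDomain_single]
  rfl

theorem invert_neg (f : ℤ[T;T⁻¹]) :
    LaurentPolynomial.invert (-f) = -LaurentPolynomial.invert f := map_neg _ _

theorem lsum_dilate {A : Type*} [Ring A] (g : ℤ → A) (N : ℤ) (f : ℤ[T;T⁻¹]) :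
    lsum g (dilate N f) = lsum (fun m => g (N * m)) f := by
  induction f using laurent_induction with
  | hT n => rw [dilate_T, lsum_T, lsum_T]
  | hadd f g hf hg => rw [map_add, lsum_add, lsum_add, hf, hg]
  | hneg f hf => rw [map_neg, lsum_neg, lsum_neg, hf]

theorem lsum_invert {A : Type*} [Ring A] (g : ℤ → A) (f : ℤ[T;T⁻¹]) :
    lsum g (LaurentPolynomial.invert f) = lsum (fun m => g (-m)) f := by
  induction f using laurent_induction with
  | hT n => rw [LaurentPolynomial.invert_T, lsum_T, lsum_T]
  | hadd f g hf hg => rw [map_add, lsum_add, lsum_add, hf, hg]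
  | hneg f hf => rw [map_neg, lsum_neg, lsum_neg, hf]

theorem lprod_T_mul {φ : ℤ → ℂ} (hφ : ∀ m, φ m ≠ 0) (e : ℤ) (f : ℤ[T;T⁻¹]) :
    lprod φ (T e * f) = lprod (fun m => φ (e + m)) f := by
  have h : ∀ m, φ (e + m) ≠ 0 := fun m => hφ _
  induction f using laurent_induction with
  | hT n => rw [← LaurentPolynomial.T_add, lprod_T, lprod_T]
  | hadd f g hf hg => rw [mul_add, lprod_add hφ, lprod_add h, hf, hg]
  | hneg f hf => rw [mul_neg, lprod_neg hφ, lprod_neg h, hf]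

theorem lprod_dilate {φ : ℤ → ℂ} (hφ : ∀ m, φ m ≠ 0) (N : ℤ) (f : ℤ[T;T⁻¹]) :
    lprod φ (dilate N f) = lprod (fun m => φ (N * m)) f := by
  have h : ∀ m, φ (N * m) ≠ 0 := fun m => hφ _
  induction f using laurent_induction with
  | hT n => rw [dilate_T, lprod_T, lprod_T]
  | hadd f g hf hg => rw [map_add, lprod_add hφ, lprod_add h, hf, hg]
  | hneg f hf => rw [map_neg, lprod_neg hφ, lprod_neg h, hf]

theorem lprod_invert {φ : ℤ → ℂ} (hφ : ∀ m, φ m ≠ 0) (f : ℤ[T;T⁻¹]) :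
    lprod φ (LaurentPolynomial.invert f) = lprod (fun m => φ (-m)) f := by
  have h : ∀ m, φ (-m) ≠ 0 := fun m => hφ _
  induction f using laurent_induction with
  | hT n => rw [LaurentPolynomial.invert_T, lprod_T, lprod_T]
  | hadd f g hf hg => rw [map_add, lprod_add hφ, lprod_add h, hf, hg]
  | hneg f hf => rw [map_neg, lprod_neg hφ, lprod_neg h, hf]

theorem one_sub_T_ne_zero {n : ℤ} (hn : n ≠ 0) : (1 - T n : ℤ[T;T⁻¹]) ≠ 0 := by
  intro h
  have := congrArg (lsum fun m : ℤ => m) h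
  rw [lsum_sub, ← LaurentPolynomial.T_zero, lsum_T, lsum_T, lsum_zero] at this
  omega

/-! ### The characters of partitions -/

/-- `∑_{(i,j) ∈ μ} T ^ (j - i)` -/
def contentPoly (μ : YoungDiagram) : ℤ[T;T⁻¹] := ∑ c ∈ μ.cells, T ((c.2 : ℤ) - c.1)

/-- `(1 - T) (1 - T⁻¹)` -/
def gam : ℤ[T;T⁻¹] := (1 - T 1) * (1 - T (-1))

/-- `(1 - T) ∑_i T ^ (μ_i - i)`, as a Laurent polynomial. -/
def mayaPoly (μ : YoungDiagram) : ℤ[T;T⁻¹] := -1 + gam * contentPoly μ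

/-- The character `∑_{c ∈ μ} T ^ (…) + ∑_{c ∈ ν} T ^ (…)` of a pair of partitions. -/
def pairPoly (μ ν : YoungDiagram) : ℤ[T;T⁻¹] :=
  contentPoly μ + LaurentPolynomial.invert (contentPoly ν) -
    gam * contentPoly μ * LaurentPolynomial.invert (contentPoly ν)

theorem invert_gam : LaurentPolynomial.invert gam = gam := by
  simp only [gam, map_mul, map_sub, map_one, LaurentPolynomial.invert_T, neg_neg]
  ring

theorem gam_ne_zero : gam ≠ 0 :=
  mul_ne_zero (one_sub_T_ne_zero one_ne_zero) (one_sub_T_ne_zero (by norm_num))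

theorem gam_mul_pairPoly (μ ν : YoungDiagram) :
    gam * pairPoly μ ν = 1 - mayaPoly μ * LaurentPolynomial.invert (mayaPoly ν) := by
  simp only [pairPoly, mayaPoly, map_add, invert_neg, map_one, map_mul, invert_gam]
  ring

theorem invert_pairPoly (μ ν : YoungDiagram) :
    LaurentPolynomial.invert (pairPoly μ ν) = pairPoly ν μ := by
  simp only [pairPoly, map_add, map_sub, map_mul, invert_gam, LaurentPolynomial.involutive_invert _]
  ring

theorem augm_gam : augm gam = 0 := by
  rw [gam, augm_mul]
  simp only [augm, lsum_sub, ← LaurentPolynomial.T_zero, lsum_T]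
  norm_num

theorem slope_gam : slope gam = 0 := by
  rw [gam, slope_mul]
  simp only [augm, slope, lsum_sub, ← LaurentPolynomial.T_zero, lsum_T]
  norm_num

theorem augm_contentPoly (μ : YoungDiagram) : augm (contentPoly μ) = μ.card := by
  simp [augm, contentPoly, lsum_sum, lsum_T, YoungDiagram.card]

theorem two_mul_slope_contentPoly (μ : YoungDiagram) : 2 * slope (contentPoly μ) = kappa μ := by
  simp [slope, contentPoly, lsum_sum, lsum_T, kappa]

theorem augm_pairPoly (μ ν : YoungDiagram) : augm (pairPoly μ ν) = μ.card + ν.card := by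
  have h1 : augm (LaurentPolynomial.invert (contentPoly ν)) = ν.card := by
    rw [← augm_contentPoly, augm, lsum_invert, augm]
  have h2 : ∀ f g, augm (f + g) = augm f + augm g := lsum_add _
  have h3 : ∀ f g, augm (f - g) = augm f - augm g := lsum_sub _
  rw [pairPoly, h3, h2, augm_mul, augm_mul, augm_gam, h1, augm_contentPoly]
  ring

theorem two_mul_slope_pairPoly (μ ν : YoungDiagram) :
    2 * slope (pairPoly μ ν) = kappa μ - kappa ν := by
  have h1 : slope (LaurentPolynomial.invert (contentPoly ν)) = -slope (contentPoly ν) := by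
    rw [slope, lsum_invert, slope, neg_eq_neg_one_mul, ← lsum_const_mul]
    simp
  have h2 : ∀ f g, slope (f + g) = slope f + slope g := lsum_add _
  have h3 : ∀ f g, slope (f - g) = slope f - slope g := lsum_sub _
  rw [pairPoly, h3, h2, slope_mul, slope_mul, augm_mul, augm_gam, slope_gam, h1,
    ← two_mul_slope_contentPoly, ← two_mul_slope_contentPoly]
  ring

theorem one_sub_T_neg_mul_sum (m : ℕ) (i : ℤ) :
    (1 - T 1) * ∑ j ∈ Finset.range m, (T ((j : ℤ) - i) : ℤ[T;T⁻¹]) = T (-i) - T ((m : ℤ) - i) := by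
  induction m with
  | zero => simp
  | succ m ih =>
    rw [Finset.sum_range_succ, mul_add, ih, sub_mul, one_mul, ← LaurentPolynomial.T_add]
    push_cast
    rw [show (1 : ℤ) + ((m : ℤ) - i) = (m : ℤ) + 1 - i by ring]
    ring

/-- `μ_{i+1} - (i + 1)` -/
def mayaInt (μ : YoungDiagram) (i : ℕ) : ℤ := (μ.rowLen i : ℤ) - i - 1

theorem mayaPoly_eq {n : ℕ} {μ : YoungDiagram} (hμ : μ.colLen 0 ≤ n) :
    mayaPoly μ = (1 - T 1) * ∑ i ∈ Finset.range n, T (mayaInt μ i) - T (-(n : ℤ)) := by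
  have h1 : gam * contentPoly μ =
      (1 - T 1) * ∑ i ∈ Finset.range n, (T (mayaInt μ i) - T (-(i : ℤ) - 1)) := by
    rw [contentPoly, sum_cells hμ, Finset.mul_sum, Finset.mul_sum]
    refine Finset.sum_congr rfl fun i _ => ?_
    rw [gam, mul_right_comm]
    simp only
    rw [one_sub_T_neg_mul_sum, mul_comm (1 - T 1), mayaInt]
    simp only [sub_mul, mul_sub, mul_one, ← LaurentPolynomial.T_add]
    rw [show -(i : ℤ) - 1 + 1 = -(i : ℤ) by ring, show -(i : ℤ) + -1 = -(i : ℤ) - 1 by ring,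
      show (μ.rowLen i : ℤ) - i - 1 + 1 = (μ.rowLen i : ℤ) - i by ring,
      show (μ.rowLen i : ℤ) - i + -1 = (μ.rowLen i : ℤ) - i - 1 by ring]
    ring
  have h2 : ∀ n : ℕ, (1 - T 1) * ∑ i ∈ Finset.range n, (T (-(i : ℤ) - 1) : ℤ[T;T⁻¹]) =
      T (-(n : ℤ)) - 1 := by
    intro n
    induction n with
    | zero => simp [LaurentPolynomial.T_zero]
    | succ n ih =>
      rw [Finset.sum_range_succ, mul_add, ih, sub_mul, one_mul, ← LaurentPolynomial.T_add]
      push_cast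
      rw [show (1 : ℤ) + (-(n : ℤ) - 1) = -(n : ℤ) by ring,
        show -((n : ℤ) + 1) = -(n : ℤ) - 1 by ring]
      ring
  rw [mayaPoly, h1, Finset.sum_sub_distrib, mul_sub, h2]
  ring

/-! ### The folded partition -/

theorem exists_lt_mayaInt_iff {n : ℕ} {μ : YoungDiagram} (hμ : μ.colLen 0 ≤ n) (y : ℤ) :
    (∃ i, i < n ∧ mayaInt μ i = y) ↔ (∃ i, mayaInt μ i = y) ∧ -(n : ℤ) ≤ y := by
  constructor
  · rintro ⟨i, hi, rfl⟩
    refine ⟨⟨i, rfl⟩, ?_⟩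
    simp only [mayaInt]
    omega
  · rintro ⟨⟨i, rfl⟩, h⟩
    refine ⟨i, ?_, rfl⟩
    by_contra hi
    rw [mayaInt, rowLen_eq_zero (by omega)] at h
    omega

theorem mayaInt_strictAnti (μ : YoungDiagram) : StrictAnti (mayaInt μ) := by
  intro i j hij
  have := μ.rowLen_anti i j hij.le
  simp only [mayaInt]
  omega

theorem mayaCoord_eq (μ : YoungDiagram) (i : ℕ) : mayaCoord μ i = (mayaInt μ i : ℚ) + 1 / 2 := by
  simp only [mayaCoord, mayaInt]
  push_cast
  ring

/-- The position of the site `y` of colour `r`. -/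
def foldSite {N : ℕ} (p : Fin N → ℤ) (r : Fin N) (y : ℤ) : ℤ := N * (y + p r) + r.val

theorem foldSite_inj {N : ℕ} (hN : 0 < N) (p : Fin N → ℤ) {r s : Fin N} {x y : ℤ}
    (h : foldSite p r x = foldSite p s y) : r = s ∧ x = y := by
  have hN' : (0 : ℤ) < N := by exact_mod_cast hN
  have hr : r = s := by
    have h1 : foldSite p r x % N = foldSite p s y % N := by rw [h]
    simp only [foldSite] at h1
    rw [Int.mul_add_emod_self_left, Int.mul_add_emod_self_left,
      Int.emod_eq_of_lt (by omega) (by exact_mod_cast r.isLt),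
      Int.emod_eq_of_lt (by omega) (by exact_mod_cast s.isLt)] at h1
    exact Fin.ext (by exact_mod_cast h1)
  subst hr
  refine ⟨rfl, ?_⟩
  simp only [foldSite] at h
  have := mul_left_cancel₀ hN'.ne' (add_right_cancel h)
  omega

theorem exists_mayaInt_foldedPartition {N : ℕ} (hN : 0 < N) (p : Fin N → ℤ) (hp : ∑ r, p r = 0)
    (lam : Fin N → YoungDiagram) (y : ℤ) :
    (∃ i, mayaInt (foldedPartition p lam) i = y) ↔
      ∃ r i, foldSite p r (mayaInt (lam r) i) = y := by
  have hNQ : (N : ℚ) ≠ 0 := by exact_mod_cast hN.ne'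
  have e : ∀ r i, (N : ℚ) * (mayaCoord (lam r) i + pTilde p r) =
      (foldSite p r (mayaInt (lam r) i) : ℚ) + 1 / 2 := by
    intro r i
    simp only [mayaCoord_eq, pTilde, foldSite]
    push_cast
    field_simp
    ring
  have h := Set.ext_iff.1 (mayaSet_foldedPartition hN p hp lam) ((y : ℚ) + 1 / 2)
  simp only [mayaSet, foldedMayaSet, Set.mem_iUnion, Set.mem_range, e] at h
  simpa only [mayaCoord_eq, add_left_inj, Int.cast_inj] using h

theorem sum_T_mayaInt_foldedPartition {N : ℕ} (hN : 0 < N) (p : Fin N → ℤ) (hp : ∑ r, p r = 0)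
    (lam : Fin N → YoungDiagram) {k : ℕ} (hk : (foldedPartition p lam).colLen 0 ≤ N * k)
    {m : Fin N → ℕ} (hm : ∀ r, (m r : ℤ) = k + p r) (hm' : ∀ r, (lam r).colLen 0 ≤ m r) :
    ∑ i ∈ Finset.range (N * k), (T (mayaInt (foldedPartition p lam) i) : ℤ[T;T⁻¹]) =
      ∑ r, ∑ i ∈ Finset.range (m r), T (foldSite p r (mayaInt (lam r) i)) := by
  classical
  have hN' : (0 : ℤ) < N := by exact_mod_cast hN
  rw [Finset.sum_sigma' Finset.univ fun r => Finset.range (m r)]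
  have h1 : ∑ i ∈ Finset.range (N * k), (T (mayaInt (foldedPartition p lam) i) : ℤ[T;T⁻¹]) =
      ∑ y ∈ (Finset.range (N * k)).image (mayaInt (foldedPartition p lam)), T y := by
    rw [Finset.sum_image fun i _ j _ h => (mayaInt_strictAnti _).injective h]
  have h2 : ∑ x ∈ Finset.univ.sigma fun r => Finset.range (m r),
      (T (foldSite p x.1 (mayaInt (lam x.1) x.2)) : ℤ[T;T⁻¹]) =
      ∑ y ∈ (Finset.univ.sigma fun r => Finset.range (m r)).image
        (fun x => foldSite p x.1 (mayaInt (lam x.1) x.2)), T y := by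
    rw [Finset.sum_image]
    rintro ⟨r, i⟩ _ ⟨s, j⟩ _ h
    obtain ⟨h1, h2⟩ := foldSite_inj hN p h
    simp only at h1
    subst h1
    have h3 : i = j := (mayaInt_strictAnti _).injective h2
    rw [h3]
  rw [h1, h2]
  congr 1
  ext y
  have e1 : y ∈ (Finset.range (N * k)).image (mayaInt (foldedPartition p lam)) ↔
      ∃ i, i < N * k ∧ mayaInt (foldedPartition p lam) i = y := by
    simp
  have e2 : y ∈ (Finset.univ.sigma fun r => Finset.range (m r)).image
      (fun x => foldSite p x.1 (mayaInt (lam x.1) x.2)) ↔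
      ∃ r i, i < m r ∧ foldSite p r (mayaInt (lam r) i) = y := by
    simp
  rw [e1, e2, exists_lt_mayaInt_iff hk, exists_mayaInt_foldedPartition hN p hp]
  have key : ∀ (r : Fin N) (x : ℤ), -((N * k : ℕ) : ℤ) ≤ foldSite p r x ↔ -(m r : ℤ) ≤ x := by
    intro r x
    have hr : (r.val : ℤ) < N := by exact_mod_cast r.isLt
    have hr0 : (0 : ℤ) ≤ r.val := by positivity
    rw [hm, foldSite]
    push_cast
    constructor
    · intro h
      by_contra hc
      have : (N : ℤ) * (x + p r) ≤ N * (-k - 1) := mul_le_mul_of_nonneg_left (by omega) hN'.le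
      linarith
    · intro h
      have : (N : ℤ) * (-k) ≤ N * (x + p r) := mul_le_mul_of_nonneg_left (by omega) hN'.le
      linarith
  constructor
  · rintro ⟨⟨r, i, rfl⟩, h⟩
    obtain ⟨j, hj, hji⟩ := (exists_lt_mayaInt_iff (hm' r) _).2 ⟨⟨i, rfl⟩, (key r _).1 h⟩
    exact ⟨r, j, hj, by rw [hji]⟩
  · rintro ⟨r, i, hi, rfl⟩
    exact ⟨⟨r, i, rfl⟩, (key r _).2 ((exists_lt_mayaInt_iff (hm' r) _).1 ⟨i, hi, rfl⟩).2⟩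

theorem one_sub_T_mul_sum (N : ℕ) :
    (1 - T 1) * ∑ r : Fin N, (T (r.val : ℤ) : ℤ[T;T⁻¹]) = 1 - T (N : ℤ) := by
  have h := one_sub_T_neg_mul_sum N 0
  rw [Finset.sum_range] at h
  simpa [LaurentPolynomial.T_zero] using h

theorem mayaPoly_foldedPartition {N : ℕ} (hN : 0 < N) (p : Fin N → ℤ) (hp : ∑ r, p r = 0)
    (lam : Fin N → YoungDiagram) :
    (1 - T (N : ℤ)) * mayaPoly (foldedPartition p lam) =
      (1 - T 1) * ∑ r, T (foldSite p r 0) * dilate N (mayaPoly (lam r)) := by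
  set k : ℕ := (foldedPartition p lam).colLen 0 + ∑ r, ((lam r).colLen 0 + (p r).natAbs) with hk
  have hkr : ∀ r, ((lam r).colLen 0 : ℤ) ≤ k + p r := fun r => by
    have := Finset.single_le_sum (f := fun r => (lam r).colLen 0 + (p r).natAbs)
      (fun _ _ => Nat.zero_le _) (Finset.mem_univ r)
    omega
  have hm : ∀ r, (((k : ℤ) + p r).toNat : ℤ) = k + p r := fun r =>
    Int.toNat_of_nonneg (by have := hkr r; omega)
  have hm' : ∀ r, (lam r).colLen 0 ≤ ((k : ℤ) + p r).toNat := fun r => by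
    have := hkr r
    omega
  have hkN : (foldedPartition p lam).colLen 0 ≤ N * k :=
    (Nat.le_add_right _ _).trans (Nat.le_mul_of_pos_left k hN)
  rw [mayaPoly_eq hkN, sum_T_mayaInt_foldedPartition hN p hp lam hkN hm hm']
  have h1 : ∀ r : Fin N, T (foldSite p r 0) * dilate N (mayaPoly (lam r)) =
      (1 - T (N : ℤ)) * ∑ i ∈ Finset.range ((k : ℤ) + p r).toNat,
        T (foldSite p r (mayaInt (lam r) i)) - T (-((N * k : ℕ) : ℤ)) * T (r.val : ℤ) := by
    intro r
    rw [mayaPoly_eq (hm' r), map_sub, map_mul, map_sub, map_one, map_sum, dilate_T, dilate_T,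
      mul_one, mul_sub, mul_left_comm, Finset.mul_sum, ← LaurentPolynomial.T_add,
      ← LaurentPolynomial.T_add, hm]
    simp only [dilate_T, ← LaurentPolynomial.T_add]
    congr 2
    · refine Finset.sum_congr rfl fun i _ => ?_
      congr 1
      simp only [foldSite]
      ring
    · simp only [foldSite]
      push_cast
      ring
  simp only [h1]
  rw [Finset.sum_sub_distrib, ← Finset.mul_sum, ← Finset.mul_sum, mul_sub, mul_sub,
    mul_left_comm (1 - T 1) (T _), one_sub_T_mul_sum]
  ring

theorem mayaPoly_bot : mayaPoly ⊥ = -1 := by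
  simp [mayaPoly, contentPoly]

theorem pairPoly_foldedPartition {N : ℕ} (hN : 0 < N) (p : Fin N → ℤ) (hp : ∑ r, p r = 0)
    (lam : Fin N → YoungDiagram) :
    pairPoly (foldedPartition p lam) (foldedPartition p lam) -
      pairPoly (foldedPartition p fun _ => ⊥) (foldedPartition p fun _ => ⊥) =
      ∑ r, ∑ s, T (foldSite p r 0 - foldSite p s 0) * dilate N (pairPoly (lam r) (lam s)) := by
  have hN0 : (N : ℤ) ≠ 0 := by exact_mod_cast hN.ne'
  have hN1 : -(N : ℤ) ≠ 0 := neg_ne_zero.2 hN0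
  set W := mayaPoly (foldedPartition p lam)
  set W0 := mayaPoly (foldedPartition p fun _ => ⊥)
  have hW := mayaPoly_foldedPartition hN p hp lam
  have hW0 := mayaPoly_foldedPartition hN p hp fun _ => ⊥
  have hWi := congrArg LaurentPolynomial.invert hW
  have hW0i := congrArg LaurentPolynomial.invert hW0
  simp only [map_mul, map_sub, map_one, map_sum, LaurentPolynomial.invert_T] at hWi hW0i
  have hdi : ∀ f : ℤ[T;T⁻¹], LaurentPolynomial.invert (dilate N f) =
      dilate N (LaurentPolynomial.invert f) := by
    intro f
    induction f using laurent_induction with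
    | hT n =>
      rw [dilate_T, LaurentPolynomial.invert_T, LaurentPolynomial.invert_T, dilate_T, mul_neg]
    | hadd f g hf hg => rw [map_add, map_add, hf, hg, map_add, map_add]
    | hneg f hf => rw [map_neg, invert_neg, hf, invert_neg, map_neg]
  have hgN : dilate N gam = (1 - T (N : ℤ)) * (1 - T (-(N : ℤ))) := by
    rw [gam, map_mul, map_sub, map_sub, map_one, dilate_T, dilate_T, mul_one, mul_neg_one]
  have hgN0 : dilate N gam ≠ 0 := by
    rw [hgN]
    exact mul_ne_zero (one_sub_T_ne_zero hN0) (one_sub_T_ne_zero hN1)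
  apply mul_left_cancel₀ (mul_ne_zero gam_ne_zero hgN0)
  have hL : gam * dilate N gam * (pairPoly (foldedPartition p lam) (foldedPartition p lam) -
      pairPoly (foldedPartition p fun _ => ⊥) (foldedPartition p fun _ => ⊥)) =
      ((1 - T (N : ℤ)) * W0) * ((1 - T (-(N : ℤ))) * LaurentPolynomial.invert W0) -
      ((1 - T (N : ℤ)) * W) * ((1 - T (-(N : ℤ))) * LaurentPolynomial.invert W) := by
    have h1 := gam_mul_pairPoly (foldedPartition p lam) (foldedPartition p lam)
    have h2 := gam_mul_pairPoly (foldedPartition p fun _ => ⊥) (foldedPartition p fun _ => ⊥)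
    rw [hgN]
    linear_combination (1 - T (N : ℤ)) * (1 - T (-(N : ℤ))) * (h1 - h2)
  have hterm : ∀ r s : Fin N, gam * dilate N gam * (T (foldSite p r 0 - foldSite p s 0) *
      dilate N (pairPoly (lam r) (lam s))) =
      gam * (T (foldSite p r 0) * T (-foldSite p s 0) - (T (foldSite p r 0) *
        dilate N (mayaPoly (lam r))) * (T (-foldSite p s 0) *
          LaurentPolynomial.invert (dilate N (mayaPoly (lam s))))) := by
    intro r s
    have h1 := congrArg (dilate N) (gam_mul_pairPoly (lam r) (lam s))
    rw [map_mul, map_sub, map_one, map_mul, ← hdi] at h1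
    rw [LaurentPolynomial.T_sub]
    linear_combination gam * T (foldSite p r 0) * T (-foldSite p s 0) * h1
  rw [hL, hW, hW0, hWi, hW0i, Finset.mul_sum]
  simp only [Finset.mul_sum _ _ (gam * dilate N gam), hterm]
  simp only [← Finset.mul_sum, Finset.sum_sub_distrib, mayaPoly_bot, map_neg, map_one, mul_neg,
    mul_one, Finset.sum_neg_distrib, ← Finset.sum_mul]
  rw [gam]
  ring

theorem contentPoly_foldedPartition {N : ℕ} (hN : 0 < N) (p : Fin N → ℤ) (hp : ∑ r, p r = 0)
    (lam : Fin N → YoungDiagram) :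
    contentPoly (foldedPartition p lam) - contentPoly (foldedPartition p fun _ => ⊥) =
      (∑ j ∈ Finset.range N, T (-(j : ℤ))) *
        ∑ r, T (foldSite p r 0) * dilate N (contentPoly (lam r)) := by
  have hN0 : (N : ℤ) ≠ 0 := by exact_mod_cast hN.ne'
  have hW := mayaPoly_foldedPartition hN p hp lam
  have hW0 := mayaPoly_foldedPartition hN p hp fun _ => ⊥
  have hgN : dilate N gam = (1 - T (N : ℤ)) * (1 - T (-(N : ℤ))) := by
    rw [gam, map_mul, map_sub, map_sub, map_one, dilate_T, dilate_T, mul_one, mul_neg_one]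
  have hgeo : (1 - T (-1)) * ∑ j ∈ Finset.range N, (T (-(j : ℤ)) : ℤ[T;T⁻¹]) =
      1 - T (-(N : ℤ)) := by
    have h := congrArg LaurentPolynomial.invert (one_sub_T_mul_sum N)
    rw [map_mul, map_sub, map_sub, map_one, map_sum] at h
    simp only [LaurentPolynomial.invert_T] at h
    rw [Finset.sum_range]
    exact h
  apply mul_left_cancel₀ (mul_ne_zero (one_sub_T_ne_zero hN0) gam_ne_zero)
  have h1 : ∀ r : Fin N, T (foldSite p r 0) * dilate N (mayaPoly (lam r)) =
      T (foldSite p r 0) * dilate N (mayaPoly ⊥) +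
        dilate N gam * (T (foldSite p r 0) * dilate N (contentPoly (lam r))) := by
    intro r
    rw [mayaPoly_bot, mayaPoly, map_add, map_mul]
    ring
  rw [Finset.sum_congr rfl fun r _ => h1 r, Finset.sum_add_distrib, mul_add, ← hW0,
    ← Finset.mul_sum, hgN] at hW
  rw [mayaPoly, mayaPoly] at hW
  have h2 : gam = (1 - T 1) * (1 - T (-1)) := rfl
  linear_combination hW - (1 - T (N : ℤ)) * (1 - T 1) *
    (∑ r, T (foldSite p r 0) * dilate N (contentPoly (lam r))) * hgeo - (1 - T (N : ℤ)) *
    (∑ j ∈ Finset.range N, T (-(j : ℤ))) *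
    (∑ r, T (foldSite p r 0) * dilate N (contentPoly (lam r))) * h2

theorem card_foldedPartition {N : ℕ} (hN : 0 < N) (p : Fin N → ℤ) (hp : ∑ r, p r = 0)
    (lam : Fin N → YoungDiagram) :
    ((foldedPartition p lam).card : ℤ) - (foldedPartition p fun _ => ⊥).card =
      N * ∑ r, ((lam r).card : ℤ) := by
  have h := congrArg augm (contentPoly_foldedPartition hN p hp lam)
  have h3 : ∀ f g, augm (f - g) = augm f - augm g := lsum_sub _
  rw [h3, augm_contentPoly, augm_contentPoly, augm_mul] at h
  rw [h]
  have h4 : ∀ r, augm (T (foldSite p r 0) * dilate N (contentPoly (lam r))) = (lam r).card := by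
    intro r
    rw [augm_mul, ← augm_contentPoly, augm, augm, lsum_T, lsum_dilate, one_mul]
    rfl
  simp only [augm] at h4 ⊢
  rw [lsum_sum, lsum_sum, Finset.sum_congr rfl fun r _ => h4 r]
  simp [lsum_T]

theorem kappa_foldedPartition {N : ℕ} (hN : 0 < N) (p : Fin N → ℤ) (hp : ∑ r, p r = 0)
    (lam : Fin N → YoungDiagram) :
    kappa (foldedPartition p lam) - kappa (foldedPartition p fun _ => ⊥) =
      ∑ r, ((N : ℤ) ^ 2 * kappa (lam r) +
        N * (2 * N * p r + 2 * r.val - (N - 1)) * (lam r).card) := by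
  have h := congrArg slope (contentPoly_foldedPartition hN p hp lam)
  have h3 : ∀ f g, slope (f - g) = slope f - slope g := lsum_sub _
  rw [h3, slope_mul] at h
  have e1 : augm (∑ j ∈ Finset.range N, (T (-(j : ℤ)) : ℤ[T;T⁻¹])) = N := by
    simp [augm, lsum_sum, lsum_T]
  have e2 : 2 * slope (∑ j ∈ Finset.range N, (T (-(j : ℤ)) : ℤ[T;T⁻¹])) = -(N * (N - 1)) := by
    rw [slope, lsum_sum]
    simp only [lsum_T]
    clear * -
    induction N with
    | zero => simp
    | succ N ih =>
      rw [Finset.sum_range_succ, mul_add, ih]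
      push_cast
      ring
  have e3 : augm (∑ r, T (foldSite p r 0) * dilate N (contentPoly (lam r))) =
      ∑ r, ((lam r).card : ℤ) := by
    rw [augm, lsum_sum]
    refine Finset.sum_congr rfl fun r _ => ?_
    have : augm (T (foldSite p r 0) * dilate N (contentPoly (lam r))) = (lam r).card := by
      rw [augm_mul, ← augm_contentPoly, augm, augm, lsum_T, lsum_dilate, one_mul]
      rfl
    exact this
  have e4 : 2 * slope (∑ r, T (foldSite p r 0) * dilate N (contentPoly (lam r))) =
      ∑ r, (N * kappa (lam r) + 2 * (N * p r + r.val) * ((lam r).card : ℤ)) := by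
    rw [slope, lsum_sum, Finset.mul_sum]
    refine Finset.sum_congr rfl fun r _ => ?_
    have h5 : slope (T (foldSite p r 0) * dilate N (contentPoly (lam r))) =
        foldSite p r 0 * (lam r).card + N * slope (contentPoly (lam r)) := by
      rw [slope_mul, ← augm_contentPoly, augm, augm, slope, slope, lsum_T, lsum_T, lsum_dilate,
        lsum_dilate, one_mul, lsum_const_mul, augm, slope]
    have h6 : lsum (fun m => m) (T (foldSite p r 0) * dilate N (contentPoly (lam r))) =
        slope (T (foldSite p r 0) * dilate N (contentPoly (lam r))) := rfl
    rw [h6, h5, ← two_mul_slope_contentPoly, foldSite]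
    ring
  rw [e1, e3] at h
  rw [← two_mul_slope_contentPoly, ← two_mul_slope_contentPoly, ← mul_sub, h, mul_add,
    ← mul_assoc, e2, mul_left_comm, e4, Finset.mul_sum, Finset.mul_sum, ← Finset.sum_add_distrib]
  refine Finset.sum_congr rfl fun r _ => ?_
  ring

/-! ### The square of the principal specialization -/

/-- `a ^ (-|m|) - a ^ |m|`, with the value `1` at `m = 0`. -/
def bracket (a : ℂ) (m : ℤ) : ℂ := if m = 0 then 1 else a ^ (-|m|) - a ^ |m|

theorem bracket_neg (a : ℂ) (m : ℤ) : bracket a (-m) = bracket a m := by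
  simp [bracket]

theorem bracket_ne_zero {a : ℂ} (ha0 : a ≠ 0) (ha : ∀ k, 1 ≤ k → (a ^ 2) ^ k ≠ 1) (m : ℤ) :
    bracket a m ≠ 0 := by
  rw [bracket]
  split_ifs with h
  · exact one_ne_zero
  · intro h1
    have hk : 1 ≤ m.natAbs := Int.natAbs_pos.2 h
    apply ha m.natAbs hk
    rw [sub_eq_zero, zpow_neg, Int.abs_eq_natAbs, zpow_natCast] at h1
    rw [pow_right_comm, sq]
    nth_rw 1 [← h1]
    exact inv_mul_cancel₀ (pow_ne_zero _ ha0)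

theorem zpow_finset_sum {ι : Type*} {a : ℂ} (ha0 : a ≠ 0) (s : Finset ι) (f : ι → ℤ) :
    a ^ (∑ i ∈ s, f i) = ∏ i ∈ s, a ^ f i := by
  classical
  induction s using Finset.induction_on with
  | empty => simp
  | insert i s hi ih => rw [Finset.sum_insert hi, Finset.prod_insert hi, zpow_add₀ ha0, ih]

theorem one_sub_zpow_sq {a : ℂ} (ha0 : a ≠ 0) {m : ℤ} (hm : m ≠ 0) :
    (1 - (a ^ 2) ^ m) ^ 2 = (a ^ 2) ^ m * bracket a m ^ 2 := by
  rw [bracket, if_neg hm]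
  have h : (a ^ (-|m|) - a ^ |m|) ^ 2 = (a ^ (-m) - a ^ m) ^ 2 := by
    rcases abs_choice m with h | h
    · rw [h]
    · rw [h, neg_neg]
      ring
  rw [h, ← zpow_natCast a 2, ← zpow_mul, zpow_neg]
  have e : a ^ (((2 : ℕ) : ℤ) * m) = a ^ m * a ^ m := by
    rw [← zpow_add₀ ha0]
    congr 1
    push_cast
    ring
  have h0 : a ^ m ≠ 0 := zpow_ne_zero m ha0
  rw [e]
  field_simp

theorem one_sub_pow_sq {a : ℂ} (ha0 : a ≠ 0) {m : ℕ} (hm : 1 ≤ m) :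
    (1 - (a ^ 2) ^ m) ^ 2 = a ^ (2 * (m : ℤ)) * (bracket a m * bracket a (-m)) := by
  have h := one_sub_zpow_sq ha0 (m := (m : ℤ)) (by omega)
  rw [zpow_natCast] at h
  rw [h, bracket_neg, zpow_mul, sq (bracket a m)]
  norm_cast

theorem pairPoly_self_eq {n : ℕ} {μ : YoungDiagram} (hμ : μ.colLen 0 ≤ n) :
    -pairPoly μ μ =
      ∑ i : Fin n, ∑ j ∈ Finset.Ioi i,
        (T ((betaNum n μ i - betaNum n μ j : ℕ) : ℤ) +
          T (-((betaNum n μ i - betaNum n μ j : ℕ) : ℤ))) -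
      ∑ i : Fin n, ∑ m ∈ Finset.Icc 1 (betaNum n μ i), (T (m : ℤ) + T (-(m : ℤ))) := by
  apply mul_left_cancel₀ gam_ne_zero
  set K : ℤ[T;T⁻¹] := ∑ i : Fin n, T (betaNum n μ i : ℤ) with hK
  set K' : ℤ[T;T⁻¹] := ∑ i : Fin n, T (-(betaNum n μ i : ℤ)) with hK'
  have hKW : T (n : ℤ) * mayaPoly μ = (1 - T 1) * K - 1 := by
    rw [mayaPoly_eq hμ, mul_sub, ← LaurentPolynomial.T_add, add_neg_cancel, LaurentPolynomial.T_zero,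
      mul_left_comm, Finset.mul_sum, Finset.sum_range]
    simp only [← LaurentPolynomial.T_add]
    congr 2
    refine Finset.sum_congr rfl fun i _ => ?_
    congr 1
    have := i.isLt
    simp only [betaNum, mayaInt]
    omega
  have hKW' : T (-(n : ℤ)) * LaurentPolynomial.invert (mayaPoly μ) = (1 - T (-1)) * K' - 1 := by
    have h := congrArg LaurentPolynomial.invert hKW
    rw [map_mul, LaurentPolynomial.invert_T, map_sub, map_one, map_mul, map_sub, map_one,
      LaurentPolynomial.invert_T, hK, map_sum] at h
    simpa only [LaurentPolynomial.invert_T] using h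
  have hWW : mayaPoly μ * LaurentPolynomial.invert (mayaPoly μ) =
      ((1 - T 1) * K - 1) * ((1 - T (-1)) * K' - 1) := by
    rw [← hKW, ← hKW', mul_mul_mul_comm, ← LaurentPolynomial.T_add, add_neg_cancel,
      LaurentPolynomial.T_zero, one_mul]
  have h1 : ∑ i : Fin n, ∑ j ∈ Finset.Ioi i,
        (T ((betaNum n μ i - betaNum n μ j : ℕ) : ℤ) +
          T (-((betaNum n μ i - betaNum n μ j : ℕ) : ℤ)) : ℤ[T;T⁻¹]) = K * K' - n := by
    have e : ∀ i : Fin n, ∑ j ∈ Finset.Ioi i,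
        (T ((betaNum n μ i - betaNum n μ j : ℕ) : ℤ) +
          T (-((betaNum n μ i - betaNum n μ j : ℕ) : ℤ)) : ℤ[T;T⁻¹]) = ∑ j ∈ Finset.Ioi i,
        (T ((betaNum n μ j : ℤ) - betaNum n μ i) + T ((betaNum n μ i : ℤ) - betaNum n μ j)) := by
      intro i
      refine Finset.sum_congr rfl fun j hj => ?_
      rw [Nat.cast_sub (betaNum_strictAnti n μ (Finset.mem_Ioi.1 hj)).le, neg_sub, add_comm]
    rw [Finset.sum_congr rfl fun i _ => e i,
      Finset.sum_sum_Ioi_add_eq_sum_sum_off_diag fun j i : Fin n =>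
        (T ((betaNum n μ j : ℤ) - betaNum n μ i) : ℤ[T;T⁻¹]), eq_sub_iff_add_eq]
    have e2 : (n : ℤ[T;T⁻¹]) = ∑ i : Fin n, T ((betaNum n μ i : ℤ) - betaNum n μ i) := by
      simp [LaurentPolynomial.T_zero]
    rw [e2, ← Finset.sum_add_distrib, mul_comm, hK, hK', Finset.sum_mul_sum]
    refine Finset.sum_congr rfl fun i _ => ?_
    rw [add_comm, Fintype.sum_eq_add_sum_compl i fun j =>
      (T (-(betaNum n μ i : ℤ)) * T (betaNum n μ j : ℤ) : ℤ[T;T⁻¹])]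
    simp only [← LaurentPolynomial.T_add, sub_eq_neg_add]
  have h2 : ∀ l : ℕ, gam * ∑ m ∈ Finset.Icc 1 l, (T (m : ℤ) + T (-(m : ℤ)) : ℤ[T;T⁻¹]) =
      (1 - T 1) * T (l : ℤ) + (1 - T (-1)) * T (-(l : ℤ)) - gam := by
    have hg : gam = 1 - T 1 + (1 - T (-1)) := by
      simp only [gam, mul_sub, sub_mul, mul_one, ← LaurentPolynomial.T_add]
      rw [add_neg_cancel, LaurentPolynomial.T_zero]
      ring
    intro l
    induction l with
    | zero => simp [LaurentPolynomial.T_zero, hg]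
    | succ l ih =>
      rw [Finset.sum_Icc_succ_top (by omega), mul_add, ih, hg]
      simp only [mul_add, sub_mul, add_mul, one_mul, ← LaurentPolynomial.T_add]
      push_cast
      rw [show (1 : ℤ) + ((l : ℤ) + 1) = (l : ℤ) + 2 by ring,
        show (1 : ℤ) + -((l : ℤ) + 1) = -(l : ℤ) by ring,
        show (-1 : ℤ) + ((l : ℤ) + 1) = (l : ℤ) by ring,
        show (-1 : ℤ) + -((l : ℤ) + 1) = -(l : ℤ) - 2 by ring,
        show (1 : ℤ) + (l : ℤ) = (l : ℤ) + 1 by ring,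
        show (-1 : ℤ) + -(l : ℤ) = -((l : ℤ) + 1) by ring]
      ring
  have h3 : gam * ∑ i : Fin n, ∑ m ∈ Finset.Icc 1 (betaNum n μ i), (T (m : ℤ) + T (-(m : ℤ)) : ℤ[T;T⁻¹]) =
      (1 - T 1) * K + (1 - T (-1)) * K' - (n : ℤ[T;T⁻¹]) * gam := by
    rw [Finset.mul_sum, Finset.sum_congr rfl fun i _ => h2 _, Finset.sum_sub_distrib,
      Finset.sum_add_distrib, ← Finset.mul_sum, ← Finset.mul_sum, Finset.sum_const,
      Finset.card_univ, Fintype.card_fin, nsmul_eq_mul]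
  rw [mul_neg, gam_mul_pairPoly, hWW, h1, mul_sub gam, h3, gam]
  ring

theorem sum_Ioi_betaNum_sub (n : ℕ) (μ : YoungDiagram) :
    ∑ i : Fin n, ∑ j ∈ Finset.Ioi i, ((betaNum n μ i - betaNum n μ j : ℕ) : ℤ) =
      ∑ i : Fin n, ((n : ℤ) - 1 - 2 * i.val) * betaNum n μ i := by
  have h1 : ∀ i : Fin n, ∑ j ∈ Finset.Ioi i, ((betaNum n μ i - betaNum n μ j : ℕ) : ℤ) =
      ((n : ℤ) - 1 - i.val) * betaNum n μ i - ∑ j ∈ Finset.Ioi i, (betaNum n μ j : ℤ) := by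
    intro i
    rw [Finset.sum_congr rfl fun j hj =>
      Nat.cast_sub (betaNum_strictAnti n μ (Finset.mem_Ioi.1 hj)).le, Finset.sum_sub_distrib,
      Finset.sum_const, Fin.card_Ioi, nsmul_eq_mul]
    congr 2
    have := i.isLt
    omega
  have h2 : ∑ i : Fin n, ∑ j ∈ Finset.Ioi i, (betaNum n μ j : ℤ) =
      ∑ j : Fin n, (j.val : ℤ) * betaNum n μ j := by
    rw [Finset.sum_comm' (t' := Finset.univ) (s' := fun j => Finset.Iio j) (by simp)]
    refine Finset.sum_congr rfl fun j _ => ?_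
    rw [Finset.sum_const, Fin.card_Iio, nsmul_eq_mul]
  rw [Finset.sum_congr rfl fun i _ => h1 i, Finset.sum_sub_distrib, h2, ← Finset.sum_sub_distrib]
  exact Finset.sum_congr rfl fun i _ => by ring

theorem kappa_eq_sum {n : ℕ} {μ : YoungDiagram} (hμ : μ.colLen 0 ≤ n) :
    kappa μ = ∑ i : Fin n, ((μ.rowLen i : ℤ) ^ 2 - (2 * i.val + 1) * μ.rowLen i) := by
  rw [kappa, sum_cells hμ, Finset.mul_sum, Finset.sum_range]
  refine Finset.sum_congr rfl fun i _ => ?_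
  generalize μ.rowLen i = l
  simp only
  induction l with
  | zero => simp
  | succ l ih =>
    rw [Finset.sum_range_succ, mul_add, ih]
    push_cast
    ring

theorem two_mul_sum_Icc (l : ℕ) : ∑ m ∈ Finset.Icc 1 l, (2 * (m : ℤ)) = l * (l + 1) := by
  induction l with
  | zero => simp
  | succ l ih =>
    rw [Finset.sum_Icc_succ_top (by omega), ih]
    push_cast
    ring

theorem sum_exponent_eq_neg_kappa {n : ℕ} {μ : YoungDiagram} (hμ : μ.colLen 0 ≤ n) :
    2 * (∑ i : Fin n, (2 * (i.val : ℤ) + 1) * μ.rowLen i) +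
      (2 * ∑ i : Fin n, ((n : ℤ) - 1 - 2 * i.val) * betaNum n μ i) -
      ∑ i : Fin n, (betaNum n μ i : ℤ) * (betaNum n μ i + 1) = -kappa μ := by
  have h0 : ∀ M : ℤ, ∀ n : ℕ,
      2 * ∑ c ∈ Finset.range n, (3 * (c : ℤ) ^ 2 - (2 * M - 1) * c) =
        n * (n - 1) * (2 * n - 1) - (2 * M - 1) * (n * (n - 1)) := by
    intro M n
    induction n with
    | zero => simp
    | succ n ih =>
      rw [Finset.sum_range_succ, mul_add, ih]
      push_cast
      ring
  have h1 : ∑ i : Fin n, (3 * ((n : ℤ) - 1 - i.val) ^ 2 - (2 * n - 1) * ((n : ℤ) - 1 - i.val)) = 0 := by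
    have h2 := h0 n n
    rw [← Finset.sum_range_reflect, Finset.sum_range] at h2
    have h3 : ∀ i : Fin n, ((n - 1 - i.val : ℕ) : ℤ) = (n : ℤ) - 1 - i.val := fun i => by
      have := i.isLt
      omega
    simp only [h3] at h2
    linarith
  rw [kappa_eq_sum hμ, Finset.mul_sum, Finset.mul_sum, ← Finset.sum_add_distrib,
    ← Finset.sum_sub_distrib, ← Finset.sum_neg_distrib, ← sub_eq_zero, ← Finset.sum_sub_distrib,
    ← h1]
  refine Finset.sum_congr rfl fun i _ => ?_
  have h3 : (betaNum n μ i : ℤ) = (μ.rowLen i : ℤ) + ((n : ℤ) - 1 - i.val) := by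
    have := i.isLt
    simp only [betaNum]
    omega
  rw [h3]
  ring

theorem schur_geomPowerSum_sq {a : ℂ} (ha0 : a ≠ 0) (ha : ∀ k, 1 ≤ k → (a ^ 2) ^ k ≠ 1)
    (μ : YoungDiagram) :
    schur (geomPowerSum a) μ ^ 2 = a ^ (-kappa μ) * lprod (bracket a) (-pairPoly μ μ) := by
  have hφ := bracket_ne_zero ha0 ha
  set n := μ.colLen 0 with hn
  rw [schur_geomPowerSum ha0 ha hn.symm.le, pairPoly_self_eq hn.symm.le, lprod_sub hφ,
    lprod_sum hφ, lprod_sum hφ]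
  simp only [lprod_sum hφ, lprod_add hφ, lprod_T]
  rw [mul_pow, ← Finset.prod_pow, ← pow_mul]
  simp only [div_pow, qFactorial, ← Finset.prod_pow]
  rw [Finset.prod_div_distrib]
  have h1 : ∏ i : Fin n, ∏ j ∈ Finset.Ioi i,
      (1 - (a ^ 2) ^ (betaNum n μ i - betaNum n μ j)) ^ 2 =
      a ^ (2 * ∑ i : Fin n, ((n : ℤ) - 1 - 2 * i.val) * betaNum n μ i) *
        ∏ i : Fin n, ∏ j ∈ Finset.Ioi i,
          (bracket a ((betaNum n μ i - betaNum n μ j : ℕ) : ℤ) *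
            bracket a (-((betaNum n μ i - betaNum n μ j : ℕ) : ℤ))) := by
    rw [← sum_Ioi_betaNum_sub, Finset.mul_sum, zpow_finset_sum ha0, ← Finset.prod_mul_distrib]
    refine Finset.prod_congr rfl fun i _ => ?_
    rw [Finset.mul_sum, zpow_finset_sum ha0, ← Finset.prod_mul_distrib]
    refine Finset.prod_congr rfl fun j hj => ?_
    have := betaNum_strictAnti n μ (Finset.mem_Ioi.1 hj)
    exact one_sub_pow_sq ha0 (by omega)
  have h2 : ∏ i : Fin n, ∏ m ∈ Finset.Icc 1 (betaNum n μ i), (1 - (a ^ 2) ^ m) ^ 2 =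
      a ^ (∑ i : Fin n, (betaNum n μ i : ℤ) * (betaNum n μ i + 1)) *
        ∏ i : Fin n, ∏ m ∈ Finset.Icc 1 (betaNum n μ i), (bracket a (m : ℤ) * bracket a (-m)) := by
    rw [zpow_finset_sum ha0, ← Finset.prod_mul_distrib]
    refine Finset.prod_congr rfl fun i _ => ?_
    rw [← two_mul_sum_Icc, zpow_finset_sum ha0, ← Finset.prod_mul_distrib]
    refine Finset.prod_congr rfl fun m hm => ?_
    exact one_sub_pow_sq ha0 (Finset.mem_Icc.1 hm).1
  have h3 : a ^ ((∑ i : Fin n, (2 * (i : ℕ) + 1) * μ.rowLen i) * 2) =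
      a ^ (2 * (∑ i : Fin n, (2 * (i.val : ℤ) + 1) * μ.rowLen i)) := by
    rw [← zpow_natCast]
    congr 1
    push_cast
    ring
  rw [h1, h2, h3, ← sum_exponent_eq_neg_kappa hn.symm.le, zpow_sub₀ ha0, zpow_add₀ ha0]
  ring

/-! ### The alphabets `q^{-ρ}` and `q^{λ+ρ}` -/

theorem cpow_half_sq (b : ℂ) : (b ^ (1 / 2 : ℂ)) ^ 2 = b := by
  rw [← Complex.cpow_nat_mul]
  norm_num

theorem cpow_half_ne_zero {b : ℂ} (hb : b ≠ 0) : b ^ (1 / 2 : ℂ) ≠ 0 := fun h => by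
  have := cpow_half_sq b
  rw [h] at this
  simp at this
  exact hb this.symm

theorem norm_cpow_half_lt_one {b : ℂ} (hb : ‖b‖ < 1) : ‖b ^ (1 / 2 : ℂ)‖ < 1 := by
  have h : ‖b ^ (1 / 2 : ℂ)‖ ^ 2 < 1 := by rwa [← norm_pow, cpow_half_sq]
  exact lt_of_pow_lt_pow_left₀ 2 zero_le_one (by simpa using h)

theorem powerSumNegRho_eq {q : ℂ} (hq0 : q ≠ 0) (hq1 : ‖q‖ < 1) {k : ℕ} (hk : 1 ≤ k) :
    powerSumNegRho q k = geomPowerSum (q ^ (1 / 2 : ℂ)) k := by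
  have h : ∀ i : ℕ, (q ^ ((i : ℂ) + 1 / 2)) ^ k = (q ^ (1 / 2 : ℂ)) ^ k * (q ^ k) ^ i := fun i => by
    rw [Complex.cpow_add _ _ hq0, Complex.cpow_natCast, mul_pow, mul_comm, pow_right_comm]
  have h1 : ‖q ^ k‖ < 1 := by
    rw [norm_pow]
    exact pow_lt_one₀ (norm_nonneg q) hq1 (by omega)
  rw [powerSumNegRho, tsum_congr h, tsum_mul_left, tsum_geometric_of_norm_lt_one h1, geomPowerSum,
    pow_mul, cpow_half_sq, ← div_eq_mul_inv]

theorem cpow_mayaCoord {b : ℂ} (hb : b ≠ 0) (μ : YoungDiagram) (i : ℕ) :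
    b ^ ((mayaCoord μ i : ℚ) : ℂ) = b ^ (1 / 2 : ℂ) * b ^ mayaInt μ i := by
  rw [mayaCoord_eq, mul_comm]
  push_cast
  rw [Complex.cpow_add _ _ hb, Complex.cpow_intCast]

theorem powerSumShiftedRho_eq {b : ℂ} (hb0 : b ≠ 0) (hb : ‖b‖ < 1) (lam : YoungDiagram) {k : ℕ}
    (hk : 1 ≤ k) :
    powerSumShiftedRho b lam k =
      (b ^ (1 / 2 : ℂ)) ^ k / (1 - b ^ k) * lsum (fun m => (b ^ k) ^ m) (mayaPoly lam) := by
  set c := b ^ (1 / 2 : ℂ) with hc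
  have hc0 : c ≠ 0 := cpow_half_ne_zero hb0
  have hcb : b ^ k = c ^ k * c ^ k := by
    rw [← mul_pow, ← sq, hc, cpow_half_sq]
  have h1 : 1 - b ^ k ≠ 0 := sub_ne_zero.2 (pow_ne_one_of_norm_lt_one hb k hk).symm
  have hx : b ^ k ≠ 0 := pow_ne_zero _ hb0
  have e1 : b ^ ((k : ℂ) / 2) = c ^ k := by
    rw [hc, ← Complex.cpow_nat_mul]
    congr 1
    ring
  have hw : ∀ μ : YoungDiagram, μ.colLen 0 ≤ lam.colLen 0 →
      (1 - b ^ k) * ∑ i ∈ Finset.range (lam.colLen 0), (b ^ k) ^ mayaInt μ i =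
        lsum (fun m => (b ^ k) ^ m) (mayaPoly μ) + (b ^ k) ^ (-(lam.colLen 0 : ℤ)) := by
    intro μ hμ
    rw [mayaPoly_eq hμ, lsum_sub, lsum_zpow_mul hx, lsum_sub, ← LaurentPolynomial.T_zero, lsum_T,
      lsum_T, lsum_T, lsum_sum]
    simp only [lsum_T, zpow_one, zpow_zero]
    ring
  have h2 : ∑ i ∈ Finset.range (lam.colLen 0),
      ((b ^ ((mayaCoord lam i : ℚ) : ℂ)) ^ k - (b ^ ((mayaCoord ⊥ i : ℚ) : ℂ)) ^ k) =
      c ^ k * (lsum (fun m => (b ^ k) ^ m) (mayaPoly lam) + 1) / (1 - b ^ k) := by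
    rw [eq_div_iff h1]
    have h3 : ∀ (μ : YoungDiagram) i, (b ^ ((mayaCoord μ i : ℚ) : ℂ)) ^ k =
        c ^ k * (b ^ k) ^ mayaInt μ i := fun μ i => by
      rw [cpow_mayaCoord hb0, mul_pow, ← zpow_natCast (b ^ mayaInt μ i), ← zpow_mul,
        ← zpow_natCast b k, ← zpow_mul, mul_comm (k : ℤ)]
    simp only [h3, ← mul_sub, ← Finset.mul_sum, Finset.sum_sub_distrib]
    have h4 := hw lam le_rfl
    have h5 := hw ⊥ (by simp [colLen_bot])
    rw [mayaPoly_bot, lsum_neg, ← LaurentPolynomial.T_zero, lsum_T, zpow_zero] at h5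
    linear_combination c ^ k * (h4 - h5)
  rw [powerSumShiftedRho, h2, Complex.cpow_neg, e1]
  have h6 : c ^ k - (c ^ k)⁻¹ ≠ 0 := by
    intro h
    apply h1
    rw [sub_eq_zero] at h
    rw [hcb]
    nth_rw 1 [h]
    rw [inv_mul_cancel₀ (pow_ne_zero _ hc0), sub_self]
  have h7 : 1 / (c ^ k - (c ^ k)⁻¹) = -c ^ k / (1 - b ^ k) := by
    rw [div_eq_div_iff h6 h1, hcb]
    field_simp
    ring
  rw [h7]
  ring

theorem powerSumShiftedRho_bot {b : ℂ} (hb0 : b ≠ 0) (hb : ‖b‖ < 1) {k : ℕ} (hk : 1 ≤ k) :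
    powerSumShiftedRho b ⊥ k = geomPowerSum (b ^ (1 / 2 : ℂ))⁻¹ k := by
  have h1 : 1 - b ^ k ≠ 0 := sub_ne_zero.2 (pow_ne_one_of_norm_lt_one hb k hk).symm
  have h2 : b ^ k - 1 ≠ 0 := by rwa [← neg_ne_zero, neg_sub]
  have hcb : b ^ k = (b ^ (1 / 2 : ℂ)) ^ k * (b ^ (1 / 2 : ℂ)) ^ k := by
    rw [← mul_pow, ← sq, cpow_half_sq]
  have hc0 : (b ^ (1 / 2 : ℂ)) ^ k ≠ 0 := pow_ne_zero _ (cpow_half_ne_zero hb0)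
  rw [powerSumShiftedRho_eq hb0 hb _ hk, mayaPoly_bot, lsum_neg, ← LaurentPolynomial.T_zero, lsum_T,
    zpow_zero, geomPowerSum, pow_mul, inv_pow, inv_pow, inv_pow, cpow_half_sq,
    div_mul_eq_mul_div, div_eq_div_iff h1 (by
      rw [← one_div, one_sub_div (pow_ne_zero _ hb0)]
      exact div_ne_zero h2 (pow_ne_zero _ hb0))]
  rw [hcb]
  field_simp
  ring

theorem contentPoly_transpose (μ : YoungDiagram) :
    contentPoly μ.transpose = LaurentPolynomial.invert (contentPoly μ) := by
  rw [contentPoly, contentPoly, map_sum]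
  refine Finset.sum_nbij' Prod.swap Prod.swap ?_ ?_ ?_ ?_ ?_
  · intro c hc
    rw [YoungDiagram.mem_cells] at hc ⊢
    exact YoungDiagram.mem_transpose.1 hc
  · intro c hc
    rw [YoungDiagram.mem_cells] at hc ⊢
    rw [YoungDiagram.mem_transpose]
    simpa using hc
  · simp
  · simp
  · intro c _
    rw [LaurentPolynomial.invert_T]
    simp

theorem mayaPoly_transpose (μ : YoungDiagram) :
    mayaPoly μ.transpose = LaurentPolynomial.invert (mayaPoly μ) := by
  rw [mayaPoly, mayaPoly, contentPoly_transpose, map_add, map_mul, invert_gam, invert_neg, map_one]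

theorem powerSumShiftedRho_mul_transpose {b : ℂ} (hb0 : b ≠ 0) (hb : ‖b‖ < 1)
    (lam μ : YoungDiagram) {k : ℕ} (hk : 1 ≤ k) :
    powerSumShiftedRho b lam k * powerSumShiftedRho b μ.transpose k =
      b ^ k / (1 - b ^ k) ^ 2 + lsum (fun m => (b ^ k) ^ m) (pairPoly lam μ) := by
  have h1 : 1 - b ^ k ≠ 0 := sub_ne_zero.2 (pow_ne_one_of_norm_lt_one hb k hk).symm
  have hx : b ^ k ≠ 0 := pow_ne_zero _ hb0
  have hcb : (b ^ (1 / 2 : ℂ)) ^ k * (b ^ (1 / 2 : ℂ)) ^ k = b ^ k := by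
    rw [← mul_pow, ← sq, cpow_half_sq]
  have h2 := congrArg (lsum fun m => (b ^ k) ^ m) (gam_mul_pairPoly lam μ)
  rw [lsum_zpow_mul hx, lsum_sub, lsum_zpow_mul hx, gam, lsum_zpow_mul hx, lsum_sub, lsum_sub,
    ← LaurentPolynomial.T_zero, lsum_T, lsum_T, lsum_T, zpow_zero, zpow_one, zpow_neg,
    zpow_one] at h2
  rw [powerSumShiftedRho_eq hb0 hb _ hk, powerSumShiftedRho_eq hb0 hb _ hk, mayaPoly_transpose]
  rw [show ∀ u v w x : ℂ, u / v * w * (u / v * x) = (u * u) * (w * x) / v ^ 2 from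
      fun u v w x => by ring, hcb, div_add' _ _ _ (pow_ne_zero 2 h1)]
  congr 1
  have h3 : (b ^ k) * (b ^ k)⁻¹ = 1 := mul_inv_cancel₀ hx
  linear_combination (b ^ k) * h2 + (1 - b ^ k) * (lsum (fun m => (b ^ k) ^ m) (pairPoly lam μ)) * h3

theorem exists_norm_lsum_le (x : ℂ) (f : ℤ[T;T⁻¹]) :
    ∃ R : ℝ, 1 ≤ R ∧ ∀ k : ℕ, 1 ≤ k → ‖lsum (fun m => (x ^ k) ^ m) f‖ ≤ R ^ k := by
  induction f using laurent_induction with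
  | hT n =>
    refine ⟨max 1 ‖x ^ n‖, le_max_left _ _, fun k _ => ?_⟩
    rw [lsum_T, ← zpow_natCast x k, ← zpow_mul, mul_comm, zpow_mul, zpow_natCast, norm_pow]
    exact pow_le_pow_left₀ (norm_nonneg _) (le_max_right _ _) _
  | hadd f g hf hg =>
    obtain ⟨R, hR, hf⟩ := hf
    obtain ⟨S, hS, hg⟩ := hg
    refine ⟨R + S, by linarith, fun k hk => ?_⟩
    rw [lsum_add]
    exact (norm_add_le _ _).trans ((add_le_add (hf k hk) (hg k hk)).trans
      (pow_add_pow_le (by linarith) (by linarith) (by omega)))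
  | hneg f hf =>
    obtain ⟨R, hR, hf⟩ := hf
    exact ⟨R, hR, fun k hk => by rw [lsum_neg, norm_neg]; exact hf k hk⟩

theorem exists_norm_powerSumShiftedRho_le {b : ℂ} (hb0 : b ≠ 0) (hb : ‖b‖ < 1)
    (lam : YoungDiagram) :
    ∃ R : ℝ, 1 ≤ R ∧ ∀ k, 1 ≤ k → ‖powerSumShiftedRho b lam k‖ ≤ R ^ k := by
  obtain ⟨R, hR, h⟩ := exists_norm_lsum_le b (mayaPoly lam)
  have h1 : 0 < 1 - ‖b‖ := by linarith
  have h2 : 1 ≤ (1 - ‖b‖)⁻¹ := (one_le_inv₀ h1).2 (by linarith [norm_nonneg b])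
  refine ⟨(1 - ‖b‖)⁻¹ * R, one_le_mul_of_one_le_of_one_le h2 hR, fun k hk => ?_⟩
  rw [powerSumShiftedRho_eq hb0 hb _ hk, norm_mul, mul_pow]
  refine mul_le_mul ?_ (h k hk) (norm_nonneg _) (by positivity)
  rw [norm_div, norm_pow]
  have h3 : 1 - ‖b‖ ≤ ‖1 - b ^ k‖ := by
    have h4 := norm_sub_norm_le (1 : ℂ) (b ^ k)
    rw [norm_one, norm_pow] at h4
    have h5 := pow_le_of_le_one (norm_nonneg b) hb.le (n := k) (by omega)
    linarith
  calc ‖b ^ (1 / 2 : ℂ)‖ ^ k / ‖1 - b ^ k‖ ≤ 1 / (1 - ‖b‖) :=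
        div_le_div₀ zero_le_one (pow_le_one₀ (norm_nonneg _) (norm_cpow_half_lt_one hb).le) h1 h3
    _ = (1 - ‖b‖)⁻¹ := one_div _
    _ ≤ (1 - ‖b‖)⁻¹ ^ k := le_self_pow₀ h2 (by omega)

/-! ### Sums of complete symmetric functions -/

theorem hasSum_completeSymm_add {P P' : ℕ → ℂ} {g g' : ℂ} (h : HasSum (completeSymm P) g)
    (h' : HasSum (completeSymm P') g') :
    HasSum (completeSymm fun k => P k + P' k) (g * g') := by
  have e : (completeSymm fun k => P k + P' k) = fun n =>
      ∑ x ∈ Finset.HasAntidiagonal.antidiagonal n, completeSymm P x.1 * completeSymm P' x.2 :=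
    funext fun n => completeSymm_add P P' n
  have h1 := h.summable.norm
  have h2 := h'.summable.norm
  rw [e, ← h.tsum_eq, ← h'.tsum_eq, tsum_mul_tsum_eq_tsum_sum_antidiagonal_of_summable_norm h1 h2]
  exact (summable_norm_sum_mul_antidiagonal_of_summable_norm h1 h2).of_norm.hasSum

theorem hasSum_completeSymm_zero : HasSum (completeSymm fun _ => 0) 1 := by
  have h := hasSum_ite_eq (0 : ℕ) (1 : ℂ)
  convert! h using 2 with n
  rw [completeSymm_zero_fun]

theorem hasSum_completeSymm_sum {ι : Type*} (s : Finset ι) {P : ι → ℕ → ℂ} {g : ι → ℂ}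
    (h : ∀ i ∈ s, HasSum (completeSymm (P i)) (g i)) :
    HasSum (completeSymm fun k => ∑ i ∈ s, P i k) (∏ i ∈ s, g i) := by
  classical
  induction s using Finset.induction_on with
  | empty => simpa using hasSum_completeSymm_zero
  | insert i s hi ih =>
    rw [Finset.prod_insert hi]
    simp only [Finset.sum_insert hi]
    exact hasSum_completeSymm_add (h i (Finset.mem_insert_self i s))
      (ih fun j hj => h j (Finset.mem_insert_of_mem hj))

theorem hasSum_completeSymm_pow {c : ℂ} (hc : ‖c‖ < 1) :
    HasSum (completeSymm fun k => c ^ k) (1 - c)⁻¹ := by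
  have e : (completeSymm fun k => c ^ k) = fun n => c ^ n := funext fun n => completeSymm_pow c n
  rw [e]
  exact hasSum_geometric_of_norm_lt_one hc

theorem hasSum_completeSymm_neg_pow (c : ℂ) :
    HasSum (completeSymm fun k => -c ^ k) (1 - c) := by
  have h1 : completeSeries (fun k => -c ^ k) = ((1 - Polynomial.C c * Polynomial.X : Polynomial ℂ) : PowerSeries ℂ) := by
    have h2 : completeSeries (fun k => -c ^ k) * completeSeries (fun k => c ^ k) = 1 := by
      rw [← completeSeries_add]
      simp only [neg_add_cancel]
      exact completeSeries_zero_fun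
    have h3 := completeSeries_pow_mul c
    calc completeSeries (fun k => -c ^ k)
        = completeSeries (fun k => -c ^ k) * (completeSeries (fun k => c ^ k) *
            ((1 - Polynomial.C c * Polynomial.X : Polynomial ℂ) : PowerSeries ℂ)) := by
          rw [h3, mul_one]
      _ = _ := by rw [← mul_assoc, h2, one_mul]
  have h4 : ∀ n, completeSymm (fun k => -c ^ k) n =
      (1 - Polynomial.C c * Polynomial.X : Polynomial ℂ).coeff n := fun n => by
    rw [← coeff_completeSeries, h1, Polynomial.coeff_coe]
  have h5 := hasSum_sum_of_ne_finset_zero (L := SummationFilter.unconditional ℕ)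
    (f := completeSymm fun k => -c ^ k) (s := Finset.range 2) (by
      intro n hn
      rw [h4]
      have : 2 ≤ n := by
        rw [Finset.mem_range] at hn
        omega
      obtain ⟨m, rfl⟩ : ∃ m, n = m + 2 := ⟨n - 2, by omega⟩
      simp [Polynomial.coeff_one])
  convert! h5 using 1
  rw [Finset.sum_range_succ, Finset.sum_range_one, h4, h4]
  simp [Polynomial.coeff_one]
  ring

theorem hasSum_completeSymm_intCast_mul_pow {c : ℂ} (hc : ‖c‖ < 1) (n : ℤ) :
    HasSum (completeSymm fun k => (n : ℂ) * c ^ k) ((1 - c) ^ n)⁻¹ := by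
  obtain ⟨m, rfl | rfl⟩ := n.eq_nat_or_neg
  · have h := hasSum_completeSymm_sum (Finset.range m) fun _ _ => hasSum_completeSymm_pow hc
    simpa [zpow_natCast] using h
  · have h := hasSum_completeSymm_sum (Finset.range m) fun _ _ => hasSum_completeSymm_neg_pow c
    simpa [zpow_natCast] using h

theorem hasSum_completeSymm_lsum {w b : ℂ} (f : ℤ[T;T⁻¹])
    (h : ∀ m ∈ f.coeff.support, ‖w * b ^ m‖ < 1) :
    HasSum (completeSymm fun k => w ^ k * lsum (fun m => (b ^ k) ^ m) f)
      (lprod (fun m => 1 - w * b ^ m) f)⁻¹ := by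
  have h1 := hasSum_completeSymm_sum f.coeff.support fun m hm =>
    hasSum_completeSymm_intCast_mul_pow (h m hm) (f.coeff m)
  rw [lprod, Finsupp.prod, ← Finset.prod_inv_distrib]
  convert! h1 using 2
  funext k
  rw [lsum, Finsupp.sum, Finset.mul_sum]
  refine Finset.sum_congr rfl fun m _ => ?_
  rw [mul_pow, ← zpow_natCast (b ^ m), ← zpow_mul, ← zpow_natCast b k, ← zpow_mul, mul_comm (k : ℤ)]
  ring

theorem tendsto_completeSymm {ι : Type*} {l : Filter ι} {P : ι → ℕ → ℂ} {P' : ℕ → ℂ}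
    (h : ∀ k, 1 ≤ k → Filter.Tendsto (fun i => P i k) l (𝓝 (P' k))) (n : ℕ) :
    Filter.Tendsto (fun i => completeSymm (P i) n) l (𝓝 (completeSymm P' n)) := by
  induction n using Nat.strong_induction_on with
  | _ n ih =>
    cases n with
    | zero => simp only [completeSymm_zero]; exact tendsto_const_nhds
    | succ n =>
      simp only [completeSymm_succ]
      exact (tendsto_finsetSum _ fun k _ =>
        (h (k + 1) (by omega)).mul (ih (n - k) (by omega))).div_const _

/-! ### The MacMahon product -/

/-- `∏_{k ≥ 1} (1 - w b ^ k) ^ k` -/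
def macMahon (b w : ℂ) : ℂ := ∏' j : ℕ, (1 - w * b ^ (j + 1)) ^ (j + 1)

theorem norm_one_sub_pow_sub_one_le (u : ℂ) (n : ℕ) :
    ‖(1 - u) ^ n - 1‖ ≤ n * ‖u‖ * Real.exp (n * ‖u‖) := by
  have h := Finset.norm_prod_one_add_sub_one_le (Finset.range n) fun _ => -u
  simp only [Finset.prod_const, Finset.card_range, Finset.sum_const, norm_neg, nsmul_eq_mul,
    ← sub_eq_add_neg] at h
  set x := (n : ℝ) * ‖u‖
  have h1 := Real.add_one_le_exp (-x)
  have h2 := mul_le_mul_of_nonneg_right h1 (Real.exp_pos x).le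
  rw [← Real.exp_add, neg_add_cancel, Real.exp_zero] at h2
  linarith

theorem summable_succ_mul_pow {r : ℝ} (hr0 : 0 ≤ r) (hr : r < 1) :
    Summable fun j : ℕ => ((j : ℝ) + 1) * r ^ (j + 1) := by
  have h := summable_pow_mul_geometric_of_norm_lt_one (R := ℝ) 1
    (r := r) (by rwa [Real.norm_of_nonneg hr0])
  simpa using (summable_nat_add_iff 1).2 h

theorem exists_summable_bound {b : ℂ} (hb : ‖b‖ < 1) (R : ℝ) :
    ∃ u : ℕ → ℝ, Summable u ∧ ∀ j w, ‖w‖ ≤ R → ‖(1 - w * b ^ (j + 1)) ^ (j + 1) - 1‖ ≤ u j := by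
  have hs := summable_succ_mul_pow (norm_nonneg b) hb
  set S := ∑' j : ℕ, ((j : ℝ) + 1) * ‖b‖ ^ (j + 1) with hS
  refine ⟨fun j => (((j : ℝ) + 1) * ‖b‖ ^ (j + 1)) * (R * Real.exp (R * S)),
    hs.mul_right _, fun j w hw => ?_⟩
  have hR : 0 ≤ R := (norm_nonneg w).trans hw
  have h0 : ∀ j : ℕ, 0 ≤ ((j : ℝ) + 1) * ‖b‖ ^ (j + 1) := fun j => by positivity
  have h1 : ((j : ℝ) + 1) * ‖b‖ ^ (j + 1) ≤ S := hs.le_tsum j fun i _ => h0 i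
  have h2 : ((j + 1 : ℕ) : ℝ) * ‖w * b ^ (j + 1)‖ ≤ R * (((j : ℝ) + 1) * ‖b‖ ^ (j + 1)) := by
    rw [norm_mul, norm_pow, Nat.cast_add_one, mul_left_comm]
    exact mul_le_mul_of_nonneg_right hw (h0 j)
  refine (norm_one_sub_pow_sub_one_le _ _).trans ?_
  have h3 : R * (((j : ℝ) + 1) * ‖b‖ ^ (j + 1)) ≤ R * S := mul_le_mul_of_nonneg_left h1 hR
  calc _ ≤ (R * (((j : ℝ) + 1) * ‖b‖ ^ (j + 1))) * Real.exp (R * S) :=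
        mul_le_mul h2 (Real.exp_le_exp.2 (h2.trans h3)) (Real.exp_pos _).le
          (mul_nonneg hR (h0 j))
    _ = _ := by ring

theorem summable_norm_macMahon {b : ℂ} (hb : ‖b‖ < 1) (w : ℂ) :
    Summable fun j : ℕ => ‖(1 - w * b ^ (j + 1)) ^ (j + 1) - 1‖ := by
  obtain ⟨u, hu, h⟩ := exists_summable_bound hb ‖w‖
  exact hu.of_nonneg_of_le (fun _ => norm_nonneg _) fun j => h j w le_rfl

theorem multipliable_macMahon {b : ℂ} (hb : ‖b‖ < 1) (w : ℂ) :
    Multipliable fun j : ℕ => (1 - w * b ^ (j + 1)) ^ (j + 1) := by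
  have h := multipliable_one_add_of_summable (summable_norm_macMahon hb w)
  simpa only [add_sub_cancel] using h

theorem macMahon_ne_zero {b : ℂ} (hb : ‖b‖ < 1) {w : ℂ} (hw : ∀ j : ℕ, w * b ^ (j + 1) ≠ 1) :
    macMahon b w ≠ 0 := by
  have h := tprod_one_add_ne_zero_of_summable
    (f := fun j : ℕ => (1 - w * b ^ (j + 1)) ^ (j + 1) - 1) (fun j => by
      rw [add_sub_cancel]
      exact pow_ne_zero _ (sub_ne_zero.2 (hw j).symm)) (summable_norm_macMahon hb w)
  simp only [add_sub_cancel] at h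
  exact h

theorem differentiable_macMahon {b : ℂ} (hb : ‖b‖ < 1) : Differentiable ℂ (macMahon b) := by
  intro w
  obtain ⟨u, hu, h⟩ := exists_summable_bound hb (‖w‖ + 1)
  have hopen : IsOpen (Metric.ball (0 : ℂ) (‖w‖ + 1)) := Metric.isOpen_ball
  have hd : ∀ j : ℕ, Differentiable ℂ fun w : ℂ => (1 - w * b ^ (j + 1)) ^ (j + 1) - 1 := fun j =>
    (((differentiable_const _).sub (differentiable_id.mul_const _)).pow _).sub_const _
  have h1 := Summable.hasProdLocallyUniformlyOn_nat_one_add hopen hu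
    (f := fun (j : ℕ) (w : ℂ) => (1 - w * b ^ (j + 1)) ^ (j + 1) - 1)
    (Filter.Eventually.of_forall fun j w hw => h j w (by
      rw [mem_ball_zero_iff] at hw
      exact hw.le)) fun j => (hd j).continuous.continuousOn
  have h2 := TendstoLocallyUniformlyOn.differentiableOn
    (hasProdLocallyUniformlyOn_iff_tendstoLocallyUniformlyOn.1 h1)
    (Filter.Eventually.of_forall fun s =>
      (Differentiable.fun_finsetProd fun j _ => (hd j).const_add 1).differentiableOn) hopen
  have h3 := h2.differentiableAt (hopen.mem_nhds (show w ∈ Metric.ball (0 : ℂ) (‖w‖ + 1) by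
    rw [mem_ball_zero_iff]
    linarith))
  simp only [add_sub_cancel] at h3
  exact h3

theorem norm_mul_pow_succ_lt_one {b w : ℂ} (hb : ‖b‖ < 1) (hw : ‖w * b‖ < 1) (j : ℕ) :
    ‖w * b ^ (j + 1)‖ < 1 := by
  rw [pow_succ', ← mul_assoc, norm_mul, norm_pow]
  exact (mul_le_of_le_one_right (norm_nonneg _) (pow_le_one₀ (norm_nonneg b) hb.le)).trans_lt hw

theorem hasSum_completeSymm_macMahon_trunc {b w : ℂ} (hb : ‖b‖ < 1) (hw : ‖w * b‖ < 1) (J : ℕ) :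
    HasSum (completeSymm fun k => ∑ j ∈ Finset.range J, ((j + 1 : ℕ) : ℂ) * (w * b ^ (j + 1)) ^ k)
      (∏ j ∈ Finset.range J, (1 - w * b ^ (j + 1)) ^ (j + 1))⁻¹ := by
  rw [← Finset.prod_inv_distrib]
  refine hasSum_completeSymm_sum _ fun j _ => ?_
  have h := hasSum_completeSymm_intCast_mul_pow (norm_mul_pow_succ_lt_one hb hw j) ((j + 1 : ℕ) : ℤ)
  simpa only [zpow_natCast, Int.cast_natCast] using h

theorem hasSum_succ_mul_pow {x : ℂ} (hx : ‖x‖ < 1) :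
    HasSum (fun j : ℕ => ((j + 1 : ℕ) : ℂ) * x ^ (j + 1)) (x / (1 - x) ^ 2) := by
  have h := hasSum_coe_mul_geometric_of_norm_lt_one hx
  have h1 := (hasSum_nat_add_iff' (f := fun n : ℕ => (n : ℂ) * x ^ n) 1).2 h
  simpa using h1

theorem tendsto_powerSum_macMahon {b : ℂ} (hb : ‖b‖ < 1) (w : ℂ) {k : ℕ} (hk : 1 ≤ k) :
    Filter.Tendsto (fun J : ℕ => ∑ j ∈ Finset.range J, ((j + 1 : ℕ) : ℂ) * (w * b ^ (j + 1)) ^ k)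
      Filter.atTop (𝓝 (w ^ k * (b ^ k / (1 - b ^ k) ^ 2))) := by
  have h1 : ‖b ^ k‖ < 1 := by
    rw [norm_pow]
    exact pow_lt_one₀ (norm_nonneg _) hb (by omega)
  have h := ((hasSum_succ_mul_pow h1).mul_left (w ^ k)).tendsto_sum_nat
  convert! h using 2 with J
  refine Finset.sum_congr rfl fun j _ => ?_
  rw [mul_pow, pow_right_comm]
  ring

theorem tendsto_prod_macMahon {b : ℂ} (hb : ‖b‖ < 1) {w : ℂ} (hw : ‖w * b‖ < 1) :
    Filter.Tendsto (fun J : ℕ => (∏ j ∈ Finset.range J, (1 - w * b ^ (j + 1)) ^ (j + 1))⁻¹)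
      Filter.atTop (𝓝 (macMahon b w)⁻¹) :=
  ((multipliable_macMahon hb w).hasProd.tendsto_prod_nat).inv₀ (macMahon_ne_zero hb fun j h => by
    have := norm_mul_pow_succ_lt_one hb hw j
    rw [h, norm_one] at this
    exact lt_irrefl _ this)

theorem summable_norm_completeSymm_macMahon {r t : ℝ} (hr0 : 0 ≤ r) (hr : r < 1) (ht0 : 0 ≤ t)
    (ht : t * r < 1) :
    Summable fun n =>
      ‖completeSymm (fun k => (t : ℂ) ^ k * ((r : ℂ) ^ k / (1 - (r : ℂ) ^ k) ^ 2)) n‖ := by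
  have hb : ‖(r : ℂ)‖ < 1 := by rwa [Complex.norm_real, Real.norm_of_nonneg hr0]
  have hw : ‖(t : ℂ) * r‖ < 1 := by
    rwa [norm_mul, Complex.norm_real, Complex.norm_real, Real.norm_of_nonneg hr0,
      Real.norm_of_nonneg ht0]
  obtain ⟨B, hB⟩ := (tendsto_prod_macMahon hb hw).norm.bddAbove_range
  refine summable_of_sum_range_le (c := B) (fun _ => norm_nonneg _) fun D => ?_
  refine le_of_tendsto (tendsto_finsetSum (Finset.range D) fun n _ =>
    (tendsto_completeSymm (fun k hk => tendsto_powerSum_macMahon hb (t : ℂ) hk) n).norm)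
    (Filter.Eventually.of_forall fun J => ?_)
  refine le_trans ?_ (hB ⟨J, rfl⟩)
  have e : (fun k => ∑ j ∈ Finset.range J, ((j + 1 : ℕ) : ℂ) * ((t : ℂ) * (r : ℂ) ^ (j + 1)) ^ k) =
      fun k => ((∑ j ∈ Finset.range J, ((j : ℝ) + 1) * (t * r ^ (j + 1)) ^ k : ℝ) : ℂ) := by
    funext k
    push_cast
    rfl
  have h1 := hasSum_completeSymm_macMahon_trunc hb hw J
  rw [e] at h1
  choose x hx0 hx using exists_completeSymm_ofReal
    (R := fun k => ∑ j ∈ Finset.range J, ((j : ℝ) + 1) * (t * r ^ (j + 1)) ^ k)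
    fun k _ => Finset.sum_nonneg fun j _ => by positivity
  have h2 := Complex.hasSum_re h1
  simp only [hx, Complex.ofReal_re] at h2
  simp only [e, hx, Complex.norm_real, Real.norm_of_nonneg (hx0 _)]
  exact (sum_le_hasSum _ (fun n _ => hx0 n) h2).trans (Complex.re_le_norm _)

theorem hasSum_completeSymm_macMahon {b w : ℂ} (hb : ‖b‖ < 1) (hw : ‖w * b‖ < 1) :
    HasSum (completeSymm fun k => w ^ k * (b ^ k / (1 - b ^ k) ^ 2)) (macMahon b w)⁻¹ := by
  have hs := summable_norm_completeSymm_macMahon (norm_nonneg b) hb (norm_nonneg w)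
    (by rwa [← norm_mul])
  have hk1 : ∀ k, 1 ≤ k → ‖b‖ ^ k < 1 := fun k hk =>
    pow_lt_one₀ (norm_nonneg _) hb (by omega)
  have hR : ∀ k, (‖w‖ : ℂ) ^ k * ((‖b‖ : ℂ) ^ k / (1 - (‖b‖ : ℂ) ^ k) ^ 2) =
      ((‖w‖ ^ k * (‖b‖ ^ k / (1 - ‖b‖ ^ k) ^ 2) : ℝ) : ℂ) := fun k => by push_cast; rfl
  simp only [hR] at hs
  have hle : ∀ J k, 1 ≤ k →
      ‖∑ j ∈ Finset.range J, ((j + 1 : ℕ) : ℂ) * (w * b ^ (j + 1)) ^ k‖ ≤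
        ‖w‖ ^ k * (‖b‖ ^ k / (1 - ‖b‖ ^ k) ^ 2) := by
    intro J k hk
    have h1 : HasSum (fun j : ℕ => ((j : ℝ) + 1) * (‖w‖ * ‖b‖ ^ (j + 1)) ^ k)
        (‖w‖ ^ k * (‖b‖ ^ k / (1 - ‖b‖ ^ k) ^ 2)) := by
      have h2 := hasSum_succ_mul_pow (x := ((‖b‖ ^ k : ℝ) : ℂ)) (by
        rw [Complex.norm_real, Real.norm_of_nonneg (by positivity)]
        exact hk1 k hk)
      have h3 : HasSum (fun j : ℕ => ((j : ℝ) + 1) * (‖b‖ ^ k) ^ (j + 1))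
          (‖b‖ ^ k / (1 - ‖b‖ ^ k) ^ 2) := by
        rw [← Complex.hasSum_ofReal]
        push_cast at h2 ⊢
        exact h2
      convert! h3.mul_left (‖w‖ ^ k) using 2 with j
      rw [mul_pow, pow_right_comm]
      ring
    refine (norm_sum_le _ _).trans (le_trans (le_of_eq ?_)
      (sum_le_hasSum (Finset.range J) (fun j _ => by positivity) h1))
    refine Finset.sum_congr rfl fun j _ => ?_
    rw [norm_mul, norm_pow, norm_mul, norm_pow, Complex.norm_natCast]
    push_cast
    rfl
  have hsum : Summable (completeSymm fun k => w ^ k * (b ^ k / (1 - b ^ k) ^ 2)) := by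
    refine Summable.of_norm_bounded hs fun n => norm_completeSymm_le_norm (fun k hk => ?_) n
    exact le_of_tendsto (tendsto_powerSum_macMahon hb w hk).norm
      (Filter.Eventually.of_forall fun J => hle J k hk)
  have h1 := tendsto_tsum_of_dominated_convergence hs
    (fun n => tendsto_completeSymm (fun k hk => tendsto_powerSum_macMahon hb w hk) n)
    (Filter.Eventually.of_forall fun J n => norm_completeSymm_le_norm (hle J) n)
  simp only [(hasSum_completeSymm_macMahon_trunc hb hw _).tsum_eq] at h1
  rw [tendsto_nhds_unique (tendsto_prod_macMahon hb hw) h1]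
  exact hsum.hasSum

/-! ### Summation over partitions -/

theorem card_diagramsOfCard_le (d : ℕ) : (diagramsOfCard d).card ≤ 2 ^ d := by
  have hsum : ∀ ν : YoungDiagram, ν.rowLens.sum = ν.card := fun ν =>
    (card_eq_sum_rowLen (le_refl (ν.colLen 0))).symm
  let f : diagramsOfCard d → Composition d := fun ν =>
    ⟨ν.1.rowLens, fun {x} hx => ν.1.pos_of_mem_rowLens x hx,
      (hsum ν.1).trans (mem_diagramsOfCard.1 ν.2)⟩
  have hf : Function.Injective f := by
    rintro ⟨μ, hμ⟩ ⟨ν, hν⟩ h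
    have h1 : μ.rowLens = ν.rowLens := congrArg Composition.blocks h
    apply Subtype.ext
    exact YoungDiagram.equivListRowLens.injective (Subtype.ext h1)
  have h := Fintype.card_le_of_injective f hf
  rw [Fintype.card_coe, composition_card] at h
  exact h.trans (Nat.pow_le_pow_right (by norm_num) (Nat.sub_le d 1))

/-- Partitions, sorted by their size. -/
def sigmaCardEquiv : (Σ d : ℕ, diagramsOfCard d) ≃ YoungDiagram where
  toFun x := x.2.1
  invFun ν := ⟨ν.card, ν, mem_diagramsOfCard.2 rfl⟩
  left_inv := by
    rintro ⟨d, ν, h⟩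
    obtain rfl := mem_diagramsOfCard.1 h
    rfl
  right_inv _ := rfl

theorem hasSum_sum_diagramsOfCard {f : YoungDiagram → ℂ} {a : ℂ} (h : HasSum f a) :
    HasSum (fun d => ∑ ν ∈ diagramsOfCard d, f ν) a :=
  ((Equiv.hasSum_iff sigmaCardEquiv).2 h).sigma fun d => (diagramsOfCard d).hasSum f

theorem summable_of_sum_diagramsOfCard {f : YoungDiagram → ℝ} (hf : ∀ ν, 0 ≤ f ν)
    (h : Summable fun d => ∑ ν ∈ diagramsOfCard d, f ν) : Summable f := by
  rw [← Equiv.summable_iff sigmaCardEquiv,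
    summable_sigma_of_nonneg (f := f ∘ sigmaCardEquiv) fun x => hf _]
  refine ⟨fun d => (diagramsOfCard d).summable f, ?_⟩
  convert! h using 2 with d
  exact ((diagramsOfCard d).hasSum f).tsum_eq

theorem summable_pow_card {θ : ℝ} (h0 : 0 ≤ θ) (h1 : 2 * θ < 1) :
    Summable fun ν : YoungDiagram => θ ^ ν.card := by
  refine summable_of_sum_diagramsOfCard (fun ν => pow_nonneg h0 _) ?_
  refine Summable.of_nonneg_of_le (fun d => Finset.sum_nonneg fun ν _ => pow_nonneg h0 _)
    (fun d => ?_) (summable_geometric_of_lt_one (by linarith) h1)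
  rw [Finset.sum_congr rfl fun ν hν => by rw [mem_diagramsOfCard.1 hν], Finset.sum_const,
    nsmul_eq_mul, mul_pow]
  exact mul_le_mul_of_nonneg_right (by exact_mod_cast card_diagramsOfCard_le d) (pow_nonneg h0 _)

theorem summable_prod_pow_card {θ : ℝ} (h0 : 0 ≤ θ) (h1 : 2 * θ < 1) (n : ℕ) :
    Summable fun ν : Fin n → YoungDiagram => ∏ t, θ ^ (ν t).card := by
  induction n with
  | zero => exact (hasSum_fintype _).summable
  | succ n ih =>
    rw [← Equiv.summable_iff (Fin.consEquiv fun _ => YoungDiagram)]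
    have h := (summable_pow_card h0 h1).mul_of_nonneg ih (fun _ => pow_nonneg h0 _)
      fun _ => Finset.prod_nonneg fun _ _ => pow_nonneg h0 _
    convert! h using 2 with x
    simp [Fin.prod_univ_succ, Fin.consEquiv]

theorem hasSum_schur_mul_skewSchur {P P' : ℕ → ℂ} {χ : YoungDiagram} {h : ℂ}
    (hs : Summable fun ν => schur P ν * skewSchur P' ν χ)
    (hh : HasSum (completeSymm fun k => P k * P' k) h) :
    HasSum (fun ν => schur P ν * skewSchur P' ν χ) (h * schur P χ) := by
  have h1 := hasSum_sum_diagramsOfCard hs.hasSum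
  simp only [sum_schur_mul_skewSchur_of_card] at h1
  have h2 : HasSum (fun d => if χ.card ≤ d then
      completeSymm (fun k => P k * P' k) (d - χ.card) * schur P χ else 0) (h * schur P χ) := by
    rw [← hasSum_nat_add_iff' χ.card]
    have h3 : ∑ i ∈ Finset.range χ.card, (if χ.card ≤ i then
        completeSymm (fun k => P k * P' k) (i - χ.card) * schur P χ else 0) = 0 :=
      Finset.sum_eq_zero fun i hi => if_neg (by
        have := Finset.mem_range.1 hi
        omega)
    rw [h3, sub_zero]
    simpa using hh.mul_right (schur P χ)
  rw [h2.unique h1]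
  exact hs.hasSum

/-! ### Chains of skew Schur functions -/

/-- The term, indexed by `ν`, of the sum over chains of partitions
`χ ⊆ ν_0 ⊇ χ_0 ⊆ ν_1 ⊇ χ_1 ⊆ …`, the sum over the `χ_t` being carried out. -/
def chainTerm : (n : ℕ) → (X Y : ℕ → ℕ → ℂ) → (Q : ℕ → ℂ) → (Fin n → YoungDiagram) →
    YoungDiagram → ℂ
  | 0, _, _, _, _, χ => schur (fun _ => 0) χ
  | n + 1, X, Y, Q, ν, χ =>
    Q 0 ^ (ν 0).card * skewSchur (X 0) (ν 0) χ *
      ∑ χ' ∈ subdiagrams (ν 0), skewSchur (Y 0) (ν 0) χ' *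
        chainTerm n (fun t => X (t + 1)) (fun t => Y (t + 1)) (fun t => Q (t + 1)) (Fin.tail ν) χ'

/-- The power sums accumulated along a chain. -/
def chainPowerSum : (n : ℕ) → (Y : ℕ → ℕ → ℂ) → (Q : ℕ → ℂ) → ℕ → ℂ
  | 0, _, _, _ => 0
  | n + 1, Y, Q, k =>
    Q 0 ^ k * (chainPowerSum n (fun t => Y (t + 1)) (fun t => Q (t + 1)) k + Y 0 k)

theorem chainPowerSum_eq (n : ℕ) (Y : ℕ → ℕ → ℂ) (Q : ℕ → ℂ) (k : ℕ) :
    chainPowerSum n Y Q k =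
      ∑ s ∈ Finset.range n, (∏ t ∈ Finset.range (s + 1), Q t) ^ k * Y s k := by
  induction n generalizing Y Q with
  | zero => rfl
  | succ n ih =>
    rw [chainPowerSum, ih, Finset.sum_range_succ', mul_add, Finset.mul_sum, Finset.prod_range_one]
    congr 1
    refine Finset.sum_congr rfl fun s _ => ?_
    rw [Finset.prod_range_succ' _ (s + 1), mul_pow]
    ring

theorem norm_chainTerm_le {R ε : ℝ} (hR : 1 ≤ R) (hε : 0 ≤ ε) (n : ℕ) {X Y : ℕ → ℕ → ℂ} {Q : ℕ → ℂ}
    (hX : ∀ t, ∀ k, 1 ≤ k → ‖X t k‖ ≤ R ^ k) (hY : ∀ t, ∀ k, 1 ≤ k → ‖Y t k‖ ≤ R ^ k)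
    (hQ : ∀ t, ‖Q t‖ ≤ ε) (ν : Fin n → YoungDiagram) (χ : YoungDiagram) :
    ‖chainTerm n X Y Q ν χ‖ ≤ ∏ t, (ε * (32 * R ^ 2)) ^ (ν t).card := by
  induction n generalizing X Y Q χ with
  | zero =>
    rw [chainTerm]
    by_cases h : χ = ⊥
    · simp [h, schur_bot]
    · simp [schur_zero_fun h]
  | succ n ih =>
    rw [chainTerm, norm_mul, norm_mul, norm_pow, Fin.prod_univ_succ]
    set B := ∏ t : Fin n, (ε * (32 * R ^ 2)) ^ (ν t.succ).card with hB
    have hB0 : 0 ≤ B := Finset.prod_nonneg fun _ _ => by positivity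
    set d := (ν 0).card
    have h1 : ‖∑ χ' ∈ subdiagrams (ν 0), skewSchur (Y 0) (ν 0) χ' *
        chainTerm n (fun t => X (t + 1)) (fun t => Y (t + 1)) (fun t => Q (t + 1))
          (Fin.tail ν) χ'‖ ≤ 2 ^ d * ((4 * R) ^ d * B) := by
      have h2 : ((subdiagrams (ν 0)).card : ℝ) ≤ 2 ^ d := by
        exact_mod_cast card_diagramsIn_le (ν 0).cells
      refine (norm_sum_le_of_le (n := fun _ => (4 * R) ^ d * B) _ fun χ' _ => ?_).trans ?_
      · rw [norm_mul]
        exact mul_le_mul (norm_skewSchur_le hR (hY 0) _ _)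
          (ih (fun t => hX (t + 1)) (fun t => hY (t + 1)) (fun t => hQ (t + 1)) (Fin.tail ν) χ')
          (norm_nonneg _) (by positivity)
      · rw [Finset.sum_const, nsmul_eq_mul]
        exact mul_le_mul_of_nonneg_right h2 (by positivity)
    calc _ ≤ ε ^ d * (4 * R) ^ d * (2 ^ d * ((4 * R) ^ d * B)) := by
          refine mul_le_mul (mul_le_mul (pow_le_pow_left₀ (norm_nonneg _) (hQ 0) _)
            (norm_skewSchur_le hR (hX 0) _ _) (norm_nonneg _) (by positivity)) h1
            (norm_nonneg _) (by positivity)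
      _ = (ε * (32 * R ^ 2)) ^ d * B := by
          rw [← mul_assoc, ← mul_assoc, ← mul_pow, ← mul_pow, ← mul_pow]
          congr 2
          ring

theorem hasSum_chainTerm {R ε : ℝ} (hR : 1 ≤ R) (hε : 0 ≤ ε) (hεR : 2 * (ε * (32 * R ^ 2)) < 1)
    (n : ℕ) {X Y : ℕ → ℕ → ℂ} {Q : ℕ → ℂ}
    (hX : ∀ t, ∀ k, 1 ≤ k → ‖X t k‖ ≤ R ^ k) (hY : ∀ t, ∀ k, 1 ≤ k → ‖Y t k‖ ≤ R ^ k)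
    (hQ : ∀ t, ‖Q t‖ ≤ ε) {g : ℕ → ℕ → ℂ}
    (hg : ∀ r d, r + d < n → HasSum (completeSymm fun k =>
      (∏ t ∈ Finset.range (d + 1), Q (r + t)) ^ k * (X r k * Y (r + d) k)) (g r d))
    (χ : YoungDiagram) :
    HasSum (fun ν => chainTerm n X Y Q ν χ)
      ((∏ r ∈ Finset.range n, ∏ d ∈ Finset.range (n - r), g r d) *
        schur (chainPowerSum n Y Q) χ) := by
  induction n generalizing X Y Q g χ with
  | zero =>
    rw [Finset.range_zero, Finset.prod_empty, one_mul]
    exact hasSum_unique _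
  | succ n ih =>
    have hsum : Summable fun ν => chainTerm (n + 1) X Y Q ν χ :=
      Summable.of_norm_bounded (summable_prod_pow_card (by positivity) hεR (n + 1))
        fun ν => norm_chainTerm_le hR hε (n + 1) hX hY hQ ν χ
    set G := ∏ r ∈ Finset.range n, ∏ d ∈ Finset.range (n - r), g (r + 1) d with hG
    have ih' := ih (X := fun t => X (t + 1)) (Y := fun t => Y (t + 1)) (Q := fun t => Q (t + 1))
      (g := fun r d => g (r + 1) d) (fun t => hX (t + 1)) (fun t => hY (t + 1))
      (fun t => hQ (t + 1)) fun r d hrd => by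
        have h := hg (r + 1) d (by omega)
        simpa only [add_right_comm _ 1] using h
    set Z := chainPowerSum n (fun t => Y (t + 1)) (fun t => Q (t + 1)) with hZ
    have hfib : ∀ ν0 : YoungDiagram, HasSum (fun ν : Fin n → YoungDiagram =>
        chainTerm (n + 1) X Y Q (Fin.cons ν0 ν : Fin (n + 1) → YoungDiagram) χ)
        (G * (schur (chainPowerSum (n + 1) Y Q) ν0 * skewSchur (X 0) ν0 χ)) := by
      intro ν0
      have h1 := hasSum_sum fun χ' (_ : χ' ∈ subdiagrams ν0) =>
        (ih' χ').mul_left (skewSchur (Y 0) ν0 χ')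
      have h2 := h1.mul_left (Q 0 ^ ν0.card * skewSchur (X 0) ν0 χ)
      have h3 : ∑ χ' ∈ subdiagrams ν0, skewSchur (Y 0) ν0 χ' * (G * schur Z χ') =
          G * schur (fun k => Z k + Y 0 k) ν0 := by
        rw [← sum_schur_mul_skewSchur, Finset.mul_sum]
        exact Finset.sum_congr rfl fun χ' _ => by ring
      rw [h3] at h2
      have h4 : schur (chainPowerSum (n + 1) Y Q) ν0 =
          Q 0 ^ ν0.card * schur (fun k => Z k + Y 0 k) ν0 := schur_scale (Q 0) _ ν0
      rw [h4]
      convert! h2 using 1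
      ring
    have hprod : HasSum (fun ν0 : YoungDiagram =>
        G * (schur (chainPowerSum (n + 1) Y Q) ν0 * skewSchur (X 0) ν0 χ))
        (∑' ν, chainTerm (n + 1) X Y Q ν χ) := by
      have h := (Equiv.hasSum_iff (Fin.consEquiv fun _ => YoungDiagram)).2 hsum.hasSum
      exact h.prod_fiberwise hfib
    have hh : HasSum (completeSymm fun k => chainPowerSum (n + 1) Y Q k * X 0 k)
        (∏ d ∈ Finset.range (n + 1), g 0 d) := by
      have h := hasSum_completeSymm_sum (Finset.range (n + 1)) fun d hd =>
        hg 0 d (by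
          have := Finset.mem_range.1 hd
          omega)
      convert! h using 2
      funext k
      rw [chainPowerSum_eq, Finset.sum_mul]
      refine Finset.sum_congr rfl fun d _ => ?_
      simp only [zero_add]
      ring
    have hval : ∏ r ∈ Finset.range (n + 1), ∏ d ∈ Finset.range (n + 1 - r), g r d =
        G * ∏ d ∈ Finset.range (n + 1), g 0 d := by
      rw [Finset.prod_range_succ']
      simp only [Nat.add_sub_add_right, Nat.sub_zero, hG]
    have hkey : HasSum (fun ν0 : YoungDiagram =>
        G * (schur (chainPowerSum (n + 1) Y Q) ν0 * skewSchur (X 0) ν0 χ))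
        (G * ((∏ d ∈ Finset.range (n + 1), g 0 d) * schur (chainPowerSum (n + 1) Y Q) χ)) := by
      by_cases hG0 : G = 0
      · simp only [hG0, zero_mul]
        exact hasSum_zero
      · refine (hasSum_schur_mul_skewSchur ?_ hh).mul_left G
        exact (summable_mul_left_iff hG0).1 hprod.summable
    rw [hval, mul_assoc, hkey.unique hprod]
    exact hsum.hasSum

theorem tsum_cons {n : ℕ} {f : (Fin (n + 1) → YoungDiagram) → ℂ}
    (hf : (Function.support f).Finite) :
    ∑' χ, f χ = ∑' χ0 : YoungDiagram, ∑' χ : Fin n → YoungDiagram,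
      f (Fin.cons χ0 χ : Fin (n + 1) → YoungDiagram) := by
  have h := (Equiv.summable_iff (Fin.consEquiv fun _ => YoungDiagram)).2
    (summable_of_hasFiniteSupport hf)
  rw [← Equiv.tsum_eq (Fin.consEquiv fun _ => YoungDiagram) f]
  exact h.tsum_prod

theorem finite_support_prod {n : ℕ} (P P' : Fin n → ℕ → ℂ) (ν ν' : Fin n → YoungDiagram) :
    (Function.support fun χ : Fin n → YoungDiagram =>
      ∏ t, (skewSchur (P t) (ν t) (χ t) * skewSchur (P' t) (ν' t) (χ t))).Finite := by
  refine (Set.Finite.pi' fun t => (subdiagrams (ν t)).finite_toSet).subset fun χ hχ t => ?_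
  rw [Finset.mem_coe, mem_subdiagrams]
  by_contra h
  exact hχ (Finset.prod_eq_zero (Finset.mem_univ t) (by rw [skewSchur_eq_zero _ h, zero_mul]))

theorem chainTerm_succ_eq (n : ℕ) (X Y : ℕ → ℕ → ℂ) (Q : ℕ → ℂ) (ν : Fin (n + 1) → YoungDiagram)
    (χ : YoungDiagram) :
    chainTerm (n + 1) X Y Q ν χ =
      (∏ t : Fin (n + 1), Q t ^ (ν t).card) * skewSchur (X 0) (ν 0) χ *
        schur (Y n) (ν (Fin.last n)) *
        ∑' χ' : Fin n → YoungDiagram, ∏ t : Fin n,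
          (skewSchur (Y t) (ν t.castSucc) (χ' t) *
            skewSchur (X (t + 1)) (ν t.succ) (χ' t)) := by
  induction n generalizing X Y Q χ with
  | zero =>
    rw [chainTerm, Finset.sum_eq_single ⊥ (fun χ' _ h => by
        rw [chainTerm, schur_zero_fun h, mul_zero])
      fun h => absurd (mem_subdiagrams.2 bot_le) h]
    simp [chainTerm, schur_bot, show schur (Y 0) (ν 0) = skewSchur (Y 0) (ν 0) ⊥ from rfl]
  | succ n ih =>
    rw [chainTerm, tsum_cons (finite_support_prod (fun t : Fin (n + 1) => Y t)
      (fun t => X (t + 1)) _ _), tsum_eq_sum (s := subdiagrams (ν 0)) ?_]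
    · rw [Fin.prod_univ_succ, Finset.mul_sum, Finset.mul_sum]
      refine Finset.sum_congr rfl fun χ0 _ => ?_
      rw [ih]
      simp only [Fin.prod_univ_succ, Fin.cons_zero, Fin.cons_succ]
      rw [tsum_mul_left]
      simp only [Fin.tail, Fin.val_zero, Fin.val_succ, Fin.castSucc_zero, Fin.succ_castSucc,
        Fin.succ_last, zero_add]
      ring
    · intro χ0 h
      rw [mem_subdiagrams] at h
      simp only [Fin.prod_univ_succ, Fin.cons_zero]
      simp only [Fin.val_zero, Fin.castSucc_zero, skewSchur_eq_zero _ h, zero_mul, tsum_zero]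

/-! ### The fibre amplitude -/

/-- `∏_{k ≥ 1} (1 - w b ^ k) ^ (-k) ∏_m (1 - w b ^ m) ^ (-D_m)`, where `∑_m D_m T ^ m` is the
character of the pair `(μ, ν)`. -/
def pairFactor (b : ℂ) (μ ν : YoungDiagram) (w : ℂ) : ℂ :=
  (macMahon b w)⁻¹ * (lprod (fun m => 1 - w * b ^ m) (pairPoly μ ν))⁻¹

theorem hasSum_completeSymm_pairFactor {b : ℂ} (hb0 : b ≠ 0) (hb : ‖b‖ < 1) (μ ν : YoungDiagram)
    {w : ℂ} (hw : ‖w * b‖ < 1) (h : ∀ m ∈ (pairPoly μ ν).coeff.support, ‖w * b ^ m‖ < 1) :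
    HasSum (completeSymm fun k =>
      w ^ k * (powerSumShiftedRho b μ k * powerSumShiftedRho b ν.transpose k))
      (pairFactor b μ ν w) := by
  have h1 := hasSum_completeSymm_add (hasSum_completeSymm_macMahon hb hw)
    (hasSum_completeSymm_lsum _ h)
  convert! h1 using 1
  funext n
  refine completeSymm_congr fun k hk _ => ?_
  rw [powerSumShiftedRho_mul_transpose hb0 hb _ _ hk, mul_add]

theorem eventually_hasSum_completeSymm_pairFactor {b : ℂ} (hb0 : b ≠ 0) (hb : ‖b‖ < 1)
    (μ ν : YoungDiagram) :
    ∀ᶠ w in 𝓝 (0 : ℂ), HasSum (completeSymm fun k =>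
      w ^ k * (powerSumShiftedRho b μ k * powerSumShiftedRho b ν.transpose k))
      (pairFactor b μ ν w) := by
  have h : ∀ c : ℂ, ∀ᶠ w in 𝓝 (0 : ℂ), ‖w * c‖ < 1 := fun c => by
    have h1 : Filter.Tendsto (fun w : ℂ => ‖w * c‖) (𝓝 0) (𝓝 ‖(0 : ℂ) * c‖) :=
      ((continuous_id.mul continuous_const).norm).tendsto 0
    exact h1.eventually_lt_const (by simp)
  filter_upwards [h b, (Filter.eventually_all_finset (pairPoly μ ν).coeff.support).2
    fun m _ => h (b ^ m)] with w h1 h2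
  exact hasSum_completeSymm_pairFactor hb0 hb μ ν h1 h2

theorem meromorphicAt_pairFactor {b : ℂ} (hb : ‖b‖ < 1) (μ ν : YoungDiagram) {w : ℂ → ℂ} {z : ℂ}
    (hw : AnalyticAt ℂ w z) : MeromorphicAt (fun z => pairFactor b μ ν (w z)) z := by
  have h1 : AnalyticAt ℂ (fun z => macMahon b (w z)) z :=
    ((differentiable_macMahon hb).analyticAt (w z)).comp hw
  refine h1.meromorphicAt.inv.mul (MeromorphicAt.inv ?_)
  simp only [lprod, Finsupp.prod]
  exact MeromorphicAt.fun_prod fun m _ => ((analyticAt_const.sub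
    (hw.mul analyticAt_const)).meromorphicAt).zpow _

theorem analyticAt_pairFactor {b : ℂ} (hb : ‖b‖ < 1) (μ ν : YoungDiagram) {w : ℂ → ℂ} {z : ℂ}
    (hw : AnalyticAt ℂ w z) (h : ∀ m : ℤ, w z * b ^ m ≠ 1) :
    AnalyticAt ℂ (fun z => pairFactor b μ ν (w z)) z := by
  have h1 : AnalyticAt ℂ (fun z => macMahon b (w z)) z :=
    ((differentiable_macMahon hb).analyticAt (w z)).comp hw
  have h2 : ∀ m : ℤ, 1 - w z * b ^ m ≠ 0 := fun m => sub_ne_zero.2 (h m).symm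
  refine (h1.inv (macMahon_ne_zero hb fun j => ?_)).mul (AnalyticAt.inv ?_ (lprod_ne_zero h2 _))
  · exact_mod_cast h (j + 1 : ℕ)
  · simp only [lprod, Finsupp.prod]
    exact Finset.analyticAt_fun_prod _ fun m _ =>
      (analyticAt_const.sub (hw.mul analyticAt_const)).zpow (h2 m)

theorem exists_norm_powerSumShiftedRho_le_of_finset {b : ℂ} (hb0 : b ≠ 0) (hb : ‖b‖ < 1)
    (S : Finset YoungDiagram) :
    ∃ R : ℝ, 1 ≤ R ∧ ∀ μ ∈ S, ∀ k, 1 ≤ k → ‖powerSumShiftedRho b μ k‖ ≤ R ^ k := by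
  classical
  induction S using Finset.induction_on with
  | empty => exact ⟨1, le_rfl, by simp⟩
  | insert μ S _ ih =>
    obtain ⟨R, hR, h⟩ := ih
    obtain ⟨R', hR', h'⟩ := exists_norm_powerSumShiftedRho_le hb0 hb μ
    refine ⟨max R R', hR.trans (le_max_left _ _), fun ν hν k hk => ?_⟩
    rcases Finset.mem_insert.1 hν with rfl | hν
    · exact (h' k hk).trans (pow_le_pow_left₀ (by linarith) (le_max_right _ _) _)
    · exact (h ν hν k hk).trans (pow_le_pow_left₀ (by linarith) (le_max_left _ _) _)

/-- The extension of a finite sequence to `ℕ` by a constant. -/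
def extendBy {α : Type*} {N : ℕ} (d : α) (f : Fin N → α) (t : ℕ) : α :=
  if h : t < N then f ⟨t, h⟩ else d

theorem extendBy_val {α : Type*} {N : ℕ} (d : α) (f : Fin N → α) (t : Fin N) :
    extendBy d f t = f t := dif_pos t.isLt

theorem extendBy_of_lt {α : Type*} {N : ℕ} (d : α) (f : Fin N → α) {t : ℕ} (h : t < N) :
    extendBy d f t = f ⟨t, h⟩ := dif_pos h

theorem fibreTerm_eq_chainTerm {n : ℕ} (hN : 2 ≤ n + 2) (b : ℂ) (QF : Fin (n + 2 - 1) → ℂ)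
    (lam : Fin (n + 2) → YoungDiagram) (ν : Fin (n + 2 - 1) → YoungDiagram) :
    fibreTerm hN b QF lam ν =
      chainTerm (n + 1) (fun t => powerSumShiftedRho b (extendBy ⊥ lam t))
        (fun t => powerSumShiftedRho b (extendBy ⊥ lam (t + 1)).transpose)
        (extendBy 0 QF) ν ⊥ := by
  rw [chainTerm_succ_eq, fibreTerm]
  have h1 : ∏ t : Fin (n + 1), extendBy 0 QF t ^ (ν t).card = ∏ t : Fin (n + 2 - 1), QF t ^ (ν t).card :=
    Finset.prod_congr rfl fun t _ => by
      congr 1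
      exact extendBy_val (N := n + 2 - 1) 0 QF t
  rw [h1, extendBy_of_lt (N := n + 2) ⊥ lam (by omega : 0 < n + 2),
    extendBy_of_lt (N := n + 2) ⊥ lam (by omega : n + 1 < n + 2)]
  have h2 : ∀ (χ : Fin n → YoungDiagram) (t : Fin n),
      skewSchur (powerSumShiftedRho b (extendBy ⊥ lam (t + 1)).transpose) (ν t.castSucc) (χ t) *
        skewSchur (powerSumShiftedRho b (extendBy ⊥ lam (t + 1))) (ν t.succ) (χ t) =
      skewSchurShiftedRho b (lam ⟨t.val + 1, by omega⟩).transpose (ν ⟨t.val, by omega⟩) (χ t) *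
        skewSchurShiftedRho b (lam ⟨t.val + 1, by omega⟩) (ν ⟨t.val + 1, by omega⟩) (χ t) := by
    intro χ t
    rw [extendBy_of_lt (N := n + 2) ⊥ lam (by omega : t.val + 1 < n + 2)]
    rfl
  simp only [h2]
  rfl

theorem fibreProd_eq {N : ℕ} (QF : Fin (N - 1) → ℂ) {r s : Fin N} {d : ℕ}
    (h : r.val + d + 1 = s.val) :
    fibreProd QF r s = ∏ t ∈ Finset.range (d + 1), extendBy 0 QF (r.val + t) := by
  have hs := s.isLt
  rw [fibreProd]
  refine Finset.prod_bij' (fun t _ => t.val - r.val)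
    (fun t ht => ⟨r.val + t, by
      have := Finset.mem_range.1 ht
      omega⟩) ?_ ?_ ?_ ?_ ?_
  · intro t ht
    simp only [Finset.mem_filter, Finset.mem_univ, true_and, Finset.mem_range] at ht ⊢
    omega
  · intro t ht
    simp only [Finset.mem_filter, Finset.mem_univ, true_and, Finset.mem_range] at ht ⊢
    omega
  · intro t ht
    simp only [Finset.mem_filter, Finset.mem_univ, true_and] at ht
    apply Fin.ext
    simp only
    omega
  · intro t _
    simp
  · intro t ht
    simp only [Finset.mem_filter, Finset.mem_univ, true_and] at ht
    rw [show r.val + (t.val - r.val) = t.val by omega, extendBy_val]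

theorem prod_range_eq_prod_Fin_lt {n : ℕ} (g : ℕ → ℕ → ℂ) (f : Fin (n + 1) → Fin (n + 1) → ℂ)
    (h : ∀ (r s : Fin (n + 1)) (d : ℕ), r.val + d + 1 = s.val → f r s = g r d) :
    ∏ r ∈ Finset.range n, ∏ d ∈ Finset.range (n - r), g r d =
      ∏ r : Fin (n + 1), ∏ s ∈ Finset.univ.filter (fun s => r < s), f r s := by
  have h1 : ∀ r : Fin (n + 1), ∏ s ∈ Finset.univ.filter (fun s => r < s), f r s =
      ∏ d ∈ Finset.range (n - r), g r d := by
    intro r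
    refine Finset.prod_bij' (fun s _ => s.val - r.val - 1)
      (fun d hd => ⟨r.val + d + 1, by
        have := Finset.mem_range.1 hd
        omega⟩) ?_ ?_ ?_ ?_ ?_
    · intro s hs
      have := s.isLt
      simp only [Finset.mem_filter, Finset.mem_univ, true_and, Finset.mem_range,
        Fin.lt_def] at hs ⊢
      omega
    · intro d _
      simp only [Finset.mem_filter, Finset.mem_univ, true_and, Fin.lt_def]
      omega
    · intro s hs
      simp only [Finset.mem_filter, Finset.mem_univ, true_and, Fin.lt_def] at hs
      apply Fin.ext
      simp only
      omega
    · intro d _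
      simp only
      omega
    · intro s hs
      simp only [Finset.mem_filter, Finset.mem_univ, true_and, Fin.lt_def] at hs
      exact h r s _ (by omega)
  rw [Finset.prod_congr rfl fun r _ => h1 r,
    Fin.prod_univ_eq_prod_range (fun r => ∏ d ∈ Finset.range (n - r), g r d) (n + 1),
    Finset.prod_range_succ, Nat.sub_self, Finset.range_zero, Finset.prod_empty, mul_one]

/-- The fibre amplitude along the line `z ↦ (z Q_{F_1}, …, z Q_{F_{N-1}})`. -/
def fibreFunction {N : ℕ} (b : ℂ) (QF : Fin (N - 1) → ℂ) (lam : Fin N → YoungDiagram) (z : ℂ) : ℂ :=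
  ∏ r : Fin N, ∏ s ∈ Finset.univ.filter (fun s => r < s),
    pairFactor b (lam r) (lam s) (z ^ (s.val - r.val) * fibreProd QF r s)

theorem eventually_hasSum_fibreTerm {N : ℕ} (hN : 2 ≤ N) {b : ℂ} (hb0 : b ≠ 0) (hb : ‖b‖ < 1)
    (QF : Fin (N - 1) → ℂ) (lam : Fin N → YoungDiagram) :
    ∀ᶠ z in 𝓝 (0 : ℂ), HasSum (fibreTerm hN b (fun t => z * QF t) lam)
      (fibreFunction b QF lam z) := by
  classical
  obtain ⟨n, rfl⟩ : ∃ n, N = n + 2 := ⟨N - 2, by omega⟩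
  set lam' : ℕ → YoungDiagram := extendBy ⊥ lam with hlam'
  have hmem : ∀ t, lam' t ∈ insert ⊥ (Finset.univ.image lam) := by
    intro t
    by_cases h : t < n + 2
    · rw [hlam', extendBy_of_lt _ _ h]
      exact Finset.mem_insert_of_mem (Finset.mem_image_of_mem _ (Finset.mem_univ _))
    · rw [hlam', extendBy, dif_neg h]
      exact Finset.mem_insert_self _ _
  obtain ⟨R, hR, hbound⟩ := exists_norm_powerSumShiftedRho_le_of_finset hb0 hb
    (insert ⊥ (Finset.univ.image lam) ∪
      (insert ⊥ (Finset.univ.image lam)).image YoungDiagram.transpose)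
  have hX : ∀ t, ∀ k, 1 ≤ k → ‖powerSumShiftedRho b (lam' t) k‖ ≤ R ^ k := fun t =>
    hbound _ (Finset.mem_union_left _ (hmem t))
  have hY : ∀ t, ∀ k, 1 ≤ k → ‖powerSumShiftedRho b (lam' (t + 1)).transpose k‖ ≤ R ^ k := fun t =>
    hbound _ (Finset.mem_union_right _ (Finset.mem_image_of_mem _ (hmem (t + 1))))
  set Q' : ℕ → ℂ := extendBy 0 QF with hQ'
  have hzQ : ∀ z t, extendBy 0 (fun t => z * QF t) t = z * Q' t := by
    intro z t
    simp only [hQ', extendBy]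
    split_ifs <;> simp
  set ε : ℝ := 1 / (128 * R ^ 2) with hε
  have hR0 : 0 < R := by linarith
  have hε0 : 0 < ε := by positivity
  have hεR : 2 * (ε * (32 * R ^ 2)) < 1 := by
    rw [hε]
    field_simp
    norm_num
  have hsmall : ∀ᶠ z in 𝓝 (0 : ℂ), ∀ t ∈ Finset.range (n + 1), ‖z * Q' t‖ ≤ ε := by
    rw [Filter.eventually_all_finset]
    intro t _
    have h1 : Filter.Tendsto (fun z : ℂ => ‖z * Q' t‖) (𝓝 0) (𝓝 ‖(0 : ℂ) * Q' t‖) :=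
      ((continuous_id.mul continuous_const).norm).tendsto 0
    exact h1.eventually_le_const (by simpa using hε0)
  have hgen : ∀ᶠ z in 𝓝 (0 : ℂ), ∀ r ∈ Finset.range (n + 1), ∀ d ∈ Finset.range (n + 1),
      HasSum (completeSymm fun k =>
        (∏ t ∈ Finset.range (d + 1), (z * Q' (r + t))) ^ k *
          (powerSumShiftedRho b (lam' r) k * powerSumShiftedRho b (lam' (r + d + 1)).transpose k))
        (pairFactor b (lam' r) (lam' (r + d + 1)) (∏ t ∈ Finset.range (d + 1), (z * Q' (r + t)))) := by
    rw [Filter.eventually_all_finset]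
    intro r _
    rw [Filter.eventually_all_finset]
    intro d _
    have h1 : Filter.Tendsto (fun z : ℂ => ∏ t ∈ Finset.range (d + 1), (z * Q' (r + t))) (𝓝 0) (𝓝 0) := by
      have h2 : Continuous fun z : ℂ => ∏ t ∈ Finset.range (d + 1), (z * Q' (r + t)) := by fun_prop
      have h3 := h2.tendsto 0
      simpa using h3
    exact h1.eventually (eventually_hasSum_completeSymm_pairFactor hb0 hb _ _)
  filter_upwards [hsmall, hgen] with z hz hg
  have hQ : ∀ t, ‖extendBy 0 (fun t => z * QF t) t‖ ≤ ε := by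
    intro t
    by_cases h : t < n + 2 - 1
    · rw [hzQ]
      exact hz t (Finset.mem_range.2 (by omega))
    · rw [extendBy, dif_neg h, norm_zero]
      exact hε0.le
  have hmain := hasSum_chainTerm hR hε0.le hεR (n + 1) hX hY hQ
    (g := fun r d => pairFactor b (lam' r) (lam' (r + d + 1))
      (∏ t ∈ Finset.range (d + 1), (z * Q' (r + t)))) (fun r d hrd => by
        have h := hg r (Finset.mem_range.2 (by omega)) d (Finset.mem_range.2 (by omega))
        simpa only [hzQ] using h) ⊥
  rw [schur_bot, mul_one, prod_range_eq_prod_Fin_lt _ (fun r s : Fin (n + 2) =>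
    pairFactor b (lam r) (lam s) (z ^ (s.val - r.val) * fibreProd QF r s))] at hmain
  · have e : fibreTerm hN b (fun t => z * QF t) lam = fun ν => chainTerm (n + 1)
        (fun t => powerSumShiftedRho b (lam' t))
        (fun t => powerSumShiftedRho b (lam' (t + 1)).transpose)
        (extendBy 0 fun t => z * QF t) ν ⊥ :=
      funext fun ν => fibreTerm_eq_chainTerm hN b _ lam ν
    rw [e]
    exact hmain
  · intro r s d h
    rw [fibreProd_eq QF h, Finset.prod_mul_distrib, Finset.prod_const, Finset.card_range, h,
      show s.val - r.val = d + 1 by omega, hlam', extendBy_val, extendBy_val]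

theorem exists_isFibreContinuation {N : ℕ} (hN : 2 ≤ N) {b : ℂ} (hb0 : b ≠ 0) (hb : ‖b‖ < 1)
    {QF : Fin (N - 1) → ℂ} (lam : Fin N → YoungDiagram)
    (h : ∀ r s : Fin N, r < s → ∀ m : ℤ, fibreProd QF r s * b ^ m ≠ 1) :
    ∃ F : ℂ → ℂ, IsFibreContinuation hN b QF lam F ∧ AnalyticAt ℂ F 1 ∧
      F 1 = fibreFunction b QF lam 1 := by
  have hw : ∀ (r s : Fin N) (z : ℂ),
      AnalyticAt ℂ (fun z : ℂ => z ^ (s.val - r.val) * fibreProd QF r s) z := fun r s z =>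
    (analyticAt_id.pow _).mul analyticAt_const
  have hmero : MeromorphicOn (fibreFunction b QF lam) Set.univ := fun z _ =>
    MeromorphicAt.fun_prod fun r _ => MeromorphicAt.fun_prod fun s _ =>
      meromorphicAt_pairFactor hb _ _ (hw r s z)
  have hana : ∀ z : ℂ, (∀ r s : Fin N, r < s → ∀ m : ℤ,
      z ^ (s.val - r.val) * fibreProd QF r s * b ^ m ≠ 1) →
      AnalyticAt ℂ (fibreFunction b QF lam) z := fun z hz =>
    Finset.analyticAt_fun_prod _ fun r _ => Finset.analyticAt_fun_prod _ fun s hs =>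
      analyticAt_pairFactor hb _ _ (hw r s z) (hz r s (Finset.mem_filter.1 hs).2)
  have h0 : AnalyticAt ℂ (fibreFunction b QF lam) 0 := hana 0 fun r s hrs m => by
    have : s.val - r.val ≠ 0 := by
      have := Fin.lt_def.1 hrs
      omega
    simp [zero_pow this]
  have h1 : AnalyticAt ℂ (fibreFunction b QF lam) 1 := hana 1 fun r s hrs m => by
    simpa using h r s hrs m
  set F := toMeromorphicNFOn (fibreFunction b QF lam) Set.univ with hF
  have heq : ∀ z, AnalyticAt ℂ (fibreFunction b QF lam) z → F =ᶠ[𝓝 z] fibreFunction b QF lam := by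
    intro z hz
    filter_upwards [hz.eventually_analyticAt] with w hw
    rw [hF, toMeromorphicNFOn_eq_toMeromorphicNFAt hmero (Set.mem_univ w),
      toMeromorphicNFAt_eq_self.2 hw.meromorphicNFAt]
  refine ⟨F, ⟨meromorphicNFOn_toMeromorphicNFOn _ _, ?_⟩, h1.congr (heq 1 h1).symm,
    (heq 1 h1).eq_of_nhds⟩
  filter_upwards [heq 0 h0, eventually_hasSum_fibreTerm hN hb0 hb QF lam] with z hz hs
  rwa [hz]

theorem fibreAmplitude_eq {N : ℕ} (hN : 2 ≤ N) {b : ℂ} (hb0 : b ≠ 0) (hb : ‖b‖ < 1)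
    {QF : Fin (N - 1) → ℂ} (lam : Fin N → YoungDiagram)
    (h : ∀ r s : Fin N, r < s → ∀ m : ℤ, fibreProd QF r s * b ^ m ≠ 1) :
    fibreAmplitude hN b QF lam = ∏ r : Fin N, ∏ s ∈ Finset.univ.filter (fun s => r < s),
      pairFactor b (lam r) (lam s) (fibreProd QF r s) := by
  obtain ⟨F, hF, -, hF1⟩ := exists_isFibreContinuation hN hb0 hb lam h
  have h1 := Classical.epsilon_spec (p := fun F => IsFibreContinuation hN b QF lam F) ⟨F, hF⟩
  rw [fibreAmplitude, h1.unique hF, hF1, fibreFunction]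
  simp

/-! ### The instanton weights -/

theorem schurNegRho_eq {q : ℂ} (hq0 : q ≠ 0) (hq1 : ‖q‖ < 1) (μ : YoungDiagram) :
    schurNegRho q μ = schur (geomPowerSum (q ^ (1 / 2 : ℂ))) μ :=
  skewSchur_congr ⊥ fun _ hk _ => powerSumNegRho_eq hq0 hq1 hk

theorem foldedPartition_injective {N : ℕ} (hN : 0 < N) (p : Fin N → ℤ) (hp : ∑ r, p r = 0) :
    Function.Injective (foldedPartition p) := by
  have key : ∀ lam lam' : Fin N → YoungDiagram, foldedPartition p lam = foldedPartition p lam' →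
      ∀ r, mayaSet (lam r) ⊆ mayaSet (lam' r) := by
    rintro lam lam' h r x ⟨i, rfl⟩
    have h1 := (exists_mayaInt_foldedPartition hN p hp lam
      (foldSite p r (mayaInt (lam r) i))).2 ⟨r, i, rfl⟩
    rw [h] at h1
    obtain ⟨s, j, hj⟩ := (exists_mayaInt_foldedPartition hN p hp lam' _).1 h1
    obtain ⟨rfl, h2⟩ := foldSite_inj hN p hj
    exact ⟨j, by rw [mayaCoord_eq, mayaCoord_eq, h2]⟩
  intro lam lam' h
  funext r
  exact mayaSet_injective (Set.Subset.antisymm (key lam lam' h r) (key lam' lam h.symm r))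

theorem summable_pow_mul_norm_schur_sq {a : ℂ} (ha0 : a ≠ 0) (ha : ‖a‖ < 1) {t : ℝ} (ht0 : 0 ≤ t)
    (ht : t * ‖a‖ ^ 2 < 1) :
    Summable fun μ : YoungDiagram => t ^ μ.card * ‖schur (geomPowerSum a) μ‖ ^ 2 := by
  choose x hx hle using exists_schur_geomPowerSum_ofReal ha0 ha
  have hx0 : ∀ μ, 0 ≤ x μ := fun μ => (norm_nonneg _).trans (hle μ)
  have hs : Summable fun μ : YoungDiagram => t ^ μ.card * x μ ^ 2 := by
    refine summable_of_sum_diagramsOfCard (fun μ => by positivity) ?_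
    refine (summable_norm_completeSymm_macMahon (r := ‖a‖ ^ 2) (by positivity)
      (pow_lt_one₀ (norm_nonneg a) ha two_ne_zero) ht0 ht).congr fun d => ?_
    have h1 := sum_schur_mul_skewSchur_of_card (geomPowerSum (‖a‖ : ℂ)) (geomPowerSum (‖a‖ : ℂ)) ⊥ d
    rw [card_bot, if_pos (Nat.zero_le d), Nat.sub_zero, schur_bot, mul_one] at h1
    have h2 : completeSymm (fun k => (t : ℂ) ^ k *
        (((‖a‖ ^ 2 : ℝ) : ℂ) ^ k / (1 - ((‖a‖ ^ 2 : ℝ) : ℂ) ^ k) ^ 2)) d =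
        ((∑ μ ∈ diagramsOfCard d, t ^ μ.card * x μ ^ 2 : ℝ) : ℂ) := by
      rw [completeSymm_scale, completeSymm_congr (P' := fun k =>
        geomPowerSum (‖a‖ : ℂ) k * geomPowerSum (‖a‖ : ℂ) k) fun k _ _ => by
          rw [geomPowerSum, pow_mul, div_mul_div_comm, ← sq, ← sq]
          push_cast
          rw [pow_right_comm], ← h1, Finset.mul_sum]
      push_cast
      refine Finset.sum_congr rfl fun μ hμ => ?_
      rw [mem_diagramsOfCard.1 hμ, ← hx μ, sq]
      rfl
    rw [h2, Complex.norm_real, Real.norm_of_nonneg]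
    exact Finset.sum_nonneg fun μ _ => by positivity
  refine hs.of_nonneg_of_le (fun μ => by positivity) fun μ => ?_
  exact mul_le_mul_of_nonneg_left (pow_le_pow_left₀ (norm_nonneg _) (hle μ) 2) (by positivity)

theorem card_foldedPartition_nat {N : ℕ} (hN : 0 < N) (p : Fin N → ℤ) (hp : ∑ r, p r = 0)
    (lam : Fin N → YoungDiagram) :
    (foldedPartition p lam).card =
      N * ∑ r, (lam r).card + (foldedPartition p fun _ => ⊥).card := by
  have h := card_foldedPartition hN p hp lam
  zify
  linarith

theorem cpow_half_mul_sq (x : ℂ) (n : ℕ) : (x ^ ((1 / 2 : ℂ) * n)) ^ 2 = x ^ n := by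
  rw [← Complex.cpow_nat_mul, ← Complex.cpow_natCast]
  congr 1
  push_cast
  ring

theorem instantonWeight_sq {N : ℕ} (hN : 0 < N) {p : Fin N → ℤ} (hp : ∑ r, p r = 0) {q : ℂ}
    (hq0 : q ≠ 0) (hq1 : ‖q‖ < 1) (Q : ℂ) (lam : Fin N → YoungDiagram) :
    instantonWeight q Q p lam ^ 2 = Q ^ (N * ∑ r, (lam r).card) *
      (schur (geomPowerSum (q ^ (1 / 2 : ℂ))) (foldedPartition p lam) ^ 2 /
        schur (geomPowerSum (q ^ (1 / 2 : ℂ))) (foldedPartition p fun _ => ⊥) ^ 2) := by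
  rw [instantonWeight, mul_pow, div_pow, schurNegRho_eq hq0 hq1, schurNegRho_eq hq0 hq1,
    card_foldedPartition_nat hN p hp lam, Nat.cast_add, add_sub_cancel_right, cpow_half_mul_sq]

theorem summable_instantonWeight_sq {N : ℕ} (hN : 0 < N) {p : Fin N → ℤ} (hp : ∑ r, p r = 0) {q Q : ℂ}
    (hq0 : q ≠ 0) (hq1 : ‖q‖ < 1) (hQ : ‖Q * q‖ < 1) :
    Summable fun lam : Fin N → YoungDiagram => instantonWeight q Q p lam ^ 2 := by
  set a := q ^ (1 / 2 : ℂ) with ha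
  set t := max ‖Q‖ 1 with ht
  have ht0 : 0 < t := lt_max_of_lt_right one_pos
  have haq : ‖a‖ ^ 2 = ‖q‖ := by rw [← norm_pow, ha, cpow_half_sq]
  have htq : t * ‖a‖ ^ 2 < 1 := by
    rw [haq, ht, max_mul_of_nonneg _ _ (norm_nonneg q), one_mul, ← norm_mul]
    exact max_lt hQ hq1
  have h1 := (summable_pow_mul_norm_schur_sq (cpow_half_ne_zero hq0) (norm_cpow_half_lt_one hq1)
    ht0.le htq).comp_injective (foldedPartition_injective hN p hp)
  set μ0 := foldedPartition p fun _ => ⊥ with hμ0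
  refine Summable.of_norm_bounded (h1.mul_left ((t ^ μ0.card)⁻¹ *
    (‖schur (geomPowerSum a) μ0‖ ^ 2)⁻¹)) fun lam => ?_
  rw [instantonWeight_sq hN hp hq0 hq1, Function.comp_apply, card_foldedPartition_nat hN p hp lam,
    norm_mul, norm_div, norm_pow, norm_pow, norm_pow, pow_add]
  have h2 : (t ^ μ0.card)⁻¹ * t ^ μ0.card = 1 := inv_mul_cancel₀ (pow_ne_zero _ ht0.ne')
  calc _ ≤ t ^ (N * ∑ r, (lam r).card) *
        (‖schur (geomPowerSum a) (foldedPartition p lam)‖ ^ 2 / ‖schur (geomPowerSum a) μ0‖ ^ 2) :=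
        mul_le_mul_of_nonneg_right
          (pow_le_pow_left₀ (norm_nonneg _) (le_max_left _ _) _) (by positivity)
    _ = ((t ^ μ0.card)⁻¹ * t ^ μ0.card) * (t ^ (N * ∑ r, (lam r).card) *
        (‖schur (geomPowerSum a) (foldedPartition p lam)‖ ^ 2 /
          ‖schur (geomPowerSum a) μ0‖ ^ 2)) := by rw [h2, one_mul]
    _ = _ := by
      rw [← hμ0]
      ring

/-! ### The string weights -/

theorem sum_Fin_lt_eq (N : ℕ) (f : ℕ → ℕ → ℤ) :
    ∑ r : Fin N, ∑ s ∈ Finset.univ.filter (fun s => r < s), f r s =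
      ∑ s ∈ Finset.range N, ∑ r ∈ Finset.range s, f r s := by
  rw [Finset.sum_comm' (t' := Finset.univ) (s' := fun s => Finset.univ.filter fun r => r < s)
    (by simp), ← Fin.sum_univ_eq_sum_range (fun s => ∑ r ∈ Finset.range s, f r s) N]
  refine Finset.sum_congr rfl fun s _ => ?_
  have hs := s.isLt
  refine Finset.sum_bij' (fun r _ => r.val) (fun r hr => ⟨r, by
    have := Finset.mem_range.1 hr
    omega⟩) ?_ ?_ ?_ ?_ ?_
  · intro r hr
    simpa only [Finset.mem_filter, Finset.mem_univ, true_and, Fin.lt_def, Finset.mem_range] using hr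
  · intro r hr
    simpa only [Finset.mem_filter, Finset.mem_univ, true_and, Fin.lt_def, Finset.mem_range] using hr
  all_goals exact fun _ _ => rfl

theorem sum_Fin_pred_lt_eq {N : ℕ} (x : ℕ → ℤ) (c : ℕ → ℤ) :
    ∑ t : Fin (N - 1), x t * ∑ s ∈ Finset.univ.filter (fun s : Fin N => t.val < s.val), c s =
      ∑ s ∈ Finset.range N, c s * ∑ t ∈ Finset.range s, x t := by
  simp only [Finset.mul_sum]
  rw [Finset.sum_comm' (t' := Finset.univ)
    (s' := fun s : Fin N => Finset.univ.filter fun t : Fin (N - 1) => t.val < s.val) (by simp),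
    ← Fin.sum_univ_eq_sum_range (fun s => ∑ t ∈ Finset.range s, c s * x t) N]
  refine Finset.sum_congr rfl fun s _ => ?_
  have hs := s.isLt
  refine Finset.sum_bij' (fun r _ => r.val) (fun r hr => ⟨r, by
    have := Finset.mem_range.1 hr
    omega⟩) ?_ ?_ ?_ ?_ ?_
  · intro r hr
    simpa using hr
  · intro r hr
    simpa using hr
  · simp
  · simp
  · intro r _
    ring

theorem sum_card_exponent (N : ℕ) (x c : ℕ → ℤ) :
    2 * (∑ s ∈ Finset.range N, c s *
        ∑ t ∈ Finset.range s, ((t : ℤ) + 1) * (x t - x (t + 1))) -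
      ∑ s ∈ Finset.range N, ∑ r ∈ Finset.range s, (x r - x s) * (c r + c s) =
      ∑ s ∈ Finset.range N, c s * (∑ r ∈ Finset.range N, x r - N * x s) := by
  have h1 : ∀ s : ℕ, ∑ t ∈ Finset.range s, ((t : ℤ) + 1) * (x t - x (t + 1)) =
      ∑ t ∈ Finset.range s, x t - s * x s := by
    intro s
    induction s with
    | zero => simp
    | succ s ih =>
      rw [Finset.sum_range_succ, ih, Finset.sum_range_succ]
      push_cast
      ring
  simp only [h1]
  induction N with
  | zero => simp
  | succ N ih =>
    have h2 : ∑ r ∈ Finset.range N, (x r - x N) * (c r + c N) =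
        ∑ r ∈ Finset.range N, (x r - x N) * c r + c N * (∑ r ∈ Finset.range N, x r - N * x N) := by
      simp only [mul_add, Finset.sum_add_distrib, sub_mul, Finset.sum_sub_distrib, ← Finset.sum_mul,
        Finset.sum_const, Finset.card_range, nsmul_eq_mul]
      ring
    have h3 : ∑ s ∈ Finset.range N, c s * (∑ r ∈ Finset.range (N + 1), x r - ((N + 1 : ℕ) : ℤ) * x s) =
        ∑ s ∈ Finset.range N, c s * (∑ r ∈ Finset.range N, x r - N * x s) -
          ∑ r ∈ Finset.range N, (x r - x N) * c r := by
      rw [← Finset.sum_sub_distrib]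
      refine Finset.sum_congr rfl fun s _ => ?_
      rw [Finset.sum_range_succ]
      push_cast
      ring
    rw [Finset.sum_range_succ, Finset.sum_range_succ, Finset.sum_range_succ _ N, h2, h3, ← ih,
      Finset.sum_range_succ]
    push_cast
    ring

theorem sum_kappa_exponent (N : ℕ) (k : ℕ → ℤ) :
    -2 * (∑ r ∈ Finset.range N, ((r : ℤ) + 1) * k r) + ∑ r ∈ Finset.range N, k r -
      ∑ s ∈ Finset.range N, ∑ r ∈ Finset.range s, (k r - k s) =
      -(N * ∑ r ∈ Finset.range N, k r) := by
  induction N with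
  | zero => simp
  | succ N ih =>
    rw [Finset.sum_range_succ, Finset.sum_range_succ, Finset.sum_range_succ _ N,
      Finset.sum_sub_distrib, Finset.sum_const, Finset.card_range, nsmul_eq_mul]
    push_cast
    linarith

theorem lprod_eq_one_of_sq {σ : ℤ → ℂ} (h0 : σ 0 = 1) (hsq : ∀ m, σ m ^ 2 = 1)
    (heven : ∀ m, σ (-m) = σ m) {f : ℤ[T;T⁻¹]} (hf : LaurentPolynomial.invert f = f) :
    lprod σ f = 1 := by
  have hc : ∀ m, f.coeff (-m) = f.coeff m := fun m => by
    rw [← LaurentPolynomial.invert_apply, hf]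
  refine Finset.prod_involution (fun m _ => -m) (fun m _ => ?_) (fun m _ h => ?_) (fun m hm => ?_)
    fun m _ => neg_neg m
  · simp only [heven, hc]
    rw [← mul_zpow, ← sq, hsq, one_zpow]
  · intro hm
    have : m = 0 := by omega
    simp only [this, h0, one_zpow] at h
    exact h rfl
  · rw [Finsupp.mem_support_iff, hc]
    exact Finsupp.mem_support_iff.1 hm

theorem lprod_eq_of_sq {φ ψ : ℤ → ℂ} (hψ : ∀ m, ψ m ≠ 0) (h0 : φ 0 = ψ 0)
    (hsq : ∀ m, φ m ^ 2 = ψ m ^ 2) (hφe : ∀ m, φ (-m) = φ m) (hψe : ∀ m, ψ (-m) = ψ m)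
    {f : ℤ[T;T⁻¹]} (hf : LaurentPolynomial.invert f = f) : lprod φ f = lprod ψ f := by
  have h := lprod_eq_one_of_sq (σ := fun m => φ m / ψ m) (by simp only [h0, div_self (hψ 0)])
    (fun m => by rw [div_pow, hsq, div_self (pow_ne_zero 2 (hψ m))])
    (fun m => by simp only [hφe, hψe]) hf
  have e : φ = fun m => φ m / ψ m * ψ m := funext fun m => (div_mul_cancel₀ _ (hψ m)).symm
  rw [e, lprod_mul_fun, h, one_mul]

theorem bracket_zero (a : ℂ) : bracket a 0 = 1 := if_pos rfl

theorem bracket_sq_eq {a c : ℂ} (ha0 : a ≠ 0) (hc0 : c ≠ 0) {N : ℕ} (hN : 0 < N)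
    (h : c ^ 2 = ((a ^ 2) ^ N)⁻¹) (m : ℤ) : bracket c m ^ 2 = bracket a (N * m) ^ 2 := by
  by_cases hm : m = 0
  · rw [hm, mul_zero, bracket_zero, bracket_zero]
  have hNm : (N : ℤ) * m ≠ 0 := mul_ne_zero (by exact_mod_cast hN.ne') hm
  have h1 := one_sub_zpow_sq hc0 hm
  have h2 := one_sub_zpow_sq ha0 hNm
  have e : (c ^ 2) ^ m = ((a ^ 2) ^ ((N : ℤ) * m))⁻¹ := by
    rw [h, zpow_mul, zpow_natCast, inv_zpow]
  have hx : (a ^ 2) ^ ((N : ℤ) * m) ≠ 0 := zpow_ne_zero _ (pow_ne_zero 2 ha0)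
  rw [e] at h1
  set x := (a ^ 2) ^ ((N : ℤ) * m)
  have h3 : x⁻¹ * x = 1 := inv_mul_cancel₀ hx
  have h4 : x * (x⁻¹ * bracket c m ^ 2) = bracket a (N * m) ^ 2 := by
    rw [← h1]
    apply mul_left_cancel₀ hx
    rw [← h2]
    linear_combination (x⁻¹ * x - 1) * h3 + (2 * (1 - x)) * h3
  rw [← h4, ← mul_assoc, mul_inv_cancel₀ hx, one_mul]

theorem schurShiftedRho_bot_sq {q : ℂ} (hq0 : q ≠ 0) (hq1 : ‖q‖ < 1) {N : ℕ} (hN : 0 < N)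
    (lam : YoungDiagram) :
    schurShiftedRho (q ^ N) ⊥ lam ^ 2 = (q ^ (1 / 2 : ℂ)) ^ (N * kappa lam) *
      (lprod (fun m => bracket (q ^ (1 / 2 : ℂ)) (N * m)) (pairPoly lam lam))⁻¹ := by
  set a := q ^ (1 / 2 : ℂ) with ha
  have hb0 : q ^ N ≠ 0 := pow_ne_zero N hq0
  have hb1 : ‖q ^ N‖ < 1 := by
    rw [norm_pow]
    exact pow_lt_one₀ (norm_nonneg q) hq1 hN.ne'
  have haq : a ^ 2 = q := cpow_half_sq q
  have ha0 : a ≠ 0 := cpow_half_ne_zero hq0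
  set c := (q ^ N) ^ (1 / 2 : ℂ) with hc
  have hcq : c ^ 2 = q ^ N := cpow_half_sq _
  have hc0 : c ≠ 0 := cpow_half_ne_zero hb0
  have e1 : schurShiftedRho (q ^ N) ⊥ lam = schur (geomPowerSum c⁻¹) lam :=
    skewSchur_congr ⊥ fun k hk _ => powerSumShiftedRho_bot hb0 hb1 hk
  have hc1 : ∀ k, 1 ≤ k → ((c⁻¹) ^ 2) ^ k ≠ 1 := fun k hk h => by
    rw [inv_pow, hcq, inv_pow, inv_eq_one] at h
    exact pow_ne_one_of_norm_lt_one hb1 k hk h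
  have ha1 : ∀ k, 1 ≤ k → (a ^ 2) ^ k ≠ 1 := by
    rw [haq]
    exact pow_ne_one_of_norm_lt_one hq1
  have e2 : lprod (bracket c⁻¹) (pairPoly lam lam) =
      lprod (fun m => bracket a (N * m)) (pairPoly lam lam) :=
    lprod_eq_of_sq (fun m => bracket_ne_zero ha0 ha1 _) (by rw [mul_zero, bracket_zero, bracket_zero])
      (bracket_sq_eq ha0 (inv_ne_zero hc0) hN (by rw [inv_pow, hcq, haq])) (bracket_neg _)
      (fun m => by rw [mul_neg, bracket_neg]) (invert_pairPoly lam lam)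
  rw [e1, schur_geomPowerSum_sq (inv_ne_zero hc0) hc1, lprod_neg (bracket_ne_zero (inv_ne_zero hc0) hc1),
    e2, inv_zpow', neg_neg]
  congr 1
  obtain ⟨k, hk⟩ : ∃ k, kappa lam = 2 * k := ⟨_, rfl⟩
  rw [hk, zpow_mul, zpow_ofNat, hcq, ← haq, mul_left_comm, zpow_mul, zpow_ofNat, zpow_mul,
    zpow_natCast]

theorem fibreParam_eq {N : ℕ} (hN : 0 < N) (q : ℂ) (p : Fin N → ℤ) (t : Fin (N - 1)) :
    fibreParam q p t = q ^ (extendBy 0 (fun r => foldSite p r 0) t -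
      extendBy 0 (fun r => foldSite p r 0) (t + 1)) := by
  have hNQ : (N : ℚ) ≠ 0 := by exact_mod_cast hN.ne'
  rw [fibreParam, extendBy_of_lt (N := N) _ _ (by omega : t.val < N),
    extendBy_of_lt (N := N) _ _ (by omega : t.val + 1 < N), ← Complex.cpow_intCast]
  congr 1
  rw [← Rat.cast_intCast]
  congr 1
  simp only [pTilde, foldSite]
  push_cast
  field_simp
  ring

theorem fibreProd_fibreParam {N : ℕ} (hN : 0 < N) {q : ℂ} (hq0 : q ≠ 0) (p : Fin N → ℤ)
    {r s : Fin N} (hrs : r < s) :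
    fibreProd (fibreParam q p) r s = q ^ (foldSite p r 0 - foldSite p s 0) := by
  obtain ⟨d, hd⟩ : ∃ d, r.val + d + 1 = s.val := ⟨s.val - r.val - 1, by
    have := Fin.lt_def.1 hrs
    omega⟩
  have hs := s.isLt
  set x : ℕ → ℤ := extendBy 0 fun r => foldSite p r 0 with hx
  have h1 : ∀ t ∈ Finset.range (d + 1), extendBy 0 (fibreParam q p) (r.val + t) =
      q ^ (x (r.val + t) - x (r.val + (t + 1))) := fun t ht => by
    have := Finset.mem_range.1 ht
    rw [extendBy_of_lt _ _ (by omega : r.val + t < N - 1), fibreParam_eq hN, ← hx, add_assoc]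
  rw [fibreProd_eq _ hd, Finset.prod_congr rfl h1, ← zpow_finset_sum hq0,
    Finset.sum_range_sub' fun t => x (r.val + t), add_zero, ← add_assoc, hd, hx, extendBy_val,
    extendBy_val]

theorem foldSite_sub_add_ne_zero {N : ℕ} (hN : 0 < N) (p : Fin N → ℤ) {r s : Fin N} (hrs : r < s)
    (m : ℤ) : foldSite p r 0 - foldSite p s 0 + N * m ≠ 0 := by
  intro h
  have h1 : foldSite p r m = foldSite p s 0 := by
    simp only [foldSite] at h ⊢
    linarith
  exact hrs.ne (foldSite_inj hN p h1).1

theorem zpow_ne_one {q : ℂ} (hq1 : ‖q‖ < 1) {l : ℤ} (hl : l ≠ 0) : q ^ l ≠ 1 := by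
  intro h
  have h1 := congrArg norm h
  rw [norm_zpow, norm_one, zpow_eq_one_iff_right₀ (norm_nonneg q) hq1.ne] at h1
  exact hl h1

theorem zpow_mul_pow_zpow {q : ℂ} (hq0 : q ≠ 0) (e : ℤ) (N : ℕ) (m : ℤ) :
    q ^ e * (q ^ N) ^ m = q ^ (e + N * m) := by
  rw [zpow_add₀ hq0, zpow_mul, zpow_natCast]

theorem fibreProd_mul_zpow_ne_one {N : ℕ} (hN : 0 < N) {q : ℂ} (hq0 : q ≠ 0) (hq1 : ‖q‖ < 1)
    (p : Fin N → ℤ) {r s : Fin N} (hrs : r < s) (m : ℤ) :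
    fibreProd (fibreParam q p) r s * (q ^ N) ^ m ≠ 1 := by
  rw [fibreProd_fibreParam hN hq0 p hrs, zpow_mul_pow_zpow hq0]
  exact zpow_ne_one hq1 (foldSite_sub_add_ne_zero hN p hrs m)

theorem lprod_one_sub_sq {q : ℂ} (hq0 : q ≠ 0) {e : ℤ} {N : ℕ} (he : ∀ m : ℤ, e + N * m ≠ 0)
    (μ ν : YoungDiagram) :
    lprod (fun m => 1 - q ^ e * (q ^ N) ^ m) (pairPoly μ ν) ^ 2 =
      (q ^ (1 / 2 : ℂ)) ^ (2 * e * (μ.card + ν.card) + N * (kappa μ - kappa ν)) *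
        lprod (fun m => bracket (q ^ (1 / 2 : ℂ)) (e + N * m)) (pairPoly μ ν) ^ 2 := by
  set a := q ^ (1 / 2 : ℂ) with ha
  have haq : a ^ 2 = q := cpow_half_sq q
  have ha0 : a ≠ 0 := cpow_half_ne_zero hq0
  have e1 : ∀ m : ℤ, (1 - q ^ e * (q ^ N) ^ m) * (1 - q ^ e * (q ^ N) ^ m) =
      a ^ (2 * e + 2 * N * m) * (bracket a (e + N * m) * bracket a (e + N * m)) := fun m => by
    rw [← sq, ← sq, zpow_mul_pow_zpow hq0, ← haq, one_sub_zpow_sq ha0 (he m)]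
    congr 1
    rw [← zpow_ofNat, ← zpow_mul]
    congr 1
    ring
  have e2 : lsum (fun m : ℤ => 2 * e + 2 * N * m) (pairPoly μ ν) =
      2 * e * (μ.card + ν.card) + N * (kappa μ - kappa ν) := by
    have h1 : lsum (fun m : ℤ => 2 * e + 2 * N * m) (pairPoly μ ν) =
        lsum (fun _ : ℤ => 2 * e * 1) (pairPoly μ ν) +
          lsum (fun m : ℤ => 2 * N * m) (pairPoly μ ν) := by
      rw [← lsum_add_fun, mul_one]
    rw [h1, lsum_const_mul, lsum_const_mul]
    change 2 * e * augm (pairPoly μ ν) + 2 * N * slope (pairPoly μ ν) = _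
    rw [augm_pairPoly, ← two_mul_slope_pairPoly]
    ring
  rw [sq, ← lprod_mul_fun, funext e1, lprod_mul_fun, lprod_mul_fun, lprod_zpow ha0, e2, sq]

theorem string_exponent_eq {N : ℕ} (p : Fin N → ℤ) (hp : ∑ r, p r = 0) (c k : Fin N → ℤ) :
    -2 * N * (∑ r : Fin N, ((r.val : ℤ) + 1) * k r) +
      4 * (∑ t : Fin (N - 1), ((t.val : ℤ) + 1) * (extendBy 0 (fun r => foldSite p r 0) t -
        extendBy 0 (fun r => foldSite p r 0) (t + 1)) *
        ∑ s ∈ Finset.univ.filter (fun s : Fin N => t.val < s.val), c s) +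
      N * (∑ r, k r) -
      ∑ r : Fin N, ∑ s ∈ Finset.univ.filter (fun s => r < s),
        (2 * (foldSite p r 0 - foldSite p s 0) * (c r + c s) + N * (k r - k s)) =
      -∑ r, ((N : ℤ) ^ 2 * k r + N * (2 * N * p r + 2 * r.val - (N - 1)) * c r) := by
  set x : ℕ → ℤ := extendBy 0 fun r => foldSite p r 0 with hx
  have hxr : ∀ r : Fin N, foldSite p r 0 = x r := fun r =>
    (extendBy_val 0 (fun r => foldSite p r 0) r).symm
  have hcr : ∀ r : Fin N, c r = extendBy 0 c r := fun r => (extendBy_val _ _ r).symm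
  have hkr : ∀ r : Fin N, k r = extendBy 0 k r := fun r => (extendBy_val _ _ r).symm
  have h1 := sum_card_exponent N x (extendBy 0 c)
  have h2 := sum_kappa_exponent N (extendBy 0 k)
  have h3 : ∑ r : Fin N, ∑ s ∈ Finset.univ.filter (fun s => r < s),
        (2 * (foldSite p r 0 - foldSite p s 0) * (c r + c s) + N * (k r - k s)) =
      2 * (∑ s ∈ Finset.range N, ∑ r ∈ Finset.range s,
        (x r - x s) * (extendBy 0 c r + extendBy 0 c s)) +
      N * (∑ s ∈ Finset.range N, ∑ r ∈ Finset.range s, (extendBy 0 k r - extendBy 0 k s)) := by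
    simp only [hxr, hcr, hkr]
    rw [sum_Fin_lt_eq N fun r s => 2 * (x r - x s) * (extendBy 0 c r + extendBy 0 c s) +
      N * (extendBy 0 k r - extendBy 0 k s)]
    simp only [Finset.mul_sum, ← Finset.sum_add_distrib, mul_assoc]
  have h4 : ∑ t : Fin (N - 1), ((t.val : ℤ) + 1) * (x t - x (t + 1)) *
        ∑ s ∈ Finset.univ.filter (fun s : Fin N => t.val < s.val), c s =
      ∑ s ∈ Finset.range N, extendBy 0 c s *
        ∑ t ∈ Finset.range s, ((t : ℤ) + 1) * (x t - x (t + 1)) := by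
    simp only [hcr]
    exact sum_Fin_pred_lt_eq (fun t => ((t : ℤ) + 1) * (x t - x (t + 1))) (extendBy 0 c)
  have h5 : ∑ r : Fin N, ((r.val : ℤ) + 1) * k r =
      ∑ r ∈ Finset.range N, ((r : ℤ) + 1) * extendBy 0 k r := by
    simp only [hkr]
    exact Fin.sum_univ_eq_sum_range (fun r => ((r : ℤ) + 1) * extendBy 0 k r) N
  have h6 : ∑ r : Fin N, k r = ∑ r ∈ Finset.range N, extendBy 0 k r := by
    simp only [hkr]
    exact Fin.sum_univ_eq_sum_range (fun r => extendBy 0 k r) N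
  have h7 : 2 * ∑ r ∈ Finset.range N, x r = N * (N - 1) := by
    rw [← Fin.sum_univ_eq_sum_range x N]
    simp only [← hxr, foldSite, zero_add, Finset.sum_add_distrib, ← Finset.mul_sum, hp]
    rw [Fin.sum_univ_eq_sum_range (fun r => (r : ℤ)) N, mul_zero, zero_add]
    have h : ∀ n : ℕ, 2 * ∑ r ∈ Finset.range n, (r : ℤ) = n * (n - 1) := by
      intro n
      induction n with
      | zero => simp
      | succ n ih =>
        rw [Finset.sum_range_succ, mul_add, ih]
        push_cast
        ring
    exact h _
  have h8 : ∑ r, ((N : ℤ) ^ 2 * k r + N * (2 * N * p r + 2 * r.val - (N - 1)) * c r) =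
      N ^ 2 * (∑ r ∈ Finset.range N, extendBy 0 k r) -
        2 * ∑ s ∈ Finset.range N, extendBy 0 c s * (∑ r ∈ Finset.range N, x r - N * x s) := by
    have h9 : ∑ r, (N : ℤ) * (2 * N * p r + 2 * r.val - (N - 1)) * c r =
        ∑ s ∈ Finset.range N, -2 * (extendBy 0 c s * (∑ r ∈ Finset.range N, x r - N * x s)) := by
      rw [← Fin.sum_univ_eq_sum_range (fun s => -2 * (extendBy 0 c s *
        (∑ r ∈ Finset.range N, x r - N * x s))) N]
      refine Finset.sum_congr rfl fun r _ => ?_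
      rw [← hcr, ← hxr, foldSite]
      linear_combination (c r) * h7
    rw [Finset.sum_add_distrib, ← Finset.mul_sum, h6, h9, ← Finset.mul_sum]
    ring
  rw [h3, h4, h5, h6, h8]
  linear_combination 2 * h1 + N * h2

theorem string_prefactor_sq {N : ℕ} {q : ℂ} (k : Fin N → ℤ) :
    ((q ^ N) ^ (-(1 / 2 : ℂ) * ∑ r : Fin N, ((r.val : ℂ) + 1) * (k r : ℂ))) ^ 2 =
      (q ^ (1 / 2 : ℂ)) ^ (-2 * N * ∑ r : Fin N, ((r.val : ℤ) + 1) * k r) := by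
  set E := ∑ r : Fin N, ((r.val : ℤ) + 1) * k r with hE
  have e : ∑ r : Fin N, ((r.val : ℂ) + 1) * (k r : ℂ) = (E : ℂ) := by
    rw [hE]
    push_cast
    rfl
  rw [e, ← Complex.cpow_nat_mul, show ((2 : ℕ) : ℂ) * (-(1 / 2) * (E : ℂ)) = ((-E : ℤ) : ℂ) by
    push_cast
    ring, Complex.cpow_intCast, show (-2 * N * E : ℤ) = (2 : ℕ) * (N * -E) by
    push_cast
    ring, zpow_mul, zpow_natCast, cpow_half_sq, zpow_mul, zpow_natCast]

theorem stringWeight_sq_mul {N : ℕ} (hN : 2 ≤ N) {p : Fin N → ℤ} (hp : ∑ r, p r = 0) {q : ℂ}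
    (hq0 : q ≠ 0) (hq1 : ‖q‖ < 1) (Q : ℂ) (lam : Fin N → YoungDiagram) :
    (∏ r : Fin N, ∏ s ∈ Finset.univ.filter (fun s => r < s),
      macMahon (q ^ N) (fibreProd (fibreParam q p) r s) ^ 2) *
      stringWeight hN (q ^ N) (fibreParam q p) (Q ^ N) lam ^ 2 = instantonWeight q Q p lam ^ 2 := by
  have hN0 : 0 < N := by omega
  have hb0 : q ^ N ≠ 0 := pow_ne_zero N hq0
  have hb1 : ‖q ^ N‖ < 1 := by
    rw [norm_pow]
    exact pow_lt_one₀ (norm_nonneg q) hq1 hN0.ne'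
  set a := q ^ (1 / 2 : ℂ) with ha
  have haq : a ^ 2 = q := cpow_half_sq q
  have ha0 : a ≠ 0 := cpow_half_ne_zero hq0
  have ha1 : ∀ k, 1 ≤ k → (a ^ 2) ^ k ≠ 1 := by
    rw [haq]
    exact pow_ne_one_of_norm_lt_one hq1
  have hφ := bracket_ne_zero ha0 ha1
  set e : Fin N → Fin N → ℤ := fun r s => foldSite p r 0 - foldSite p s 0 with he
  set L : Fin N → Fin N → ℂ := fun r s =>
    lprod (fun m => bracket a (e r s + N * m)) (pairPoly (lam r) (lam s)) with hL
  have hL0 : ∀ r s, L r s ≠ 0 := fun r s => lprod_ne_zero (fun m => hφ _) _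
  have hLsymm : ∀ r s, L s r = L r s := by
    intro r s
    simp only [hL]
    rw [← invert_pairPoly, lprod_invert fun m => hφ _]
    congr 1
    funext m
    rw [← bracket_neg]
    congr 1
    simp only [he]
    ring
  set x : ℕ → ℤ := extendBy 0 fun r => foldSite p r 0 with hx
  have hA : ((Q ^ N) ^ ((1 / 2 : ℂ) * ∑ r, ((lam r).card : ℂ))) ^ 2 =
      Q ^ (N * ∑ r, (lam r).card) := by
    rw [← Nat.cast_sum, cpow_half_mul_sq, pow_mul]
  have hC : (∏ r : Fin (N - 1), fibreParam q p r ^ ((r.val + 1) *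
      ∑ s ∈ Finset.univ.filter (fun s : Fin N => r.val < s.val), (lam s).card)) ^ 2 =
      a ^ (4 * ∑ t : Fin (N - 1), ((t.val : ℤ) + 1) * (x t - x (t + 1)) *
        ∑ s ∈ Finset.univ.filter (fun s : Fin N => t.val < s.val), ((lam s).card : ℤ)) := by
    rw [Finset.mul_sum, zpow_finset_sum ha0, ← Finset.prod_pow]
    refine Finset.prod_congr rfl fun t _ => ?_
    rw [fibreParam_eq hN0, ← hx, ← haq, ← zpow_natCast a 2, ← zpow_mul, ← pow_mul, ← zpow_natCast,
      ← zpow_mul]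
    congr 1
    push_cast
    ring
  have hD : (∏ r, schurShiftedRho (q ^ N) ⊥ (lam r)) ^ 2 =
      a ^ (N * ∑ r, kappa (lam r)) * ∏ r, (L r r)⁻¹ := by
    rw [Finset.mul_sum, zpow_finset_sum ha0, ← Finset.prod_pow, ← Finset.prod_mul_distrib]
    refine Finset.prod_congr rfl fun r _ => ?_
    rw [schurShiftedRho_bot_sq hq0 hq1 hN0]
    simp only [hL, he, sub_self, zero_add]
    rfl
  have hE : (∏ r : Fin N, ∏ s ∈ Finset.univ.filter (fun s => r < s),
      macMahon (q ^ N) (fibreProd (fibreParam q p) r s) ^ 2) *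
      fibreAmplitude hN (q ^ N) (fibreParam q p) lam ^ 2 =
      a ^ (-∑ r : Fin N, ∑ s ∈ Finset.univ.filter (fun s => r < s),
        (2 * (foldSite p r 0 - foldSite p s 0) * (((lam r).card : ℤ) + (lam s).card) +
          N * (kappa (lam r) - kappa (lam s)))) *
        ∏ r : Fin N, ∏ s ∈ Finset.univ.filter (fun s => r < s), (L r s ^ 2)⁻¹ := by
    rw [fibreAmplitude_eq hN hb0 hb1 lam fun r s hrs m =>
      fibreProd_mul_zpow_ne_one hN0 hq0 hq1 p hrs m]
    simp only [← Finset.sum_neg_distrib]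
    rw [zpow_finset_sum ha0, ← Finset.prod_pow, ← Finset.prod_mul_distrib, ← Finset.prod_mul_distrib]
    refine Finset.prod_congr rfl fun r _ => ?_
    rw [zpow_finset_sum ha0, ← Finset.prod_pow, ← Finset.prod_mul_distrib, ← Finset.prod_mul_distrib]
    refine Finset.prod_congr rfl fun s hs => ?_
    have hrs : r < s := (Finset.mem_filter.1 hs).2
    have hM : macMahon (q ^ N) (fibreProd (fibreParam q p) r s) ≠ 0 :=
      macMahon_ne_zero hb1 fun j => by
        exact_mod_cast fibreProd_mul_zpow_ne_one hN0 hq0 hq1 p hrs (j + 1 : ℕ)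
    rw [pairFactor, mul_pow, ← mul_assoc, inv_pow, mul_inv_cancel₀ (pow_ne_zero 2 hM), one_mul, inv_pow,
      fibreProd_fibreParam hN0 hq0 p hrs,
      lprod_one_sub_sq hq0 (foldSite_sub_add_ne_zero hN0 p hrs), mul_inv, zpow_neg]
  have hI : schur (geomPowerSum a) (foldedPartition p lam) ^ 2 /
      schur (geomPowerSum a) (foldedPartition p fun _ => ⊥) ^ 2 =
      a ^ (-∑ r, ((N : ℤ) ^ 2 * kappa (lam r) +
        N * (2 * N * p r + 2 * r.val - (N - 1)) * (lam r).card)) * ∏ r, ∏ s, (L r s)⁻¹ := by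
    rw [schur_geomPowerSum_sq ha0 ha1, schur_geomPowerSum_sq ha0 ha1, mul_div_mul_comm,
      ← zpow_sub₀ ha0, ← lprod_sub hφ, ← kappa_foldedPartition hN0 p hp lam]
    congr 1
    · congr 1
      ring
    · rw [show ∀ u v : ℤ[T;T⁻¹], -u - -v = -(u - v) from fun u v => by ring,
        pairPoly_foldedPartition hN0 p hp lam, lprod_neg hφ, lprod_sum hφ, ← Finset.prod_inv_distrib]
      refine Finset.prod_congr rfl fun r _ => ?_
      rw [lprod_sum hφ, ← Finset.prod_inv_distrib]
      refine Finset.prod_congr rfl fun s _ => ?_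
      rw [lprod_T_mul hφ, lprod_dilate fun m => hφ _]
  have hLL : ∏ r, ∏ s, (L r s)⁻¹ = (∏ r, (L r r)⁻¹) *
      ∏ r : Fin N, ∏ s ∈ Finset.univ.filter (fun s => r < s), (L r s ^ 2)⁻¹ := by
    have h1 := Finset.prod_prod_Ioi_mul_eq_prod_prod_off_diag fun r s : Fin N => (L r s)⁻¹
    have h2 : ∀ r : Fin N, ∏ s, (L r s)⁻¹ = (L r r)⁻¹ * ∏ s ∈ {r}ᶜ, (L s r)⁻¹ := fun r => by
      rw [Fintype.prod_eq_mul_prod_compl r]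
      simp only [hLsymm r]
    rw [Finset.prod_congr rfl fun r _ => h2 r, Finset.prod_mul_distrib, ← h1]
    congr 1
    refine Finset.prod_congr rfl fun r _ => ?_
    rw [Finset.filter_lt_eq_Ioi]
    refine Finset.prod_congr rfl fun s _ => ?_
    rw [hLsymm r s, sq, mul_inv]
  rw [instantonWeight_sq hN0 hp hq0 hq1, ← ha, hI, hLL,
    ← string_exponent_eq p hp (fun r => ((lam r).card : ℤ)) fun r => kappa (lam r), stringWeight, mul_pow,
    mul_pow, mul_pow, mul_pow, hA, hC, hD, string_prefactor_sq, ← ha]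
  rw [sub_eq_add_neg, zpow_add₀ ha0, zpow_add₀ ha0, zpow_add₀ ha0, ← hx]
  linear_combination (Q ^ (N * ∑ r, (lam r).card) *
    a ^ (-2 * (N : ℤ) * ∑ r : Fin N, ((r.val : ℤ) + 1) * kappa (lam r)) *
    a ^ (4 * ∑ t : Fin (N - 1), ((t.val : ℤ) + 1) * (x t - x (t + 1)) *
        ∑ s ∈ Finset.univ.filter (fun s : Fin N => t.val < s.val), ((lam s).card : ℤ)) *
    (a ^ ((N : ℤ) * ∑ r, kappa (lam r)) * ∏ r, (L r r)⁻¹)) * hE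

end PlanePartition

end

theorem mainTheorem7 (N : ℕ) (hN : 2 ≤ N) (p : Fin N → ℤ) (hp : ∑ r, p r = 0)
    (q Q : ℂ) (hq0 : q ≠ 0) (hq1 : ‖q‖ < 1) (hQ : ‖Q * q‖ < 1) :
    (∀ lam : Fin N → YoungDiagram, ∃ F : ℂ → ℂ,
      PlanePartition.IsFibreContinuation hN (q ^ N) (PlanePartition.fibreParam q p) lam F ∧
        AnalyticAt ℂ F 1) ∧
    (∀ r s : Fin N, r < s → Multipliable fun k : ℕ =>
      (1 - PlanePartition.fibreProd (PlanePartition.fibreParam q p) r s *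
        q ^ (N * (k + 1))) ^ (2 * (k + 1))) ∧
    (Summable fun lam : Fin N → YoungDiagram =>
      PlanePartition.instantonWeight q Q p lam ^ 2) ∧
    (Summable fun lam : Fin N → YoungDiagram =>
      PlanePartition.stringWeight hN (q ^ N) (PlanePartition.fibreParam q p) (Q ^ N) lam ^ 2) ∧
    ∑' lam : Fin N → YoungDiagram, PlanePartition.instantonWeight q Q p lam ^ 2 =
      (∏ r : Fin N, ∏ s ∈ Finset.univ.filter (fun s : Fin N => r < s), ∏' k : ℕ,
        (1 - PlanePartition.fibreProd (PlanePartition.fibreParam q p) r s *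
          q ^ (N * (k + 1))) ^ (2 * (k + 1))) *
      PlanePartition.stringAmplitude hN (q ^ N) (PlanePartition.fibreParam q p) (Q ^ N) := by
  have hN0 : 0 < N := by omega
  have hb1 : ‖q ^ N‖ < 1 := by
    rw [norm_pow]
    exact pow_lt_one₀ (norm_nonneg q) hq1 hN0.ne'
  have hcont := fun lam : Fin N → YoungDiagram =>
    PlanePartition.exists_isFibreContinuation hN (pow_ne_zero N hq0) hb1
      (QF := PlanePartition.fibreParam q p) lam fun r s hrs m =>
        PlanePartition.fibreProd_mul_zpow_ne_one hN0 hq0 hq1 p hrs m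
  have hprod : ∀ w : ℂ, (fun k : ℕ => (1 - w * q ^ (N * (k + 1))) ^ (2 * (k + 1))) = fun k : ℕ =>
      (1 - w * (q ^ N) ^ (k + 1)) ^ (k + 1) * (1 - w * (q ^ N) ^ (k + 1)) ^ (k + 1) := fun w => by
    funext k
    rw [two_mul, pow_add, pow_mul]
  have hM := fun w : ℂ => PlanePartition.multipliable_macMahon hb1 w
  have htprod : ∀ w : ℂ, ∏' k : ℕ, (1 - w * q ^ (N * (k + 1))) ^ (2 * (k + 1)) =
      PlanePartition.macMahon (q ^ N) w ^ 2 := fun w => by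
    rw [hprod, (hM w).tprod_mul (hM w), sq]
    rfl
  set C := ∏ r : Fin N, ∏ s ∈ Finset.univ.filter (fun s : Fin N => r < s),
    PlanePartition.macMahon (q ^ N)
      (PlanePartition.fibreProd (PlanePartition.fibreParam q p) r s) ^ 2 with hC
  have hC0 : C ≠ 0 := by
    refine Finset.prod_ne_zero_iff.2 fun r _ => Finset.prod_ne_zero_iff.2 fun s hs =>
      pow_ne_zero 2 (PlanePartition.macMahon_ne_zero hb1 fun j => ?_)
    exact_mod_cast PlanePartition.fibreProd_mul_zpow_ne_one hN0 hq0 hq1 p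
      (Finset.mem_filter.1 hs).2 (j + 1 : ℕ)
  have hterm := fun lam : Fin N → YoungDiagram =>
    PlanePartition.stringWeight_sq_mul hN hp hq0 hq1 Q lam
  have hinst := PlanePartition.summable_instantonWeight_sq hN0 hp hq0 hq1 hQ
  refine ⟨fun lam => ?_, fun r s _ => ?_, hinst, ?_, ?_⟩
  · obtain ⟨F, hF, hF1, -⟩ := hcont lam
    exact ⟨F, hF, hF1⟩
  · rw [hprod]
    exact (hM _).mul (hM _)
  · rw [← summable_mul_left_iff hC0]
    exact hinst.congr fun lam => (hterm lam).symm
  · rw [PlanePartition.stringAmplitude, tsum_congr fun lam => (hterm lam).symm, tsum_mul_left]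
    simp only [htprod]
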